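/- **Theorem.** *Setting.* Vehicles $1,\dots ,n$ move on a road whose centre line is a plane curve parametrized by arc length $s\in\mathbb R$, with tangent angle $\theta^r(s)$ and differentiable signed curvature $\chi^r(s)=d\theta^r/ds$. The road edges lie at lateral distance $w$ on both sides, $w>\epsilon_w>0$, and $w\,|\chi^r(s)|<1$ for all $s$. Each vehicle obeys the second-order kinematic bicycle model $$\dot p_{xi}=v_i\cos\theta_i,\quad \dot p_{yi}=v_i\sin\theta_i,\quad \dot v_i=a_i,\quad \dot\theta_i=v_i\chi_i .$$ Let $s_i$ be the arc length of the (continuously moving) orthogonal projection of vehicle $i$ on the centre line, $\tilde y_i$ its signed lateral displacement (positive to the left), $\chi_i^r=\chi^r(s_i)$, $\tilde\theta_i=\theta_i-\theta^r(s_i)$, and $v_i^r=\dfrac{v_i\cos\tilde\theta_i}{1-\chi_i^r\tilde y_i}$ the speed of the projection. Put $$d_i^{\eta_L}=w-\tilde y_i-\epsilon_w,\quad d_i^{\eta_R}=w+\tilde y_i-\epsilon_w,\quad e_i=s_{i-1}-s_i,\quad d_i^\rho=e_i-\epsilon,\quad \nu_i=v_{i-1}^r-v_i^r .$$ The leader $1$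 is in its desired configuration for all times: $\tilde y_1=0$, $\tilde\theta_1=0$, $v_1=v^*>0$ constant, $s_1=s_1^*$. The desired configuration of vehicle $i\ge 2$ is $\tilde y_i=\tilde\theta_i=0$, $v_i^*=v^*$, $s_i^*=s_{i-1}^*-e_i^*$ with constants $e_i^*>L_i+\epsilon$, where $L_i>0$ is the wheel base and $\epsilon>0$ a safe margin. With gains $k,k_1,\dots ,k_6>0$, the followers $i\ge2$ use the lateral law $$\chi_i=-k_1\frac{\sin\tilde\theta_i}{\tilde\theta_i}\tilde y_i-k_2\,\mathrm{sign}(v_i)\tilde\theta_i+\frac{\chi_i^r\cos\tilde\theta_i}{1-\chi_i^r\tilde y_i}-k_3\Bigl(\frac1{d_i^{\eta_L}}+\frac1{d_i^{\eta_R}}\Bigr)\mathrm{sign}(v_i)\sin\tilde\theta_i$$ (with $\sin\theta/\theta=1$ at $\theta=0$; the last term is $-k_3\bigl(\frac{(d_i^{\eta_R})'}{d_i^{\eta_R}}-\frac{(d_i^{\eta_L})'}{d_i^{\eta_L}}\bigr)$, where $'$ is the derivative in the curvilinear abscissa $\sigma=\int|v_i|\,dt$), and the longitudinal law obtained from $a_1^r=0$,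 $a_i^r=k_4(e_i-e_i^*)+k_5\nu_i+a_{i-1}^r+k_6\,\nu_i/d_i^\rho$ by $$a_i=\frac{1}{\cos\tilde\theta_i}\Bigl(a_i^r(1-\chi_i^r\tilde y_i)+v_i\sin\tilde\theta_i\,\dot{\tilde\theta}_i-v_i^r(\dot\chi_i^r\tilde y_i+\chi_i^r\dot{\tilde y}_i)\Bigr)-k\Bigl(v_i^r\frac{1-\chi_i^r\tilde y_i}{\cos\tilde\theta_i}-v_i\Bigr),$$ where $\dot{\tilde y}_i=v_i\sin\tilde\theta_i$, $\dot{\tilde\theta}_i=v_i\bigl(\chi_i-\frac{\chi_i^r\cos\tilde\theta_i}{1-\chi_i^r\tilde y_i}\bigr)$ and $\dot\chi_i^r=\frac{d\chi^r}{ds}(s_i)\,v_i^r$. Let $0<\epsilon_1<\pi/2$. Call an initial condition *safe* if the leader is in its desired configuration and for every $i\ge2$: $d_i^\rho(0)>0$, $d_i^{\eta_L}(0)>0$, $d_i^{\eta_R}(0)>0$ and $k_1\tilde y_i(0)^2+\tilde\theta_i(0)^2<(\pi/2-\epsilon_1)^2$. *Claims.* From every safe initial condition the closed-loop system has a solution for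 all $t\ge0$. Along every solution on an interval $[0,T)$, $0<T\le\infty$, with safe initial condition, for all $i\ge2$ and $t\in[0,T)$: 1. $|\tilde\theta_i|<\pi/2$, $|\chi_i^r|\,|\tilde y_i|<1$ (that is, $|\tilde y_i|<1/|\chi_i^r|$), and $d_i^\rho$, $d_i^{\eta_L}$, $d_i^{\eta_R}$ are positive; 2. the controls $\chi_i$ and $a_i$ are well defined (no denominator vanishes); $\chi_i$ is bounded on $[0,T)$, and so is $a_i$ provided that $d\chi^r/ds$ is bounded on the set of arc lengths $s_i(t)$, $t\in[0,T)$. Moreover, for all $i\ge 2$, among the solutions on $[0,\infty)$ with safe initial condition, 3. the origins of $(\tilde y_i,\tilde\theta_i)$ and of $(s_i-s_i^*,\,v_i-v_i^*)$ are asymptotically stable: both errors tend to $0$ along every such solution; for every $\eta>0$ there is $\delta>0$ such that $\|(\tilde y_i,\tilde\theta_i)(0)\|<\delta$ implies $\|(\tilde y_i,\tilde\theta_i)(t)\|<\eta$ for all $t\ge0$; and for every $\eta>0$ there is $\delta>0$ such that, if the initial errors $(\tilde y_j,\tilde\theta_j)$, $(s_j-s_j^*,v_j-v_j^*)$ of the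 vehicles $2\le j\le i$ on which vehicle $i$ depends are all smaller than $\delta$, then $\|(s_i-s_i^*,v_i-v_i^*)(t)\|<\eta$ for all $t\ge0$. -/

import Mathlib

open Real Set Filter Topology

noncomputable section

namespace Platoon

/-- A curved road: the centre line, parametrized by its arc length `s ∈ ℝ`, given by its
coordinates `(cx s, cy s)`, its tangent angle `ang s` and its signed curvature `curv s`
(`= χ^r`). The two road edges are at lateral distance `w` on either side, `epsw` is the lateral
safe margin. -/
structure Road where
  cx : ℝ → ℝ
  cy : ℝ → ℝ
  ang : ℝ → ℝ
  curv : ℝ → ℝ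
  w : ℝ
  epsw : ℝ
  cx_deriv : ∀ s, HasDerivAt cx (cos (ang s)) s
  cy_deriv : ∀ s, HasDerivAt cy (sin (ang s)) s
  ang_deriv : ∀ s, HasDerivAt ang (curv s) s
  curv_diff : Differentiable ℝ curv
  epsw_pos : 0 < epsw
  epsw_lt : epsw < w
  /-- `w < 1 / |χ^r|`, including the straight parts `χ^r = 0`. -/
  curv_lt : ∀ s, w * |curv s| < 1

/-- Number of vehicles, control gains, margins and the desired formation.
Vehicles are numbered `1, …, n`; vehicle `1` is the leader, vehicle `i ≥ 2` follows `i - 1`. -/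
structure Params where
  n : ℕ
  k1 : ℝ
  k2 : ℝ
  k3 : ℝ
  k4 : ℝ
  k5 : ℝ
  k6 : ℝ
  /-- gain `k` of the correction term of the acceleration law -/
  k : ℝ
  /-- longitudinal safe margin `ε` -/
  eps : ℝ
  eps1 : ℝ
  /-- desired platoon speed `v^*` -/
  vstar : ℝ
  /-- wheel bases `L_i` -/
  L : ℕ → ℝ
  /-- desired arc-length spacings `e_i^* = s_{i-1}^* - s_i^*` -/
  estar : ℕ → ℝ
  n_pos : 1 ≤ n
  k1_pos : 0 < k1
  k2_pos : 0 < k2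
  k3_pos : 0 < k3
  k4_pos : 0 < k4
  k5_pos : 0 < k5
  k6_pos : 0 < k6
  k_pos : 0 < k
  eps_pos : 0 < eps
  eps1_pos : 0 < eps1
  eps1_lt : eps1 < π / 2
  vstar_pos : 0 < vstar
  L_pos : ∀ i ∈ Finset.Icc 2 n, 0 < L i
  estar_gt : ∀ i ∈ Finset.Icc 2 n, L i + eps < estar i

/-- State of one vehicle: position `(px, py)` of the rear axle in the world frame, orientation
`th`, speed `v`, together with the arc length `s` of its orthogonal projection onto the centre
line and its signed lateral displacement `y` (`= ỹ`), positive to the left. -/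
structure VehicleState where
  px : ℝ
  py : ℝ
  th : ℝ
  v : ℝ
  s : ℝ
  y : ℝ

/-- State of all vehicles; only the entries `1, …, n` are ever used. -/
abbrev State := ℕ → VehicleState

variable (R : Road) (P : Params)

/-- `(s, y)` are path coordinates of the vehicle: its position is the centre-line point of arc
length `s` moved by `y` along the left unit normal. -/
def Projects (x : VehicleState) : Prop :=
  x.px = R.cx x.s - x.y * sin (R.ang x.s) ∧ x.py = R.cy x.s + x.y * cos (R.ang x.s)

/-- orientation error `θ̃ = θ - θ^r` -/
def thErr (x : VehicleState) : ℝ := x.th - R.ang x.s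

/-- speed `v^r = v cos θ̃ / (1 - χ^r ỹ)` of the virtual vehicle, the projection on the path -/
def vVirt (x : VehicleState) : ℝ :=
  x.v * cos (thErr R x) / (1 - R.curv x.s * x.y)

/-- distance to the left road edge, minus the margin -/
def dL (x : VehicleState) : ℝ := R.w - x.y - R.epsw

/-- distance to the right road edge, minus the margin -/
def dR (x : VehicleState) : ℝ := R.w + x.y - R.epsw

/-- nominal lateral control `χ_i^n` (`sinc θ = sin θ / θ`, with value `1` at `0`) -/
def chiNom (x : VehicleState) : ℝ :=
  -P.k1 * sinc (thErr R x) * x.y - P.k2 * Real.sign x.v * thErr R x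
    + R.curv x.s * cos (thErr R x) / (1 - R.curv x.s * x.y)

/-- derivative of `dL` with respect to the curvilinear abscissa `σ = ∫ |v| dt` -/
def dLσ (x : VehicleState) : ℝ := -(Real.sign x.v * sin (thErr R x))

/-- derivative of `dR` with respect to the curvilinear abscissa `σ = ∫ |v| dt` -/
def dRσ (x : VehicleState) : ℝ := Real.sign x.v * sin (thErr R x)

/-- lateral constructive barrier feedback `χ_i^c` -/
def chiBar (x : VehicleState) : ℝ :=
  -P.k3 * (dRσ R x / dR R x - dLσ R x / dL R x)

/-- the lateral control law `χ_i` -/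
def chi (x : VehicleState) : ℝ := chiNom R P x + chiBar R P x

/-- inter-vehicle arc length `e_i = s_{i-1} - s_i` -/
def gap (X : State) (i : ℕ) : ℝ := (X (i - 1)).s - (X i).s

/-- relative virtual speed `ν_i = v_{i-1}^r - v_i^r` -/
def nu (X : State) (i : ℕ) : ℝ := vVirt R (X (i - 1)) - vVirt R (X i)

/-- longitudinal safety distance `d_i^ρ = e_i - ε` -/
def dRho (X : State) (i : ℕ) : ℝ := gap X i - P.eps

/-- virtual acceleration `a_i^r`: zero for the leader, which moves at constant speed; for a
follower the nominal term plus the constructive barrier feedback `k₆ ḋ_i^ρ / d_i^ρ`, where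
`ḋ_i^ρ = ν_i`. -/
def aVirt (X : State) : ℕ → ℝ
  | 0 => 0
  | 1 => 0
  | i + 2 =>
      (P.k4 * (gap X (i + 2) - P.estar (i + 2)) + P.k5 * nu R X (i + 2) + aVirt X (i + 1))
        + P.k6 * (nu R X (i + 2) / dRho P X (i + 2))

/-- the rate of `ỹ` : `v sin θ̃` -/
def yRate (x : VehicleState) : ℝ := x.v * sin (thErr R x)

/-- the rate of `θ̃` under the lateral law: `v (χ - χ^r cos θ̃ / (1 - χ^r ỹ))` -/
def thErrRate (x : VehicleState) : ℝ :=
  x.v * (chi R P x - R.curv x.s * cos (thErr R x) / (1 - R.curv x.s * x.y))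

/-- the rate of `χ^r`, the curvature at the virtual vehicle: `(dχ^r/ds) v^r` -/
def curvRate (x : VehicleState) : ℝ := deriv R.curv x.s * vVirt R x

/-- the acceleration law `a_i` of follower `i`, recovered from `a_i^r` -/
def acc (X : State) (i : ℕ) : ℝ :=
  1 / cos (thErr R (X i)) *
      (aVirt R P X i * (1 - R.curv (X i).s * (X i).y)
        + (X i).v * sin (thErr R (X i)) * thErrRate R P (X i)
        - vVirt R (X i) * (curvRate R (X i) * (X i).y + R.curv (X i).s * yRate R (X i)))
    - P.k * (vVirt R (X i) * ((1 - R.curv (X i).s * (X i).y) / cos (thErr R (X i))) - (X i).v)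

/-- None of the divisions in the control laws of follower `i` is by zero. -/
def ControlsDefined (X : State) (i : ℕ) : Prop :=
  cos (thErr R (X i)) ≠ 0 ∧ 1 - R.curv (X i).s * (X i).y ≠ 0 ∧ dL R (X i) ≠ 0 ∧ dR R (X i) ≠ 0 ∧
    (∀ j ∈ Finset.Icc 2 i, dRho P X j ≠ 0) ∧
    (∀ j ∈ Finset.Icc 1 i, 1 - R.curv (X j).s * (X j).y ≠ 0)

/-- The second-order kinematic bicycle model with acceleration `a` and curvature `χ` on `J`. -/
def IsBicycle (x : ℝ → VehicleState) (a χ : ℝ → ℝ) (J : Set ℝ) : Prop :=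
  ∀ t ∈ J,
    HasDerivWithinAt (fun τ => (x τ).px) ((x t).v * cos (x t).th) J t ∧
    HasDerivWithinAt (fun τ => (x τ).py) ((x t).v * sin (x t).th) J t ∧
    HasDerivWithinAt (fun τ => (x τ).v) (a t) J t ∧
    HasDerivWithinAt (fun τ => (x τ).th) ((x t).v * χ t) J t

/-- The vehicle stands on the centre line, along it and with speed `v^*`. -/
def OnTrack (x : VehicleState) : Prop := x.y = 0 ∧ thErr R x = 0 ∧ x.v = P.vstar

/-- `X` is a motion of the closed-loop `n`-vehicle system on the time interval `J ∋ 0`.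
No safety property is required: at a state where a control law is singular it has an irrelevant
default value, and that such states are not reached is for the theorem to say. -/
structure IsClosedLoop (X : ℝ → State) (J : Set ℝ) : Prop where
  projects : ∀ i ∈ Finset.Icc 1 P.n, ∀ t ∈ J, Projects R (X t i)
  cont_s : ∀ i ∈ Finset.Icc 1 P.n, ContinuousOn (fun t => (X t i).s) J
  cont_y : ∀ i ∈ Finset.Icc 1 P.n, ContinuousOn (fun t => (X t i).y) J
  /-- the leader is independently controlled … -/
  leader : ∃ a χ : ℝ → ℝ, IsBicycle (fun t => X t 1) a χ J
  /-- … and is in its desired configuration, `s_1 = s_1^*` advancing at the speed `v^*` -/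
  leader_track : ∀ t ∈ J, OnTrack R P (X t 1)
  leader_s : ∀ t ∈ J, (X t 1).s = (X 0 1).s + P.vstar * t
  follower : ∀ i ∈ Finset.Icc 2 P.n,
    IsBicycle (fun t => X t i) (fun t => acc R P (X t) i) (fun t => chi R P (X t i)) J

/-- The safe initial conditions. -/
structure SafeInitial (X : State) : Prop where
  projects : ∀ i ∈ Finset.Icc 1 P.n, Projects R (X i)
  leader_track : OnTrack R P (X 1)
  rho_pos : ∀ i ∈ Finset.Icc 2 P.n, 0 < dRho P X i
  left_pos : ∀ i ∈ Finset.Icc 2 P.n, 0 < dL R (X i)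
  right_pos : ∀ i ∈ Finset.Icc 2 P.n, 0 < dR R (X i)
  lyap : ∀ i ∈ Finset.Icc 2 P.n,
    P.k1 * (X i).y ^ 2 + thErr R (X i) ^ 2 < (π / 2 - P.eps1) ^ 2

/-- Time intervals `[0, T)` with `0 < T ≤ ∞`. -/
def IsHorizon (J : Set ℝ) : Prop := J = Ici 0 ∨ ∃ T : ℝ, 0 < T ∧ J = Ico 0 T

/-- lateral error `(ỹ_i, θ̃_i)` -/
def latErr (X : State) (i : ℕ) : ℝ × ℝ := ((X i).y, thErr R (X i))

/-- desired arc length `s_i^* = s_1^* - ∑_{2 ≤ j ≤ i} e_j^*`, where `s_1^* = s_1` -/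
def sStar (X : State) (i : ℕ) : ℝ := (X 1).s - ∑ j ∈ Finset.Icc 2 i, P.estar j

/-- longitudinal error `(s_i - s_i^*, v_i - v_i^*)`, where `v_i^* = v^*` -/
def lonErr (X : State) (i : ℕ) : ℝ × ℝ := ((X i).s - sStar P X i, (X i).v - P.vstar)

/-- Motions for all times `t ≥ 0` from safe initial conditions. -/
def SafeMotion (X : ℝ → State) : Prop :=
  IsClosedLoop R P X (Ici 0) ∧ SafeInitial R P (X 0)

/-- The origin of the error `z` of vehicle `i` is asymptotically stable: it stays arbitrarily
small if the initial value of the error `z₀` that drives it is small enough (stability), and it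
converges to zero along every motion from safe initial conditions (attractivity). -/
def OriginAsymptoticallyStable {E F : Type*} [NormedAddCommGroup E] [NormedAddCommGroup F]
    (z₀ : State → F) (z : State → E) : Prop :=
  (∀ η > 0, ∃ δ > 0, ∀ X : ℝ → State, SafeMotion R P X → ‖z₀ (X 0)‖ < δ →
      ∀ t, 0 ≤ t → ‖z (X t)‖ < η) ∧
  (∀ X : ℝ → State, SafeMotion R P X → Tendsto (fun t => z (X t)) atTop (𝓝 0))

/-- All errors of the followers `2, …, i`, on which the motion of vehicle `i` depends. -/
def chainErr (i : ℕ) (X : State) : Finset.Icc 2 i → (ℝ × ℝ) × (ℝ × ℝ) :=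
  fun j => (latErr R X j, lonErr P X j)

end Platoon

end

noncomputable section

namespace Platoon

/-! ### The cardinal sine -/

/-! The acceleration law is built so that each virtual speed satisfies `d/dt v_i^r = a_i^r`. In the
difference of two consecutive virtual accelerations the recursive term cancels, so each pair `(d, ν)
= (d_i^ρ, ν_i)` obeys an autonomous planar equation: a damped spring with the extra friction `k₆ ν /
d`. The lateral error `(ỹ, θ̃)` is then driven by the speed `v_i` alone, and `v · sign v = |v|`
removes the discontinuity of the lateral law. The closed loop is thus a cascade: decoupled
longitudinal equations first, lateral ones afterwards.

Longitudinal part. The quadratic energy decreases. Adding the cross term `(d - ds) ν` and `k₆ (d -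
ds log d) + k₅/2 (d - ds)²` to a multiple of it gives a function whose derivative is at most `-2 ·
energy`, because the cross terms cancel exactly (`LonMotion.hasDeriv_lyap`). Its logarithm keeps `d`
away from zero, and its decay forces convergence (`tendsto_zero_of_strict_lyapunov`).

Lateral part. The energy `k₁ y² + θ²` decreases whatever the sign of `v`, which keeps `θ` inside the
cosine-safe range. The barrier steers back with strength `|v| |sin θ|` divided by the distance to
the edge, enough to compensate the motion towards that edge up to a bounded rate; hence the
logarithm of the edge distance falls at most linearly in time (`LatMotion.log_gap_ge`). Since the
virtual speeds tend to `v^*`, the speed is eventually bounded below by a positive constant. From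
then on a second strict Lyapunov function applies (`LatMotion.lyap_deriv_le`), the errors tend to
zero, and the edge distances are bounded below for all times.

Safety combines these a priori bounds by continuous induction (`IsClosedLoop.safe`). The inverse
function theorem supplies the differentiability of the path coordinates. Existence solves the
cascade: a vector field frozen outside a box has solutions on any bounded interval, and the same
bounds show that the box is never left (`exists_global_solution`). Stability follows from bounds of
the errors that are linear in the initial errors. -/

theorem mul_sinc (x : ℝ) : x * sinc x = sin x := by
  rcases eq_or_ne x 0 with rfl | hx
  · simp
  · rw [sinc_of_ne_zero hx]; field_simp

/-- Near zero this is the difference quotient of an analytic function, which is again analytic. The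
lateral field needs it to be Lipschitz on compact boxes. -/
theorem contDiff_sinc : ContDiff ℝ 1 sinc := by
  rw [contDiff_iff_contDiffAt]
  intro x
  rcases eq_or_ne x 0 with rfl | hx
  · have h : AnalyticAt ℝ sin (0 : ℝ) := analyticAt_sin
    obtain ⟨p, hp⟩ := h
    have := hp.has_fpower_series_dslope_fslope.analyticAt
    rw [sinc_eq_dslope]
    exact this.contDiffAt
  · have h : sinc =ᶠ[𝓝 x] fun y => sin y / y := by
      filter_upwards [isOpen_ne.mem_nhds hx] with y hy
      exact sinc_of_ne_zero hy
    exact (contDiff_sin.contDiffAt.div contDiffAt_id hx).congr_of_eventuallyEq h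

/-- Jordan's inequality gives `2 / π`, and `π ≤ 4`. -/
theorem half_le_sinc {x : ℝ} (hx : |x| ≤ π / 2) : 1 / 2 ≤ sinc x := by
  wlog h : 0 ≤ x generalizing x
  · rw [← sinc_neg]
    exact this (by rwa [abs_neg]) (by linarith)
  rcases h.eq_or_lt with rfl | h
  · norm_num
  rw [abs_of_pos h] at hx
  rw [sinc_of_ne_zero h.ne', le_div_iff₀ h]
  have h1 := mul_le_sin h.le hx
  have h2 : 1 / 2 ≤ 2 / π := by
    rw [div_le_div_iff₀ (by norm_num) pi_pos]; linarith [pi_le_four]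
  nlinarith

/-! ### Monotonicity, trapping and convergence on the half line -/

theorem le_of_right_deriv_nonpos {f f' : ℝ → ℝ} {a b : ℝ} (hab : a ≤ b)
    (hf : ContinuousOn f (Icc a b)) (hf' : ∀ t ∈ Ico a b, HasDerivWithinAt f (f' t) (Ici t) t)
    (h : ∀ t ∈ Ico a b, f' t ≤ 0) : f b ≤ f a :=
  image_le_of_deriv_right_le_deriv_boundary (B := fun _ => f a) (B' := fun _ => 0) hf hf' le_rfl
    continuousOn_const (fun _ _ => hasDerivWithinAt_const _ _ _) h (right_mem_Icc.2 hab)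

theorem le_sub_of_right_deriv_le {f f' : ℝ → ℝ} {a b c : ℝ} (hab : a ≤ b)
    (hf : ContinuousOn f (Icc a b)) (hf' : ∀ t ∈ Ico a b, HasDerivWithinAt f (f' t) (Ici t) t)
    (h : ∀ t ∈ Ico a b, f' t ≤ c) : f b ≤ f a + c * (b - a) := by
  have := le_of_right_deriv_nonpos (f := fun t => f t - c * t) (f' := fun t => f' t - c) hab
    (hf.sub (by fun_prop))
    (fun t ht => by
      have := (hf' t ht).sub ((hasDerivWithinAt_id t (Ici t)).const_mul c)
      rw [mul_one] at this
      exact this)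
    (fun t ht => by linarith [h t ht])
  linarith

/-- Continuous induction on `[0, T]`. -/
theorem trapping {S : ℝ → Prop} {T : ℝ} (h0 : S 0)
    (hopen : ∀ t ∈ Ico 0 T, S t → ∀ᶠ u in 𝓝[>] t, S u)
    (hclosed : ∀ t ∈ Ioc 0 T, (∀ u ∈ Ico 0 t, S u) → S t) : ∀ t ∈ Icc 0 T, S t := by
  by_contra! hcon
  obtain ⟨t₁, ht₁, hn⟩ := hcon
  set B : Set ℝ := {t | t ∈ Icc 0 T ∧ ¬ S t} with hB
  have hne : B.Nonempty := ⟨t₁, ht₁, hn⟩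
  have hbd : BddBelow B := ⟨0, fun x hx => hx.1.1⟩
  set c := sInf B with hc
  have hc0 : 0 ≤ c := le_csInf hne fun x hx => hx.1.1
  have hct : c ≤ t₁ := csInf_le hbd ⟨ht₁, hn⟩
  have hbelow : ∀ u ∈ Ico 0 c, S u := by
    intro u hu
    by_contra hnu
    exact absurd (csInf_le hbd (show u ∈ B from ⟨⟨hu.1, hu.2.le.trans (hct.trans ht₁.2)⟩, hnu⟩))
      (not_le.2 hu.2)
  have hSc : S c := by
    rcases hc0.eq_or_lt with h | h
    · rwa [← h]
    · exact hclosed c ⟨h, hct.trans ht₁.2⟩ hbelow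
  have hlt : c < T := by
    rcases (hct.trans ht₁.2).eq_or_lt with h | h
    · have : c = t₁ := le_antisymm hct (h ▸ ht₁.2)
      exact absurd (this ▸ hSc) hn
    · exact h
  obtain ⟨d, hd, hd'⟩ := mem_nhdsGT_iff_exists_Ioo_subset.1 (hopen c ⟨hc0, hlt⟩ hSc)
  obtain ⟨b, hb, hbd'⟩ := exists_lt_of_csInf_lt hne (show sInf B < d from hd)
  rcases (csInf_le hbd hb).eq_or_lt with h | h
  · exact hb.2 (h ▸ hSc)
  · exact hb.2 (hd' ⟨h, hbd'⟩)

/-- A nonincreasing `V ≥ 0` tends to zero if some function bounded below decreases at a rate of at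
least `c V`. -/
theorem tendsto_zero_of_strict_lyapunov {V U U' : ℝ → ℝ} {t₀ c m : ℝ} (hc : 0 < c)
    (hV : ∀ t, t₀ ≤ t → 0 ≤ V t) (hmono : ∀ s t, t₀ ≤ s → s ≤ t → V t ≤ V s)
    (hU : ContinuousOn U (Ici t₀)) (hUm : ∀ t, t₀ ≤ t → m ≤ U t)
    (hU' : ∀ t, t₀ ≤ t → HasDerivWithinAt U (U' t) (Ici t) t)
    (hle : ∀ t, t₀ ≤ t → U' t ≤ -(c * V t)) : Tendsto V atTop (𝓝 0) := by
  have key : ∀ t, t₀ < t → V t ≤ (U t₀ - m) / c * (t - t₀)⁻¹ := by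
    intro t ht
    -- As `V` is nonincreasing, `V u ≥ V t` up to time `t`, so `U` has lost at least `c V t (t -
    -- t₀)`; its lower bound `m` limits this loss.
    have h1 := le_sub_of_right_deriv_le (c := -(c * V t)) ht.le (hU.mono Icc_subset_Ici_self)
      (fun u hu => hU' u hu.1)
      (fun u hu => (hle u hu.1).trans (by nlinarith [hmono u t hu.1 hu.2.le]))
    have h2 := hUm t ht.le
    rw [div_mul_eq_mul_div, ← div_eq_mul_inv, div_div, le_div_iff₀ (by nlinarith)]
    nlinarith
  have hlim : Tendsto (fun t => (U t₀ - m) / c * (t - t₀)⁻¹) atTop (𝓝 0) := by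
    have := (tendsto_inv_atTop_zero (𝕜 := ℝ)).comp (tendsto_atTop_add_const_right atTop (-t₀) tendsto_id)
    simpa [sub_eq_add_neg] using this.const_mul ((U t₀ - m) / c)
  refine tendsto_of_tendsto_of_tendsto_of_le_of_le' tendsto_const_nhds hlim ?_ ?_
  · filter_upwards [eventually_ge_atTop t₀] with t ht using hV t ht
  · filter_upwards [eventually_gt_atTop t₀] with t ht using key t ht

/-! ### Global solutions of planar differential equations confined to boxes -/

theorem lipschitzWith_clamp {a b : ℝ × ℝ} (h₁ : a.1 ≤ b.1) (h₂ : a.2 ≤ b.2) :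
    LipschitzWith 1 fun x : ℝ × ℝ =>
      ((projIcc a.1 b.1 h₁ x.1 : ℝ), (projIcc a.2 b.2 h₂ x.2 : ℝ)) := by
  have hp : ∀ {a b : ℝ} (h : a ≤ b), LipschitzWith 1 fun x : ℝ => (projIcc a b h x : ℝ) :=
    fun h => by
    have := (LipschitzWith.subtype_val (Icc _ _)).comp (LipschitzWith.projIcc h)
    rw [one_mul] at this
    exact this
  have h1 := (hp h₁).comp (LipschitzWith.prod_fst (α := ℝ) (β := ℝ))
  have h2 := (hp h₂).comp (LipschitzWith.prod_snd (α := ℝ) (β := ℝ))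
  simpa using h1.prodMk h2

/-- Leaving the interior would require a first exit time, at which the a priori estimate `hconf`
still places the curve in the interior. The equation is required only inside the box, so the lemma
also covers solutions of a field modified outside it. -/
theorem mem_interior_box_of_confined {f : ℝ → ℝ × ℝ → ℝ × ℝ} {x₀ a b : ℝ × ℝ} {T : ℝ}
    (hx₀ : x₀ ∈ interior (Icc a b))
    (hconf : ∀ (γ : ℝ → ℝ × ℝ) (τ : ℝ), 0 ≤ τ → τ ≤ T → γ 0 = x₀ → ContinuousOn γ (Icc 0 τ) →
      (∀ t ∈ Icc 0 τ, γ t ∈ Icc a b) →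
      (∀ t ∈ Ico 0 τ, HasDerivWithinAt γ (f t (γ t)) (Ici t) t) → γ τ ∈ interior (Icc a b))
    {γ : ℝ → ℝ × ℝ} (h0 : γ 0 = x₀) (hc : ContinuousOn γ (Icc 0 T))
    (hd : ∀ t ∈ Ico 0 T, γ t ∈ Icc a b → HasDerivWithinAt γ (f t (γ t)) (Ici t) t) :
    ∀ t ∈ Icc 0 T, γ t ∈ interior (Icc a b) := by
  refine trapping (by rwa [h0]) ?_ ?_
  · intro t ht hS
    have h1 : ContinuousWithinAt γ (Icc t T) t :=
      (hc t ⟨ht.1, ht.2.le⟩).mono (Icc_subset_Icc_left ht.1)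
    have h2 : 𝓝[>] t ≤ 𝓝[Icc t T] t := by
      rw [← nhdsWithin_Ioc_eq_nhdsGT ht.2]
      exact nhdsWithin_mono _ Ioc_subset_Icc_self
    exact h2 (h1.eventually_mem (isOpen_interior.mem_nhds hS))
  · intro t ht hS
    have hIco : ∀ u ∈ Ico 0 t, γ u ∈ Icc a b := fun u hu => interior_subset (hS u hu)
    have hct := hc.mono (Icc_subset_Icc_right ht.2)
    refine hconf γ t ht.1.le ht.2 h0 hct ?_ ?_
    · intro u hu
      rcases hu.2.eq_or_lt with rfl | h
      · have h3 : Tendsto γ (𝓝[<] u) (𝓝 (γ u)) := by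
          rw [← nhdsWithin_Ico_eq_nhdsLT ht.1]
          exact (hct u (right_mem_Icc.2 ht.1.le)).mono Ico_subset_Icc_self
        refine isClosed_Icc.mem_of_tendsto h3 ?_
        filter_upwards [Ico_mem_nhdsLT ht.1] with s hs using hIco s hs
      · exact hIco u ⟨hu.1, h⟩
    · intro u hu
      exact hd u ⟨hu.1, hu.2.trans_le ht.2⟩ (hIco u hu)

/-- Composing the field with the retraction onto the box makes it bounded and globally Lipschitz;
confinement shows that the solution never meets the modification. -/
theorem exists_solution_Icc {f : ℝ → ℝ × ℝ → ℝ × ℝ} {x₀ a b : ℝ × ℝ} {T : ℝ} (hT : 0 ≤ T)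
    (hlip : ∃ K, ∀ t ∈ Icc 0 T, LipschitzOnWith K (f t) (Icc a b))
    (hcont : ∀ x ∈ Icc a b, ContinuousOn (fun t => f t x) (Icc 0 T))
    (hx₀ : x₀ ∈ interior (Icc a b))
    (hconf : ∀ (γ : ℝ → ℝ × ℝ) (τ : ℝ), 0 ≤ τ → τ ≤ T → γ 0 = x₀ → ContinuousOn γ (Icc 0 τ) →
      (∀ t ∈ Icc 0 τ, γ t ∈ Icc a b) →
      (∀ t ∈ Ico 0 τ, HasDerivWithinAt γ (f t (γ t)) (Ici t) t) → γ τ ∈ interior (Icc a b)) :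
    ∃ γ : ℝ → ℝ × ℝ, γ 0 = x₀ ∧ (∀ t ∈ Icc 0 T, γ t ∈ interior (Icc a b)) ∧
      ∀ t ∈ Icc 0 T, HasDerivWithinAt γ (f t (γ t)) (Icc 0 T) t := by
  obtain ⟨K, hK⟩ := hlip
  have hx := interior_subset hx₀
  have h₁ : a.1 ≤ b.1 := hx.1.1.trans hx.2.1
  have h₂ : a.2 ≤ b.2 := hx.1.2.trans hx.2.2
  set ρ : ℝ × ℝ → ℝ × ℝ := fun x =>
      ((projIcc a.1 b.1 h₁ x.1 : ℝ), (projIcc a.2 b.2 h₂ x.2 : ℝ)) with hρ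
  have hρl : LipschitzWith 1 ρ := lipschitzWith_clamp h₁ h₂
  have hρm : ∀ x, ρ x ∈ Icc a b := fun x =>
    ⟨⟨(projIcc a.1 b.1 h₁ x.1).2.1, (projIcc a.2 b.2 h₂ x.2).2.1⟩,
      ⟨(projIcc a.1 b.1 h₁ x.1).2.2, (projIcc a.2 b.2 h₂ x.2).2.2⟩⟩
  have hρid : ∀ x ∈ Icc a b, ρ x = x := fun x hx => by
    simp only [hρ]
    rw [projIcc_of_mem h₁ ⟨hx.1.1, hx.2.1⟩, projIcc_of_mem h₂ ⟨hx.1.2, hx.2.2⟩]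
  obtain ⟨C, hC⟩ := isCompact_Icc.exists_bound_of_continuousOn (hcont x₀ hx)
  obtain ⟨D, hD⟩ := (isCompact_Icc (a := a) (b := b)).isBounded.exists_norm_le
  have hC0 : 0 ≤ C := (norm_nonneg _).trans (hC 0 (left_mem_Icc.2 hT))
  have hD0 : 0 ≤ D := (norm_nonneg _).trans (hD x₀ hx)
  have hbound : ∀ t ∈ Icc 0 T, ∀ x, ‖f t (ρ x)‖ ≤ C + K * (D + D) := by
    intro t ht x
    have h1 := (hK t ht).norm_sub_le (hρm x) hx
    have h2 : ‖ρ x - x₀‖ ≤ D + D := (norm_sub_le _ _).trans (add_le_add (hD _ (hρm x)) (hD _ hx))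
    have h3 := hC t ht
    calc ‖f t (ρ x)‖ = ‖f t x₀ + (f t (ρ x) - f t x₀)‖ := by congr 1; abel
      _ ≤ ‖f t x₀‖ + ‖f t (ρ x) - f t x₀‖ := norm_add_le _ _
      _ ≤ C + K * (D + D) := add_le_add h3 (h1.trans (by gcongr))
  have hL0 : 0 ≤ C + K * (D + D) := by positivity
  -- The ball has radius speed bound times `T`, so Picard–Lindelöf covers all of `[0, T]` at once.
  have hPL : IsPicardLindelof (fun t x => f t (ρ x)) (⟨0, left_mem_Icc.2 hT⟩ : Icc 0 T) x₀
      (⟨(C + K * (D + D)) * T, mul_nonneg hL0 hT⟩ : NNReal) 0 ⟨C + K * (D + D), hL0⟩ K := by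
    refine ⟨fun t ht => ?_, fun x _ => hcont _ (hρm x), fun t ht x _ => hbound t ht x, ?_⟩
    · have := (hK t ht).comp (hρl.lipschitzOnWith (s := Metric.closedBall x₀
        ((⟨(C + K * (D + D)) * T, mul_nonneg hL0 hT⟩ : NNReal) : ℝ))) (fun x _ => hρm x)
      rw [mul_one] at this
      exact this
    · simp only [sub_zero, sub_self, NNReal.coe_zero]
      rw [max_eq_left hT]
      exact le_rfl
  obtain ⟨γ, h0, hγ⟩ := hPL.exists_eq_forall_mem_Icc_hasDerivWithinAt₀
  have hmem := mem_interior_box_of_confined hx₀ hconf h0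
    (fun t ht => (hγ t ht).continuousWithinAt) (fun t ht hm => by
      have := hγ t ⟨ht.1, ht.2.le⟩
      rw [hρid _ hm] at this
      exact this.mono_of_mem_nhdsWithin (mem_of_superset (Icc_mem_nhdsGE ht.2)
        (Icc_subset_Icc_left ht.1)))
  refine ⟨γ, h0, hmem, fun t ht => ?_⟩
  have := hγ t ht
  rwa [hρid _ (interior_subset (hmem t ht))] at this

/-- Solutions on integer horizons are glued by uniqueness. The box may vary with `T` because the a
priori bounds for the edge distances deteriorate with time. -/
theorem exists_global_solution {f : ℝ → ℝ × ℝ → ℝ × ℝ} {x₀ : ℝ × ℝ} {a b : ℝ → ℝ × ℝ}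
    (hlip : ∀ T, 0 ≤ T → ∃ K, ∀ t ∈ Icc 0 T, LipschitzOnWith K (f t) (Icc (a T) (b T)))
    (hcont : ∀ T, 0 ≤ T → ∀ x ∈ Icc (a T) (b T), ContinuousOn (fun t => f t x) (Icc 0 T))
    (hx₀ : ∀ T, 0 ≤ T → x₀ ∈ interior (Icc (a T) (b T)))
    (hconf : ∀ T, 0 ≤ T → ∀ (γ : ℝ → ℝ × ℝ) (τ : ℝ), 0 ≤ τ → τ ≤ T → γ 0 = x₀ →
      ContinuousOn γ (Icc 0 τ) → (∀ t ∈ Icc 0 τ, γ t ∈ Icc (a T) (b T)) →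
      (∀ t ∈ Ico 0 τ, HasDerivWithinAt γ (f t (γ t)) (Ici t) t) →
      γ τ ∈ interior (Icc (a T) (b T))) :
    ∃ γ : ℝ → ℝ × ℝ, γ 0 = x₀ ∧ (∀ t, 0 ≤ t → ∃ T, t ≤ T ∧ γ t ∈ Icc (a T) (b T)) ∧
      ∀ t, 0 ≤ t → HasDerivWithinAt γ (f t (γ t)) (Ici 0) t := by
  have hT : ∀ n : ℕ, (0 : ℝ) ≤ n + 1 := fun n => by positivity
  choose g g0 gmem gd using fun n : ℕ => exists_solution_Icc (hT n) (hlip _ (hT n))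
    (hcont _ (hT n)) (hx₀ _ (hT n)) (hconf _ (hT n))
  have gd' : ∀ n : ℕ, ∀ t ∈ Ico (0 : ℝ) (n + 1),
      HasDerivWithinAt (g n) (f t (g n t)) (Ici t) t := fun n t ht =>
    (gd n t ⟨ht.1, ht.2.le⟩).mono_of_mem_nhdsWithin (mem_of_superset (Icc_mem_nhdsGE ht.2)
        (Icc_subset_Icc_left ht.1))
  have gc : ∀ n : ℕ, ContinuousOn (g n) (Icc (0 : ℝ) (n + 1)) := fun n t ht =>
    (gd n t ht).continuousWithinAt
  have hagree : ∀ n m : ℕ, n ≤ m → ∀ t ∈ Icc (0 : ℝ) (n + 1), g n t = g m t := by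
    intro n m hnm
    have hle : (n : ℝ) + 1 ≤ m + 1 := by gcongr
    obtain ⟨K, hK⟩ := hlip _ (hT n)
    have hcm := (gc m).mono (Icc_subset_Icc_right hle)
    have hdm : ∀ t ∈ Ico (0 : ℝ) (n + 1), HasDerivWithinAt (g m) (f t (g m t)) (Ici t) t :=
      fun t ht => gd' m t ⟨ht.1, ht.2.trans_le hle⟩
    -- The boxes of different horizons need not be nested: confinement puts the longer solution into
    -- the box of the shorter one, where the Lipschitz bound yields uniqueness.
    have hmm := mem_interior_box_of_confined (hx₀ _ (hT n)) (hconf _ (hT n)) (g0 m) hcm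
      (fun t ht _ => hdm t ht)
    exact ODE_solution_unique_of_mem_Icc_right (s := fun _ => Icc (a (n + 1)) (b (n + 1)))
      (fun t ht => hK t ⟨ht.1, ht.2.le⟩) (gc n) (gd' n)
      (fun t ht => interior_subset (gmem n t ⟨ht.1, ht.2.le⟩)) hcm hdm
      (fun t ht => interior_subset (hmm t ⟨ht.1, ht.2.le⟩)) (by rw [g0, g0])
  have heq : ∀ (n : ℕ) (t : ℝ), 0 ≤ t → t < n + 1 → g ⌊t⌋₊ t = g n t := by
    intro n t ht htn
    refine hagree _ _ ?_ t ⟨ht, (Nat.lt_floor_add_one t).le⟩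
    have : (⌊t⌋₊ : ℝ) < n + 1 := (Nat.floor_le ht).trans_lt htn
    exact Nat.lt_succ_iff.1 (by exact_mod_cast this)
  -- The solution `g n` lives up to time `n + 1`, so `t` lies strictly before the end of the piece
  -- `g ⌊t⌋₊`, which leaves room for the derivative.
  refine ⟨fun t => g ⌊t⌋₊ t, ?_, ?_, ?_⟩
  · simp [g0]
  · intro t ht
    exact ⟨_, (Nat.lt_floor_add_one t).le,
      interior_subset (gmem ⌊t⌋₊ t ⟨ht, (Nat.lt_floor_add_one t).le⟩)⟩
  · intro t ht
    have htn := Nat.lt_floor_add_one t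
    have h1 : HasDerivWithinAt (g ⌊t⌋₊) (f t (g ⌊t⌋₊ t)) (Ici 0) t :=
      (gd ⌊t⌋₊ t ⟨ht, htn.le⟩).mono_of_mem_nhdsWithin (by
        rw [← Ici_inter_Iic]
        exact inter_mem self_mem_nhdsWithin (mem_nhdsWithin_of_mem_nhds (Iic_mem_nhds htn)))
    refine h1.congr_of_eventuallyEq ?_ rfl
    filter_upwards [self_mem_nhdsWithin, mem_nhdsWithin_of_mem_nhds (Iio_mem_nhds htn)] with u hu hu'
    exact heq _ u hu hu'

/-! ### The inter-vehicle dynamics -/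

/-- On `[a, b]` the distance `d > 0` and its rate `ν` obey the closed-loop longitudinal dynamics with
desired distance `ds`. -/
structure LonMotion (P : Params) (ds : ℝ) (d ν : ℝ → ℝ) (a b : ℝ) : Prop where
  cont_d : ContinuousOn d (Icc a b)
  cont_nu : ContinuousOn ν (Icc a b)
  pos : ∀ t ∈ Icc a b, 0 < d t
  deriv_d : ∀ t ∈ Ico a b, HasDerivWithinAt d (ν t) (Ici t) t
  deriv_nu : ∀ t ∈ Ico a b,
    HasDerivWithinAt ν (-(P.k4 * (d t - ds) + P.k5 * ν t + P.k6 * (ν t / d t))) (Ici t) t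

def lonEnergy (P : Params) (ds d ν : ℝ) : ℝ := (ν ^ 2 + P.k4 * (d - ds) ^ 2) / 2

/-- The summands `1` and `1 / k₄` let the energy dominate the cross term `(d - ds) ν`; the summand
`2 / k₅` lets the damping absorb the `ν²` that this cross term produces on differentiation. -/
def lonGain (P : Params) : ℝ := 2 / P.k5 + 1 + 1 / P.k4

/-- A strict Lyapunov function of the longitudinal dynamics, infinite at contact. -/
def lonLyap (P : Params) (ds d ν : ℝ) : ℝ :=
  lonGain P * lonEnergy P ds d ν + (d - ds) * ν + P.k6 * (d - ds * log d) + P.k5 / 2 * (d - ds) ^ 2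

theorem one_le_lonGain (P : Params) : 1 ≤ lonGain P := by
  have := P.k5_pos; have := P.k4_pos
  have h1 : 0 ≤ 2 / P.k5 := by positivity
  have h2 : 0 ≤ 1 / P.k4 := by positivity
  unfold lonGain; linarith

theorem one_le_lonGain_mul_k4 (P : Params) : 1 ≤ lonGain P * P.k4 := by
  have h5 := P.k5_pos; have h4 := P.k4_pos
  have h1 : 0 ≤ 2 / P.k5 * P.k4 := by positivity
  have h2 : 1 / P.k4 * P.k4 = 1 := by field_simp
  unfold lonGain; nlinarith

theorem two_le_lonGain_mul_k5 (P : Params) : 2 ≤ lonGain P * P.k5 := by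
  have h5 := P.k5_pos; have h4 := P.k4_pos
  have h1 : 0 ≤ 1 / P.k4 * P.k5 := by positivity
  have h2 : 2 / P.k5 * P.k5 = 2 := by field_simp
  unfold lonGain; nlinarith

theorem lonEnergy_nonneg (P : Params) (ds d ν : ℝ) : 0 ≤ lonEnergy P ds d ν := by
  have := P.k4_pos
  unfold lonEnergy; positivity

theorem lonGain_energy_cross_nonneg (P : Params) (ds d ν : ℝ) :
    0 ≤ lonGain P * lonEnergy P ds d ν + (d - ds) * ν := by
  have h1 := one_le_lonGain P
  have h2 := one_le_lonGain_mul_k4 P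
  unfold lonEnergy
  nlinarith [sq_nonneg (d - ds + ν), mul_nonneg (sub_nonneg.2 h1) (sq_nonneg ν),
    mul_nonneg (sub_nonneg.2 h2) (sq_nonneg (d - ds))]

/-- All contributions to `lonLyap` except `-k₆ ds log d` are nonnegative. -/
theorem exp_le_of_lonLyap (P : Params) {ds d ν : ℝ} (hds : 0 < ds) (hd : 0 < d) :
    exp (-(lonLyap P ds d ν / (P.k6 * ds))) ≤ d := by
  have h6 := P.k6_pos; have h5 := P.k5_pos
  rw [← le_log_iff_exp_le hd, neg_le, le_div_iff₀ (by positivity)]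
  have := lonGain_energy_cross_nonneg P ds d ν
  have h7 : 0 ≤ P.k5 / 2 * (d - ds) ^ 2 := by positivity
  have h8 : 0 ≤ P.k6 * d := by positivity
  unfold lonLyap
  linarith

/-- The function `d - ds log d` is minimal at `d = ds`. This is the lower bound that the convergence
argument needs. -/
theorem le_lonLyap (P : Params) {ds d : ℝ} (ν : ℝ) (hds : 0 < ds) (hd : 0 < d) :
    P.k6 * (ds - ds * log ds) ≤ lonLyap P ds d ν := by
  have h6 := P.k6_pos; have h5 := P.k5_pos
  have := lonGain_energy_cross_nonneg P ds d ν
  have h7 : 0 ≤ P.k5 / 2 * (d - ds) ^ 2 := by positivity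
  have h8 := log_le_sub_one_of_pos (div_pos hd hds)
  rw [log_div hd.ne' hds.ne'] at h8
  have h9 : ds * (log d - log ds) ≤ d - ds := by
    calc ds * (log d - log ds) ≤ ds * (d / ds - 1) := by gcongr
      _ = d - ds := by field_simp
  have : P.k6 * (ds - ds * log ds) ≤ P.k6 * (d - ds * log d) := by
    gcongr ?_ * ?_
    linarith
  unfold lonLyap
  linarith

namespace LonMotion
variable {P : Params} {ds : ℝ} {d ν : ℝ → ℝ} {a b : ℝ}

theorem mono (h : LonMotion P ds d ν a b) {a' b' : ℝ} (ha : a ≤ a') (hb : b' ≤ b) :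
    LonMotion P ds d ν a' b' where
  cont_d := h.cont_d.mono (Icc_subset_Icc ha hb)
  cont_nu := h.cont_nu.mono (Icc_subset_Icc ha hb)
  pos := fun t ht => h.pos t (Icc_subset_Icc ha hb ht)
  deriv_d := fun t ht => h.deriv_d t (Ico_subset_Ico ha hb ht)
  deriv_nu := fun t ht => h.deriv_nu t (Ico_subset_Ico ha hb ht)

theorem hasDeriv_energy (h : LonMotion P ds d ν a b) {t : ℝ} (ht : t ∈ Ico a b) :
    HasDerivWithinAt (fun t => lonEnergy P ds (d t) (ν t))
      (-(P.k5 * ν t ^ 2 + P.k6 * (ν t ^ 2 / d t))) (Ici t) t := by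
  have h1 := (((h.deriv_nu t ht).pow 2).add
    ((((h.deriv_d t ht).sub_const ds).pow 2).const_mul P.k4)).div_const 2
  refine h1.congr_deriv ?_
  push_cast
  ring

theorem cont_energy (h : LonMotion P ds d ν a b) :
    ContinuousOn (fun t => lonEnergy P ds (d t) (ν t)) (Icc a b) := by
  have := h.cont_d; have := h.cont_nu
  unfold lonEnergy; fun_prop

theorem energy_le (h : LonMotion P ds d ν a b) (hab : a ≤ b) :
    lonEnergy P ds (d b) (ν b) ≤ lonEnergy P ds (d a) (ν a) := by
  refine le_of_right_deriv_nonpos (f := fun t => lonEnergy P ds (d t) (ν t)) hab h.cont_energy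
    (fun t ht => h.hasDeriv_energy ht) fun t ht => ?_
  have h5 := P.k5_pos; have h6 := P.k6_pos; have := h.pos t ⟨ht.1, ht.2.le⟩
  have : 0 ≤ P.k5 * ν t ^ 2 + P.k6 * (ν t ^ 2 / d t) := by positivity
  linarith

/-- The cross term contributes `-k₅ (d - ds) ν - k₆ (d - ds) ν / d`, and the last two summands of
`lonLyap` are primitives of exactly the opposite terms. -/
theorem hasDeriv_lyap (h : LonMotion P ds d ν a b) {t : ℝ} (ht : t ∈ Ico a b) :
    HasDerivWithinAt (fun t => lonLyap P ds (d t) (ν t))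
      (lonGain P * (-(P.k5 * ν t ^ 2 + P.k6 * (ν t ^ 2 / d t))) + ν t ^ 2 - P.k4 * (d t - ds) ^ 2)
      (Ici t) t := by
  have hd := (h.deriv_d t ht)
  have hν := (h.deriv_nu t ht)
  have hp := h.pos t ⟨ht.1, ht.2.le⟩
  have h1 := ((((h.hasDeriv_energy ht).const_mul (lonGain P)).add ((hd.sub_const ds).mul hν)).add
    ((hd.sub ((hd.log hp.ne').const_mul ds)).const_mul P.k6)).add
      (((hd.sub_const ds).pow 2).const_mul (P.k5 / 2))
  refine h1.congr_deriv ?_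
  push_cast
  field_simp
  ring

theorem lyap_deriv_le (h : LonMotion P ds d ν a b) {t : ℝ} (ht : t ∈ Ico a b) :
    lonGain P * (-(P.k5 * ν t ^ 2 + P.k6 * (ν t ^ 2 / d t))) + ν t ^ 2 - P.k4 * (d t - ds) ^ 2 ≤
      -(2 * lonEnergy P ds (d t) (ν t)) := by
  have h6 := P.k6_pos; have hp := h.pos t ⟨ht.1, ht.2.le⟩
  have h1 := two_le_lonGain_mul_k5 P
  have h2 : 0 ≤ lonGain P * (P.k6 * (ν t ^ 2 / d t)) := by
    have := one_le_lonGain P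
    positivity
  unfold lonEnergy
  nlinarith [mul_nonneg (sub_nonneg.2 h1) (sq_nonneg (ν t))]

theorem cont_lyap (h : LonMotion P ds d ν a b) :
    ContinuousOn (fun t => lonLyap P ds (d t) (ν t)) (Icc a b) := by
  have := h.cont_d; have := h.cont_nu; have := h.cont_energy
  have hl : ContinuousOn (fun t => log (d t)) (Icc a b) :=
    h.cont_d.log fun t ht => (h.pos t ht).ne'
  unfold lonLyap; fun_prop

theorem lyap_le (h : LonMotion P ds d ν a b) (hab : a ≤ b) :
    lonLyap P ds (d b) (ν b) ≤ lonLyap P ds (d a) (ν a) :=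
  le_of_right_deriv_nonpos (f := fun t => lonLyap P ds (d t) (ν t)) hab h.cont_lyap
    (fun t ht => h.hasDeriv_lyap ht) fun t ht =>
      (h.lyap_deriv_le ht).trans (by linarith [lonEnergy_nonneg P ds (d t) (ν t)])

theorem exp_le (h : LonMotion P ds d ν a b) (hab : a ≤ b) (hds : 0 < ds) :
    exp (-(lonLyap P ds (d a) (ν a) / (P.k6 * ds))) ≤ d b := by
  refine le_trans ?_ (exp_le_of_lonLyap P (ν := ν b) hds (h.pos b (right_mem_Icc.2 hab)))
  have := P.k6_pos
  gcongr
  exact h.lyap_le hab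

theorem tendsto_energy (h : ∀ b, 0 ≤ b → LonMotion P ds d ν 0 b) (hds : 0 < ds) :
    Tendsto (fun t => lonEnergy P ds (d t) (ν t)) atTop (𝓝 0) := by
  have hI : ∀ t : ℝ, 0 ≤ t → t ∈ Ico 0 (t + 1) := fun t ht => ⟨ht, by linarith⟩
  have hI' : ∀ t : ℝ, 0 ≤ t → (0 : ℝ) ≤ t + 1 := fun t ht => by linarith
  refine tendsto_zero_of_strict_lyapunov (c := 2) (t₀ := 0) (m := P.k6 * (ds - ds * log ds))
    (U := fun t => lonLyap P ds (d t) (ν t)) two_pos (fun t _ => lonEnergy_nonneg _ _ _ _)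
    (fun s t hs hst => ((h t (hs.trans hst)).mono hs le_rfl).energy_le hst) ?_
    (fun t ht => le_lonLyap P _ hds ((h t ht).pos t (right_mem_Icc.2 ht)))
    (fun t ht => (h _ (hI' t ht)).hasDeriv_lyap (hI t ht))
    (fun t ht => (h _ (hI' t ht)).lyap_deriv_le (hI t ht))
  intro t ht
  have h1 := (h _ (hI' t ht)).cont_lyap t ⟨ht, by linarith⟩
  refine h1.mono_of_mem_nhdsWithin ?_
  rw [← Ici_inter_Iic]
  exact inter_mem self_mem_nhdsWithin (mem_nhdsWithin_of_mem_nhds (Iic_mem_nhds (by linarith)))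

end LonMotion

/-! ### The lateral dynamics -/

/-- The rate of the orientation error at lateral displacement `y` between the barriers `±m`. -/
def thField (P : Params) (m y θ v : ℝ) : ℝ :=
  -(P.k1 * sinc θ * y * v) - |v| * (P.k2 * θ + P.k3 * (1 / (m - y) + 1 / (m + y)) * sin θ)

/-- On `[a, b]` the lateral error `(y, θ)` obeys the closed-loop dynamics at speed `v`. -/
structure LatMotion (P : Params) (m : ℝ) (y θ v : ℝ → ℝ) (a b : ℝ) : Prop where
  cont_y : ContinuousOn y (Icc a b)
  cont_th : ContinuousOn θ (Icc a b)
  abs_lt : ∀ t ∈ Icc a b, |y t| < m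
  abs_le : ∀ t ∈ Icc a b, |θ t| ≤ π / 2
  deriv_y : ∀ t ∈ Ico a b, HasDerivWithinAt y (v t * sin (θ t)) (Ici t) t
  deriv_th : ∀ t ∈ Ico a b, HasDerivWithinAt θ (thField P m (y t) (θ t) (v t)) (Ici t) t

def latEnergy (P : Params) (y θ : ℝ) : ℝ := P.k1 * y ^ 2 + θ ^ 2

/-- The first two summands dominate the cross term `y θ`; the third makes the damping `2 k₂ θ²`
exceed the `θ²` terms left after Young's inequality in `LatMotion.lyap_deriv_le`. -/
def latGain (P : Params) : ℝ := 1 + 1 / P.k1 + (2 + P.k2 ^ 2 / P.k1) / (2 * P.k2)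

/-- A strict Lyapunov function of the lateral dynamics for forward motions, infinite at the
barriers. -/
def latLyap (P : Params) (m y θ : ℝ) : ℝ :=
  latGain P * latEnergy P y θ + y * θ - P.k3 * m * (log (m - y) + log (m + y))

theorem latEnergy_nonneg (P : Params) (y θ : ℝ) : 0 ≤ latEnergy P y θ := by
  have := P.k1_pos
  unfold latEnergy; positivity

theorem latGain_energy_cross_nonneg (P : Params) (y θ : ℝ) :
    0 ≤ latGain P * latEnergy P y θ + y * θ := by
  have h1 := P.k1_pos; have h2 := P.k2_pos
  have h3 : 0 ≤ (2 + P.k2 ^ 2 / P.k1) / (2 * P.k2) := by positivity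
  have h4 : 1 / P.k1 * (P.k1 * y ^ 2) = y ^ 2 := by field_simp
  have h5 : 0 ≤ (2 + P.k2 ^ 2 / P.k1) / (2 * P.k2) * latEnergy P y θ :=
    mul_nonneg h3 (latEnergy_nonneg _ _ _)
  have h6 : 0 ≤ 1 / P.k1 * θ ^ 2 := by positivity
  have h7 : 0 ≤ P.k1 * y ^ 2 := by positivity
  unfold latGain
  have : latEnergy P y θ = P.k1 * y ^ 2 + θ ^ 2 := rfl
  have h8 : (1 + 1 / P.k1) * latEnergy P y θ =
      P.k1 * y ^ 2 + θ ^ 2 + y ^ 2 + 1 / P.k1 * θ ^ 2 := by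
    rw [this]; linear_combination h4
  rw [add_mul, h8]
  nlinarith [sq_nonneg (y + θ), sq_nonneg y, sq_nonneg θ]

/-- Both edge distances are less than `2 m`, so the barrier logarithms are bounded above. -/
theorem le_latLyap (P : Params) {m y θ : ℝ} (hy : |y| < m) :
    -(P.k3 * m * (log (2 * m) + log (2 * m))) ≤ latLyap P m y θ := by
  obtain ⟨h1, h2⟩ := abs_lt.1 hy
  have hm : 0 < m := (abs_nonneg y).trans_lt hy
  have h3 := latGain_energy_cross_nonneg P y θ
  have h4 : log (m - y) ≤ log (2 * m) := log_le_log (by linarith) (by linarith)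
  have h5 : log (m + y) ≤ log (2 * m) := log_le_log (by linarith) (by linarith)
  have := P.k3_pos
  have : P.k3 * m * (log (m - y) + log (m + y)) ≤ P.k3 * m * (log (2 * m) + log (2 * m)) := by
    gcongr
  unfold latLyap
  linarith

namespace LatMotion
variable {P : Params} {m : ℝ} {y θ v : ℝ → ℝ} {a b : ℝ}

theorem mono (h : LatMotion P m y θ v a b) {a' b' : ℝ} (ha : a ≤ a') (hb : b' ≤ b) :
    LatMotion P m y θ v a' b' where
  cont_y := h.cont_y.mono (Icc_subset_Icc ha hb)
  cont_th := h.cont_th.mono (Icc_subset_Icc ha hb)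
  abs_lt := fun t ht => h.abs_lt t (Icc_subset_Icc ha hb ht)
  abs_le := fun t ht => h.abs_le t (Icc_subset_Icc ha hb ht)
  deriv_y := fun t ht => h.deriv_y t (Ico_subset_Ico ha hb ht)
  deriv_th := fun t ht => h.deriv_th t (Ico_subset_Ico ha hb ht)

/-- Reflection in the centre line exchanges the two edges, so estimates for the left edge carry over
to the right one. -/
protected theorem neg (h : LatMotion P m y θ v a b) :
    LatMotion P m (fun t => -y t) (fun t => -θ t) v a b where
  cont_y := h.cont_y.neg
  cont_th := h.cont_th.neg
  abs_lt := fun t ht => by rw [abs_neg]; exact h.abs_lt t ht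
  abs_le := fun t ht => by rw [abs_neg]; exact h.abs_le t ht
  deriv_y := fun t ht => (h.deriv_y t ht).neg.congr_deriv (by rw [sin_neg]; ring)
  deriv_th := fun t ht => (h.deriv_th t ht).neg.congr_deriv (by
    simp only [thField, sin_neg, sinc_neg, sub_neg_eq_add, ← sub_eq_add_neg]; ring)

theorem cont_energy (h : LatMotion P m y θ v a b) :
    ContinuousOn (fun t => latEnergy P (y t) (θ t)) (Icc a b) := by
  have := h.cont_y; have := h.cont_th
  unfold latEnergy; fun_prop

theorem gaps_pos (h : LatMotion P m y θ v a b) {t : ℝ} (ht : t ∈ Icc a b) :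
    0 < m - y t ∧ 0 < m + y t := by
  obtain ⟨h1, h2⟩ := _root_.abs_lt.1 (h.abs_lt t ht)
  constructor <;> linarith

/-- The terms in `y v` cancel because `θ sinc θ = sin θ`. Only terms carrying `|v|` remain, so the
direction of travel is irrelevant. -/
theorem hasDeriv_energy (h : LatMotion P m y θ v a b) {t : ℝ} (ht : t ∈ Ico a b) :
    HasDerivWithinAt (fun t => latEnergy P (y t) (θ t))
      (-(2 * |v t| * (P.k2 + P.k3 * (1 / (m - y t) + 1 / (m + y t)) * sinc (θ t)) * θ t ^ 2))
      (Ici t) t := by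
  have h1 := (((h.deriv_y t ht).pow 2).const_mul P.k1).add ((h.deriv_th t ht).pow 2)
  refine h1.congr_deriv ?_
  unfold thField
  rw [← mul_sinc]
  push_cast
  ring

theorem energy_le (h : LatMotion P m y θ v a b) (hab : a ≤ b) :
    latEnergy P (y b) (θ b) ≤ latEnergy P (y a) (θ a) := by
  refine le_of_right_deriv_nonpos (f := fun t => latEnergy P (y t) (θ t)) hab h.cont_energy
    (fun t ht => h.hasDeriv_energy ht) fun t ht => ?_
  obtain ⟨h1, h2⟩ := h.gaps_pos ⟨ht.1, ht.2.le⟩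
  have h3 : 0 ≤ sinc (θ t) := by linarith [half_le_sinc (h.abs_le t ⟨ht.1, ht.2.le⟩)]
  have := P.k2_pos; have := P.k3_pos
  rw [neg_nonpos]
  positivity

/-- Formally, `|θ| / k₃ - log (m - y)` grows at most at the rate `M k₁ m / k₃`: the barrier part of
`|θ|'` outweighs the drift `v sin θ / (m - y)`. Smoothing the absolute value costs the additional
rate `M`. -/
theorem log_gap_ge (h : LatMotion P m y θ v a b) (hab : a ≤ b) {M : ℝ}
    (hM : ∀ t ∈ Ico a b, |v t| ≤ M) :
    log (m - y a) - (π / 2 + 1) / P.k3 - M * (1 + P.k1 * m / P.k3) * (b - a) ≤ log (m - y b) := by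
  have k1 := P.k1_pos; have k2 := P.k2_pos; have k3 := P.k3_pos
  have hm : 0 < m := (abs_nonneg _).trans_lt (h.abs_lt a (left_mem_Icc.2 hab))
  have hgc : ContinuousOn (fun t => 1 / (m - y t) + 1 / (m + y t)) (Icc a b) :=
    ((continuousOn_const.div (continuousOn_const.sub h.cont_y)
      fun t ht => (h.gaps_pos ht).1.ne').add
      (continuousOn_const.div (continuousOn_const.add h.cont_y) fun t ht => (h.gaps_pos ht).2.ne'))
  obtain ⟨G, hG⟩ := isCompact_Icc.exists_bound_of_continuousOn hgc
  have hG0 : 0 ≤ G := (norm_nonneg _).trans (hG a (left_mem_Icc.2 hab))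
  -- The bound `G` of the barrier on this compact interval only fixes the smoothing parameter;
  -- through `G * δ ≤ 1` it disappears from the final estimate.
  obtain ⟨δ, hδ0, hδ1, hδG⟩ : ∃ δ : ℝ, 0 < δ ∧ δ ≤ 1 ∧ G * δ ≤ 1 := by
    refine ⟨1 / (1 + G), by positivity, ?_, ?_⟩
    · rw [div_le_one (by positivity)]; linarith
    · rw [mul_one_div, div_le_one (by positivity)]; linarith
  set q : ℝ → ℝ := fun t => √(θ t ^ 2 + δ ^ 2) with hq
  have hqpos : ∀ t, 0 < q t := fun t => by positivity
  have hqle : ∀ t, q t ≤ |θ t| + δ := fun t => by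
    refine Real.sqrt_le_iff.2 ⟨by positivity, ?_⟩
    nlinarith [sq_abs (θ t), abs_nonneg (θ t)]
  have hleq : ∀ t, |θ t| ≤ q t := fun t => Real.abs_le_sqrt (by nlinarith)
  have hlc : ContinuousOn (fun t => log (m - y t)) (Icc a b) :=
    (continuousOn_const.sub h.cont_y).log fun t ht => (h.gaps_pos ht).1.ne'
  have hqc : ContinuousOn q (Icc a b) := by
    have := h.cont_th
    fun_prop
  have hder : ∀ t ∈ Ico a b, HasDerivWithinAt (fun t => q t / P.k3 - log (m - y t))
      (θ t * thField P m (y t) (θ t) (v t) / q t / P.k3 + v t * sin (θ t) / (m - y t)) (Ici t) t := by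
    intro t ht
    have hp := (h.gaps_pos ⟨ht.1, ht.2.le⟩).1
    have h1 := ((((h.deriv_th t ht).pow 2).add_const (δ ^ 2)).sqrt
      (add_pos_of_nonneg_of_pos (sq_nonneg _) (by positivity)).ne').div_const P.k3
    have h2 := ((h.deriv_y t ht).const_sub m).log hp.ne'
    refine (h1.sub h2).congr_deriv ?_
    have : √(θ t ^ 2 + δ ^ 2) = q t := rfl
    simp only [Pi.pow_apply, this]
    have := (hqpos t).ne'
    push_cast
    field_simp
    ring
  have hbd : ∀ t ∈ Ico a b, θ t * thField P m (y t) (θ t) (v t) / q t / P.k3 +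
      v t * sin (θ t) / (m - y t) ≤ M * (1 + P.k1 * m / P.k3) := by
    intro t ht
    have ht' : t ∈ Icc a b := ⟨ht.1, ht.2.le⟩
    obtain ⟨hp1, hp2⟩ := h.gaps_pos ht'
    have hy := h.abs_lt t ht'
    have hth := h.abs_le t ht'
    have hs := half_le_sinc hth
    have hs1 := sinc_le_one (θ t)
    set g := 1 / (m - y t) + 1 / (m + y t) with hg
    have hg0 : 0 ≤ g := by positivity
    have hgG : g ≤ G := (le_abs_self _).trans (hG t ht')
    have hqp := hqpos t
    have hql := hleq t
    set s := sinc (θ t) with hsdef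
    have hsin : sin (θ t) = θ t * s := (mul_sinc _).symm
    -- The `k₁` term is bounded using `|y| < m` and `sinc θ ≤ 1`, the `k₂` term is dropped for its
    -- sign, and the barrier term is kept to offset the drift in `e2`.
    have e1 : θ t * thField P m (y t) (θ t) (v t) / q t / P.k3 ≤
        |v t| * (P.k1 * m / P.k3) - |v t| * (g * s * (|θ t| * (|θ t| / q t))) := by
      have : θ t * thField P m (y t) (θ t) (v t) / q t / P.k3 =
          -(P.k1 * s * (y t * v t) * (θ t / q t)) / P.k3 - |v t| * P.k2 * (θ t ^ 2 / q t) / P.k3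
          - |v t| * (g * s * (|θ t| * (|θ t| / q t))) := by
        have hab2 : |θ t| * (|θ t| / q t) = θ t ^ 2 / q t := by
          rw [← mul_div_assoc, abs_mul_abs_self, sq]
        rw [hab2, thField, hsin, ← hg]
        field_simp
        ring
      rw [this]
      have h1 : -(P.k1 * s * (y t * v t) * (θ t / q t)) ≤ P.k1 * m * |v t| := by
        refine (neg_le_abs _).trans ?_
        rw [abs_mul, abs_mul, abs_mul, abs_mul, abs_div, abs_of_pos k1, abs_of_pos hqp,
          abs_of_nonneg (by linarith : 0 ≤ s)]
        have h2 : |θ t| / q t ≤ 1 := by rwa [div_le_one hqp]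
        have h3 : |y t| ≤ m := hy.le
        calc P.k1 * s * (|y t| * |v t|) * (|θ t| / q t)
            ≤ P.k1 * 1 * (m * |v t|) * 1 := by gcongr
          _ = P.k1 * m * |v t| := by ring
      have h2 : 0 ≤ |v t| * P.k2 * (θ t ^ 2 / q t) / P.k3 := by positivity
      have h3 : -(P.k1 * s * (y t * v t) * (θ t / q t)) / P.k3 ≤ P.k1 * m * |v t| / P.k3 := by
        gcongr
      have h4 : P.k1 * m * |v t| / P.k3 = |v t| * (P.k1 * m / P.k3) := by ring
      linarith
    have e2 : v t * sin (θ t) / (m - y t) ≤ |v t| * (g * s * |θ t|) := by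
      have h1 : v t * sin (θ t) ≤ |v t| * (s * |θ t|) := by
        refine (le_abs_self _).trans ?_
        rw [hsin, abs_mul, abs_mul, abs_of_nonneg (by linarith : 0 ≤ s), mul_comm s]
      have h2 : 1 / (m - y t) ≤ g := by
        have : 0 ≤ 1 / (m + y t) := by positivity
        linarith
      calc v t * sin (θ t) / (m - y t) ≤ |v t| * (s * |θ t|) * (1 / (m - y t)) := by
            rw [mul_one_div]; gcongr
        _ ≤ |v t| * (s * |θ t|) * g := by
            have : 0 ≤ s := by linarith
            gcongr
        _ = |v t| * (g * s * |θ t|) := by ring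
    -- This is the defect due to smoothing: `|θ| - θ² / q ≤ q - |θ| ≤ δ`, multiplied by a barrier
    -- factor of at most `G`.
    have e3 : g * s * |θ t| - g * s * (|θ t| * (|θ t| / q t)) ≤ 1 := by
      have h1 : |θ t| - |θ t| * (|θ t| / q t) ≤ δ := by
        have : |θ t| - |θ t| * (|θ t| / q t) = (|θ t| / q t) * (q t - |θ t|) := by field_simp
        rw [this]
        calc (|θ t| / q t) * (q t - |θ t|) ≤ 1 * δ := by
              gcongr
              · rwa [div_le_one hqp]
              · linarith [hqle t]
          _ = δ := one_mul _
      calc g * s * |θ t| - g * s * (|θ t| * (|θ t| / q t))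
          = g * s * (|θ t| - |θ t| * (|θ t| / q t)) := by ring
        _ ≤ g * s * δ := by
            have : 0 ≤ s := by linarith
            gcongr
        _ ≤ G * 1 * δ := by gcongr
        _ ≤ 1 := by linarith
    calc _ ≤ |v t| * (P.k1 * m / P.k3) - |v t| * (g * s * (|θ t| * (|θ t| / q t))) +
          |v t| * (g * s * |θ t|) := add_le_add e1 e2
      _ = |v t| * (P.k1 * m / P.k3 + (g * s * |θ t| - g * s * (|θ t| * (|θ t| / q t)))) := by ring
      _ ≤ |v t| * (P.k1 * m / P.k3 + 1) := by gcongr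
      _ ≤ M * (P.k1 * m / P.k3 + 1) := by
          gcongr
          exact hM t ht
      _ = M * (1 + P.k1 * m / P.k3) := by ring
  have hfin := le_sub_of_right_deriv_le hab ((hqc.div_const P.k3).sub hlc) hder hbd
  have hqb : 0 ≤ q b / P.k3 := div_nonneg (hqpos b).le k3.le
  have hqa : q a / P.k3 ≤ (π / 2 + 1) / P.k3 := by
    gcongr
    exact (hqle a).trans (add_le_add (h.abs_le a (left_mem_Icc.2 hab)) hδ1)
  simp only [Pi.sub_apply] at hfin
  linarith

/-- The barrier term in `y θ'` is `-2 k₃ m v y sin θ / (m² - y²)`, and the logarithms in `latLyap`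
contribute its opposite. This cancellation needs `|v| = v`. -/
theorem hasDeriv_lyap (h : LatMotion P m y θ v a b) {t : ℝ} (ht : t ∈ Ico a b) (hv : 0 ≤ v t) :
    HasDerivWithinAt (fun t => latLyap P m (y t) (θ t))
      (latGain P *
        (-(2 * |v t| * (P.k2 + P.k3 * (1 / (m - y t) + 1 / (m + y t)) * sinc (θ t)) * θ t ^ 2))
        + v t * (sinc (θ t) * θ t ^ 2 - P.k1 * sinc (θ t) * y t ^ 2 - P.k2 * (y t * θ t)))
      (Ici t) t := by
  obtain ⟨hp1, hp2⟩ := h.gaps_pos ⟨ht.1, ht.2.le⟩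
  have hy := h.deriv_y t ht
  have h1 := (((h.hasDeriv_energy ht).const_mul (latGain P)).add (hy.mul (h.deriv_th t ht))).sub
    ((((hy.const_sub m).log hp1.ne').add ((hy.const_add m).log hp2.ne')).const_mul (P.k3 * m))
  refine h1.congr_deriv ?_
  unfold thField
  rw [← mul_sinc, abs_of_nonneg hv]
  field_simp
  ring

theorem lyap_deriv_le (h : LatMotion P m y θ v a b) {t : ℝ} (ht : t ∈ Ico a b) {c : ℝ}
    (hc : 0 ≤ c) (hv : c ≤ v t) :
    latGain P *
        (-(2 * |v t| * (P.k2 + P.k3 * (1 / (m - y t) + 1 / (m + y t)) * sinc (θ t)) * θ t ^ 2))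
        + v t * (sinc (θ t) * θ t ^ 2 - P.k1 * sinc (θ t) * y t ^ 2 - P.k2 * (y t * θ t)) ≤
      -(c / 4 * latEnergy P (y t) (θ t)) := by
  obtain ⟨hp1, hp2⟩ := h.gaps_pos ⟨ht.1, ht.2.le⟩
  have k1 := P.k1_pos; have k2 := P.k2_pos; have k3 := P.k3_pos
  have hs := half_le_sinc (h.abs_le t ⟨ht.1, ht.2.le⟩)
  have hs1 := sinc_le_one (θ t)
  set s := sinc (θ t)
  have hv0 : 0 ≤ v t := hc.trans hv
  rw [abs_of_nonneg hv0]
  set g := 1 / (m - y t) + 1 / (m + y t) with hg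
  have hg0 : 0 ≤ g := by positivity
  have hK : 2 + P.k2 ^ 2 / P.k1 ≤ latGain P * (2 * P.k2) := by
    have h1 : (2 + P.k2 ^ 2 / P.k1) / (2 * P.k2) * (2 * P.k2) = 2 + P.k2 ^ 2 / P.k1 := by
      field_simp
    have h2 : 0 ≤ (1 + 1 / P.k1) * (2 * P.k2) := by positivity
    unfold latGain
    linarith
  have hK0 : 0 ≤ latGain P := by unfold latGain; positivity
  -- Young's inequality, weighted to use half of the `k₁ / 2` guaranteed by `sinc θ ≥ 1 / 2`.
  have e1 : -(P.k2 * (y t * θ t)) ≤ P.k1 / 4 * y t ^ 2 + P.k2 ^ 2 / P.k1 * θ t ^ 2 := by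
    have : P.k1 / 4 * y t ^ 2 + P.k2 ^ 2 / P.k1 * θ t ^ 2 + P.k2 * (y t * θ t) =
        P.k1 * (y t / 2 + P.k2 / P.k1 * θ t) ^ 2 := by field_simp; ring
    have : 0 ≤ P.k1 * (y t / 2 + P.k2 / P.k1 * θ t) ^ 2 := by positivity
    linarith
  have e2 : s * θ t ^ 2 ≤ θ t ^ 2 := by nlinarith [sq_nonneg (θ t)]
  have e3 : P.k1 / 2 * y t ^ 2 ≤ P.k1 * s * y t ^ 2 := by
    have : P.k1 / 2 ≤ P.k1 * s := by nlinarith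
    gcongr
  have e4 : 0 ≤ latGain P * (2 * (P.k3 * g * s) * θ t ^ 2) := by positivity
  have e5 : (2 + P.k2 ^ 2 / P.k1) * θ t ^ 2 ≤ latGain P * (2 * P.k2) * θ t ^ 2 := by gcongr
  have e6 : -(latGain P * (2 * (P.k2 + P.k3 * g * s) * θ t ^ 2)) +
      (s * θ t ^ 2 - P.k1 * s * y t ^ 2 - P.k2 * (y t * θ t)) ≤
      -(1 / 4 * latEnergy P (y t) (θ t)) := by
    have : 0 ≤ θ t ^ 2 := sq_nonneg _
    unfold latEnergy
    linarith
  have e7 := latEnergy_nonneg P (y t) (θ t)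
  calc _ = v t * (-(latGain P * (2 * (P.k2 + P.k3 * g * s) * θ t ^ 2)) +
      (s * θ t ^ 2 - P.k1 * s * y t ^ 2 - P.k2 * (y t * θ t))) := by ring
    _ ≤ v t * (-(1 / 4 * latEnergy P (y t) (θ t))) := by gcongr
    _ ≤ -(c / 4 * latEnergy P (y t) (θ t)) := by nlinarith

theorem cont_lyap (h : LatMotion P m y θ v a b) :
    ContinuousOn (fun t => latLyap P m (y t) (θ t)) (Icc a b) := by
  have := h.cont_y; have := h.cont_th; have := h.cont_energy
  have hl : ContinuousOn (fun t => log (m - y t)) (Icc a b) :=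
    (continuousOn_const.sub h.cont_y).log fun t ht => (h.gaps_pos ht).1.ne'
  have hl' : ContinuousOn (fun t => log (m + y t)) (Icc a b) :=
    (continuousOn_const.add h.cont_y).log fun t ht => (h.gaps_pos ht).2.ne'
  unfold latLyap; fun_prop

theorem tendsto_energy (h : ∀ b, 0 ≤ b → LatMotion P m y θ v 0 b) {t₀ c : ℝ} (ht₀ : 0 ≤ t₀)
    (hc : 0 < c) (hv : ∀ t, t₀ ≤ t → c ≤ v t) :
    Tendsto (fun t => latEnergy P (y t) (θ t)) atTop (𝓝 0) := by
  have hI : ∀ t : ℝ, t₀ ≤ t → t ∈ Ico 0 (t + 1) := fun t ht => ⟨ht₀.trans ht, by linarith⟩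
  have hI' : ∀ t : ℝ, t₀ ≤ t → (0 : ℝ) ≤ t + 1 := fun t ht => by linarith
  refine tendsto_zero_of_strict_lyapunov (c := c / 4) (t₀ := t₀)
    (m := -(P.k3 * m * (log (2 * m) + log (2 * m))))
    (U := fun t => latLyap P m (y t) (θ t)) (by positivity) (fun t _ => latEnergy_nonneg _ _ _)
    (fun s t hs hst =>
      ((h t (ht₀.trans (hs.trans hst))).mono (ht₀.trans hs) le_rfl).energy_le hst) ?_
    (fun t ht => le_latLyap P
      ((h t (ht₀.trans ht)).abs_lt t (right_mem_Icc.2 (ht₀.trans ht))))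
    (fun t ht => (h _ (hI' t ht)).hasDeriv_lyap (hI t ht) (hc.le.trans (hv t ht)))
    (fun t ht => (h _ (hI' t ht)).lyap_deriv_le (hI t ht) hc.le (hv t ht))
  intro t ht
  have ht : t₀ ≤ t := ht
  have h1 := (h _ (hI' t ht)).cont_lyap t ⟨ht₀.trans ht, by linarith⟩
  refine h1.mono_of_mem_nhdsWithin ?_
  rw [← Ici_inter_Iic]
  exact inter_mem (mem_of_superset self_mem_nhdsWithin (Ici_subset_Ici.2 ht₀))
    (mem_nhdsWithin_of_mem_nhds (Iic_mem_nhds (by linarith)))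

end LatMotion

/-! ### Path coordinates -/

/-- The point with path coordinates `(s, y)`. -/
def pathPoint (R : Road) (q : ℝ × ℝ) : ℝ × ℝ :=
  (R.cx q.1 - q.2 * sin (R.ang q.1), R.cy q.1 + q.2 * cos (R.ang q.1))

/-- The Jacobian of the path coordinates with curvature factor `c = 1 - χ y` and angle `a`. -/
def pathJacobian (c a : ℝ) (hc : c ≠ 0) : (ℝ × ℝ) ≃L[ℝ] (ℝ × ℝ) :=
  ContinuousLinearEquiv.equivOfInverse
    (((c * cos a) • ContinuousLinearMap.fst ℝ ℝ ℝ - (sin a) • ContinuousLinearMap.snd ℝ ℝ ℝ).prod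
      ((c * sin a) • ContinuousLinearMap.fst ℝ ℝ ℝ + (cos a) • ContinuousLinearMap.snd ℝ ℝ ℝ))
    (((cos a / c) • ContinuousLinearMap.fst ℝ ℝ ℝ + (sin a / c) • ContinuousLinearMap.snd ℝ ℝ ℝ).prod
      (-(sin a) • ContinuousLinearMap.fst ℝ ℝ ℝ + (cos a) • ContinuousLinearMap.snd ℝ ℝ ℝ))
    (fun q => by
      have := sin_sq_add_cos_sq a
      ext
      · simp
        field_simp
        linear_combination c * q.1 * this
      · simp
        linear_combination q.2 * this)
    (fun q => by
      have := sin_sq_add_cos_sq a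
      ext
      · simp
        field_simp
        linear_combination q.1 * this
      · simp
        field_simp
        linear_combination q.2 * this)

/-- The Jacobian determinant is `1 - χ y`. Strict differentiability, which the inverse function
theorem requires, comes from continuity of the first derivatives of the road data. -/
theorem hasStrictFDerivAt_pathPoint (R : Road) (q : ℝ × ℝ) (hc : 1 - R.curv q.1 * q.2 ≠ 0) :
    HasStrictFDerivAt (pathPoint R)
      (pathJacobian (1 - R.curv q.1 * q.2) (R.ang q.1) hc : (ℝ × ℝ) →L[ℝ] (ℝ × ℝ)) q := by
  have hang : Continuous R.ang := continuous_iff_continuousAt.2 fun s => (R.ang_deriv s).continuousAt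
  have h1 : HasStrictDerivAt R.cx (cos (R.ang q.1)) q.1 :=
    hasStrictDerivAt_of_hasDerivAt_of_continuousAt (Eventually.of_forall R.cx_deriv)
      (by fun_prop : Continuous fun s => cos (R.ang s)).continuousAt
  have h2 : HasStrictDerivAt R.cy (sin (R.ang q.1)) q.1 :=
    hasStrictDerivAt_of_hasDerivAt_of_continuousAt (Eventually.of_forall R.cy_deriv)
      (by fun_prop : Continuous fun s => sin (R.ang s)).continuousAt
  have h3 : HasStrictDerivAt R.ang (R.curv q.1) q.1 :=
    hasStrictDerivAt_of_hasDerivAt_of_continuousAt (Eventually.of_forall R.ang_deriv)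
      R.curv_diff.continuous.continuousAt
  have hf : HasStrictFDerivAt (fun q : ℝ × ℝ => q.1) (ContinuousLinearMap.fst ℝ ℝ ℝ) q :=
    hasStrictFDerivAt_fst
  have hs : HasStrictFDerivAt (fun q : ℝ × ℝ => q.2) (ContinuousLinearMap.snd ℝ ℝ ℝ) q :=
    hasStrictFDerivAt_snd
  have key := ((h1.comp_hasStrictFDerivAt q hf).sub (hs.mul (h3.sin.comp_hasStrictFDerivAt q hf))).prodMk
    ((h2.comp_hasStrictFDerivAt q hf).add (hs.mul (h3.cos.comp_hasStrictFDerivAt q hf)))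
  refine key.congr_fderiv ?_
  ext <;> simp [pathJacobian] <;> ring

/-- The path coordinates of a moving vehicle that depend continuously on time are differentiable;
their rates are the speed of the projection and `v sin θ̃`. -/
theorem hasDeriv_pathCoordinates (R : Road) {x : ℝ → VehicleState} {J : Set ℝ} {t : ℝ} (ht : t ∈ J)
    (hproj : ∀ τ ∈ J, Projects R (x τ))
    (hs : ContinuousWithinAt (fun τ => (x τ).s) J t)
    (hy : ContinuousWithinAt (fun τ => (x τ).y) J t)
    (hc : 1 - R.curv (x t).s * (x t).y ≠ 0)
    (hpx : HasDerivWithinAt (fun τ => (x τ).px) ((x t).v * cos (x t).th) J t)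
    (hpy : HasDerivWithinAt (fun τ => (x τ).py) ((x t).v * sin (x t).th) J t) :
    HasDerivWithinAt (fun τ => (x τ).s) (vVirt R (x t)) J t ∧
      HasDerivWithinAt (fun τ => (x τ).y) (yRate R (x t)) J t := by
  set q : ℝ → ℝ × ℝ := fun τ => ((x τ).s, (x τ).y) with hq
  have hS := hasStrictFDerivAt_pathPoint R (q t) hc
  have hp : ∀ τ ∈ J, ((x τ).px, (x τ).py) = pathPoint R (q τ) := fun τ hτ => by
    rw [(hproj τ hτ).1, (hproj τ hτ).2]; rfl
  have hpd : HasDerivWithinAt (fun τ => pathPoint R (q τ))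
      ((x t).v * cos (x t).th, (x t).v * sin (x t).th) J t :=
    (hpx.prodMk hpy).congr (fun τ hτ => (hp τ hτ).symm) (hp t ht).symm
  have hqc : ContinuousWithinAt q J t := hs.prodMk hy
  -- Continuity of the coordinates selects the branch: near `t` they remain where the local inverse
  -- undoes `pathPoint`.
  have hev : q =ᶠ[𝓝[J] t] fun τ => hS.localInverse _ _ _ (pathPoint R (q τ)) :=
    (hqc.eventually hS.eventually_left_inverse).mono fun τ h => h.symm
  have hd := (hS.to_localInverse.hasFDerivAt.comp_hasDerivWithinAt t hpd).congr_of_eventuallyEq hev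
    (hS.localInverse_apply_image).symm
  have hval : ((pathJacobian (1 - R.curv (q t).1 * (q t).2) (R.ang (q t).1) hc).symm :
      (ℝ × ℝ) →L[ℝ] (ℝ × ℝ)) ((x t).v * cos (x t).th, (x t).v * sin (x t).th) =
        (vVirt R (x t), yRate R (x t)) := by
    have h1 : (x t).th = thErr R (x t) + R.ang (x t).s := by unfold thErr; ring
    have h2 := sin_sq_add_cos_sq (R.ang (x t).s)
    rw [ContinuousLinearEquiv.coe_coe, ContinuousLinearEquiv.symm_apply_eq, h1, cos_add, sin_add]
    simp only [hq, pathJacobian, vVirt, yRate]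
    ext
    · simp
      field_simp
    · simp
      field_simp
      ring
  rw [hval] at hd
  exact ⟨(ContinuousLinearMap.fst ℝ ℝ ℝ).hasFDerivAt.comp_hasDerivWithinAt t hd,
    (ContinuousLinearMap.snd ℝ ℝ ℝ).hasFDerivAt.comp_hasDerivWithinAt t hd⟩

/-! ### Bounds for states between the road edges -/

/-- half the width of the safe part of the road -/
def safeWidth (R : Road) : ℝ := R.w - R.epsw

theorem dL_eq (R : Road) (x : VehicleState) : dL R x = safeWidth R - x.y := by
  unfold dL safeWidth; ring

theorem dR_eq (R : Road) (x : VehicleState) : dR R x = safeWidth R + x.y := by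
  unfold dR safeWidth; ring

theorem w_pos (R : Road) : 0 < R.w := R.epsw_pos.trans R.epsw_lt

theorem safeWidth_pos (R : Road) : 0 < safeWidth R := sub_pos.2 R.epsw_lt

theorem abs_curv_le (R : Road) (s : ℝ) : |R.curv s| ≤ 1 / R.w := by
  rw [le_div_iff₀ (w_pos R), mul_comm]
  exact (R.curv_lt s).le

theorem abs_curv_mul_le (R : Road) (s y : ℝ) : |R.curv s * y| ≤ |y| / R.w := by
  rw [abs_mul, div_eq_mul_one_div, mul_comm]
  gcongr
  exact abs_curv_le R s

/-- The margin `epsw` makes `1 - χ y` bounded below uniformly in `s`, even if `w |χ|` comes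
arbitrarily close to `1` along the road. -/
theorem abs_curv_mul_lt (R : Road) {y : ℝ} (s : ℝ) (hy : |y| < safeWidth R) :
    |R.curv s * y| ≤ 1 - R.epsw / R.w := by
  have hw := w_pos R
  refine (abs_curv_mul_le R s y).trans ?_
  rw [div_le_iff₀ hw, sub_mul, div_mul_cancel₀ _ hw.ne']
  unfold safeWidth at hy
  linarith

theorem le_one_sub_curv_mul (R : Road) {y : ℝ} (s : ℝ) (hy : |y| < safeWidth R) :
    R.epsw / R.w ≤ 1 - R.curv s * y := by
  have := (abs_le.1 (abs_curv_mul_lt R s hy)).2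
  linarith

theorem epsw_div_w_pos (R : Road) : 0 < R.epsw / R.w := div_pos R.epsw_pos (w_pos R)

theorem one_sub_curv_mul_pos (R : Road) {y : ℝ} (s : ℝ) (hy : |y| < safeWidth R) :
    0 < 1 - R.curv s * y := (epsw_div_w_pos R).trans_le (le_one_sub_curv_mul R s hy)

theorem one_sub_curv_mul_le (R : Road) {y : ℝ} (s : ℝ) (hy : |y| < safeWidth R) :
    1 - R.curv s * y ≤ 2 := by
  have := (abs_le.1 (abs_curv_mul_lt R s hy)).1
  have := epsw_div_w_pos R
  linarith

theorem sin_eps1_pos (P : Params) : 0 < sin P.eps1 :=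
  sin_pos_of_pos_of_lt_pi P.eps1_pos (by have := P.eps1_lt; have := pi_pos; linarith)

theorem abs_th_lt_of_latEnergy (P : Params) {y θ : ℝ}
    (h : latEnergy P y θ < (π / 2 - P.eps1) ^ 2) : |θ| < π / 2 - P.eps1 := by
  refine abs_lt_of_sq_lt_sq (lt_of_le_of_lt ?_ h) (by linarith [P.eps1_lt])
  have := P.k1_pos
  have : 0 ≤ P.k1 * y ^ 2 := by positivity
  unfold latEnergy; linarith

theorem sin_eps1_le_cos (P : Params) {θ : ℝ} (h : |θ| < π / 2 - P.eps1) :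
    sin P.eps1 ≤ cos θ := by
  rw [← cos_pi_div_two_sub, ← cos_abs θ]
  exact cos_le_cos_of_nonneg_of_le_pi (abs_nonneg _) (by linarith [P.eps1_pos, pi_pos]) h.le

/-! ### From the vehicles to the reduced dynamics -/

theorem mul_sign_self (v : ℝ) : v * Real.sign v = |v| := by
  rcases lt_trichotomy v 0 with h | rfl | h
  · rw [Real.sign_of_neg h, abs_of_neg h]; ring
  · simp
  · rw [Real.sign_of_pos h, abs_of_pos h]; ring

/-- The feedforward curvature term cancels, and the factor `v` turns every `sign v` into `|v|`, so
the reduced field is continuous in the speed. -/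
theorem thErrRate_eq (R : Road) (P : Params) (x : VehicleState) :
    thErrRate R P x = thField P (safeWidth R) x.y (thErr R x) x.v := by
  unfold thErrRate chi chiNom chiBar dLσ dRσ thField
  rw [← mul_sign_self, dL_eq, dR_eq]
  ring

/-- No follower touches a road edge or its predecessor, or is perpendicular to the road. -/
def Safe (R : Road) (P : Params) (X : State) : Prop :=
  ∀ i ∈ Finset.Icc 2 P.n, 0 < dRho P X i ∧ |(X i).y| < safeWidth R ∧ |thErr R (X i)| < π / 2

theorem horizon_mem_nhdsGE {J : Set ℝ} (hJ : IsHorizon J) {t : ℝ} (ht : t ∈ J) : J ∈ 𝓝[≥] t := by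
  rcases hJ with rfl | ⟨T, _, rfl⟩
  · exact mem_of_superset self_mem_nhdsWithin (Ici_subset_Ici.2 ht)
  · exact mem_of_superset (Ico_mem_nhdsGE ht.2) (Ico_subset_Ico_left ht.1)

theorem horizon_Icc_subset {J : Set ℝ} (hJ : IsHorizon J) {t : ℝ} (ht : t ∈ J) : Icc 0 t ⊆ J := by
  rcases hJ with rfl | ⟨T, _, rfl⟩
  · exact Icc_subset_Ici_self
  · exact fun u hu => ⟨hu.1, hu.2.trans_lt ht.2⟩

theorem horizon_nonneg {J : Set ℝ} (hJ : IsHorizon J) {t : ℝ} (ht : t ∈ J) : 0 ≤ t := by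
  rcases hJ with rfl | ⟨T, _, rfl⟩
  · exact ht
  · exact ht.1

theorem one_mem (P : Params) : 1 ∈ Finset.Icc 1 P.n := Finset.mem_Icc.2 ⟨le_rfl, P.n_pos⟩

theorem mem_of_follower {P : Params} {i : ℕ} (hi : i ∈ Finset.Icc 2 P.n) : i ∈ Finset.Icc 1 P.n := by
  rw [Finset.mem_Icc] at *; omega

theorem pred_mem {P : Params} {i : ℕ} (hi : i ∈ Finset.Icc 2 P.n) : i - 1 ∈ Finset.Icc 1 P.n := by
  rw [Finset.mem_Icc] at *; omega

theorem eq_one_or_follower {P : Params} {i : ℕ} (hi : i ∈ Finset.Icc 1 P.n) :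
    i = 1 ∨ i ∈ Finset.Icc 2 P.n := by
  rw [Finset.mem_Icc] at *; omega

theorem vVirt_of_onTrack {R : Road} {P : Params} {x : VehicleState} (h : OnTrack R P x) :
    vVirt R x = P.vstar := by
  simp [vVirt, h.1, h.2.1, h.2.2]

theorem aVirt_follower (R : Road) (P : Params) (X : State) {i : ℕ} (hi : 2 ≤ i) :
    aVirt R P X i = (P.k4 * (gap X i - P.estar i) + P.k5 * nu R X i + aVirt R P X (i - 1))
        + P.k6 * (nu R X i / dRho P X i) := by
  obtain ⟨j, rfl⟩ := Nat.exists_eq_add_of_le' hi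
  rfl

namespace IsClosedLoop
variable {R : Road} {P : Params} {X : ℝ → State} {J : Set ℝ} {t : ℝ} {i : ℕ}

theorem bicycle (h : IsClosedLoop R P X J) (hi : i ∈ Finset.Icc 1 P.n) :
    ∃ a χ : ℝ → ℝ, IsBicycle (fun t => X t i) a χ J := by
  rcases eq_one_or_follower hi with rfl | hi
  · exact h.leader
  · exact ⟨_, _, h.follower i hi⟩

theorem cont_thErr (h : IsClosedLoop R P X J) (hi : i ∈ Finset.Icc 1 P.n) :
    ContinuousOn (fun t => thErr R (X t i)) J := by
  obtain ⟨a, χ, hb⟩ := h.bicycle hi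
  have h1 : ContinuousOn (fun t => (X t i).th) J :=
    fun t ht => (hb t ht).2.2.2.continuousWithinAt
  have hang : Continuous R.ang := continuous_iff_continuousAt.2 fun s => (R.ang_deriv s).continuousAt
  exact h1.sub (hang.comp_continuousOn (h.cont_s i hi))

theorem cont_dRho (h : IsClosedLoop R P X J) (hi : i ∈ Finset.Icc 2 P.n) :
    ContinuousOn (fun t => dRho P (X t) i) J :=
  ((h.cont_s _ (pred_mem hi)).sub (h.cont_s i (mem_of_follower hi))).sub continuousOn_const

theorem abs_y_lt (h : IsClosedLoop R P X J) (ht : t ∈ J) (hS : Safe R P (X t))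
    (hi : i ∈ Finset.Icc 1 P.n) : |(X t i).y| < safeWidth R := by
  rcases eq_one_or_follower hi with rfl | hi
  · rw [(h.leader_track t ht).1, abs_zero]
    exact safeWidth_pos R
  · exact (hS i hi).2.1

theorem hasDeriv_sy (h : IsClosedLoop R P X J) (ht : t ∈ J) (hS : Safe R P (X t))
    (hi : i ∈ Finset.Icc 1 P.n) :
    HasDerivWithinAt (fun τ => (X τ i).s) (vVirt R (X t i)) J t ∧
      HasDerivWithinAt (fun τ => (X τ i).y) (yRate R (X t i)) J t := by
  obtain ⟨a, χ, hb⟩ := h.bicycle hi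
  exact hasDeriv_pathCoordinates R ht (h.projects i hi) (h.cont_s i hi t ht) (h.cont_y i hi t ht)
    (one_sub_curv_mul_pos R _ (h.abs_y_lt ht hS hi)).ne' (hb t ht).1 (hb t ht).2.1

theorem hasDeriv_thErr (h : IsClosedLoop R P X J) (ht : t ∈ J) (hS : Safe R P (X t))
    (hi : i ∈ Finset.Icc 2 P.n) :
    HasDerivWithinAt (fun τ => thErr R (X τ i)) (thErrRate R P (X t i)) J t := by
  have h1 := (h.follower i hi t ht).2.2.2
  have h2 := (R.ang_deriv (X t i).s).comp_hasDerivWithinAt t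
    (h.hasDeriv_sy ht hS (mem_of_follower hi)).1
  refine (h1.sub h2).congr_deriv ?_
  simp only [thErrRate, vVirt]
  ring

theorem hasDeriv_curvFactor (h : IsClosedLoop R P X J) (ht : t ∈ J) (hS : Safe R P (X t))
    (hi : i ∈ Finset.Icc 2 P.n) :
    HasDerivWithinAt (fun τ => 1 - R.curv (X τ i).s * (X τ i).y)
      (-(curvRate R (X t i) * (X t i).y + R.curv (X t i).s * yRate R (X t i))) J t := by
  obtain ⟨hs, hy⟩ := h.hasDeriv_sy ht hS (mem_of_follower hi)
  have h1 := (R.curv_diff (X t i).s).hasDerivAt.comp_hasDerivWithinAt t hs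
  exact (h1.mul hy).const_sub 1

/-- The acceleration law realizes the virtual acceleration. -/
theorem hasDeriv_vVirt (h : IsClosedLoop R P X J) (ht : t ∈ J) (hS : Safe R P (X t))
    (hi : i ∈ Finset.Icc 1 P.n) :
    HasDerivWithinAt (fun τ => vVirt R (X τ i)) (aVirt R P (X t) i) J t := by
  rcases eq_one_or_follower hi with rfl | hi
  · exact (hasDerivWithinAt_const t J P.vstar).congr
      (fun τ hτ => vVirt_of_onTrack (h.leader_track τ hτ)) (vVirt_of_onTrack (h.leader_track t ht))
  · have hpos := one_sub_curv_mul_pos R (X t i).s (hS i hi).2.1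
    have hcos : 0 < cos (thErr R (X t i)) := cos_pos_of_mem_Ioo (abs_lt.1 (hS i hi).2.2)
    have h1 := (((h.follower i hi t ht).2.2.1).mul (h.hasDeriv_thErr ht hS hi).cos).div
      (h.hasDeriv_curvFactor ht hS hi) hpos.ne'
    refine h1.congr_deriv ?_
    unfold acc
    have hv : vVirt R (X t i) * ((1 - R.curv (X t i).s * (X t i).y) / cos (thErr R (X t i)))
        = (X t i).v := by
      unfold vVirt; field_simp
    have hv2 : vVirt R (X t i) * (1 - R.curv (X t i).s * (X t i).y) =
        (X t i).v * cos (thErr R (X t i)) := by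
      unfold vVirt; field_simp
    simp only [Pi.mul_apply]
    -- By `hv` the correction term with gain `k` vanishes identically.
    rw [hv, sub_self, mul_zero, sub_zero, div_eq_iff (by positivity)]
    generalize (curvRate R (X t i) * (X t i).y + R.curv (X t i).s * yRate R (X t i)) = D
    rw [← hv2]
    field_simp
    ring

theorem cont_vVirt (h : IsClosedLoop R P X J) (ht : t ∈ J) (hS : Safe R P (X t))
    (hi : i ∈ Finset.Icc 1 P.n) : ContinuousWithinAt (fun τ => vVirt R (X τ i)) J t :=
  (h.hasDeriv_vVirt ht hS hi).continuousWithinAt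

theorem lonMotion (h : IsClosedLoop R P X J) (hJ : IsHorizon J) (ht : t ∈ J)
    (hS : ∀ u ∈ Icc 0 t, Safe R P (X u)) (hi : i ∈ Finset.Icc 2 P.n) :
    LonMotion P (P.estar i - P.eps) (fun τ => dRho P (X τ) i) (fun τ => nu R (X τ) i) 0 t := by
  have hsub := horizon_Icc_subset hJ ht
  have hmono : ∀ u ∈ Ico 0 t, J ∈ 𝓝[Ici u] u := fun u hu =>
    horizon_mem_nhdsGE hJ (hsub ⟨hu.1, hu.2.le⟩)
  refine ⟨(h.cont_dRho hi).mono hsub, fun u hu => ?_, fun u hu => (hS u hu i hi).1,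
    fun u hu => ?_, fun u hu => ?_⟩
  · exact ((h.cont_vVirt (hsub hu) (hS u hu) (pred_mem hi)).sub
      (h.cont_vVirt (hsub hu) (hS u hu) (mem_of_follower hi))).mono hsub
  · have hu' : u ∈ Icc 0 t := ⟨hu.1, hu.2.le⟩
    exact (((h.hasDeriv_sy (hsub hu') (hS u hu') (pred_mem hi)).1.sub
      (h.hasDeriv_sy (hsub hu') (hS u hu') (mem_of_follower hi)).1).sub_const
        P.eps).mono_of_mem_nhdsWithin (hmono u hu)
  · have hu' : u ∈ Icc 0 t := ⟨hu.1, hu.2.le⟩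
    refine (((h.hasDeriv_vVirt (hsub hu') (hS u hu') (pred_mem hi)).sub
      (h.hasDeriv_vVirt (hsub hu') (hS u hu') (mem_of_follower hi))).mono_of_mem_nhdsWithin
        (hmono u hu)).congr_deriv ?_
    -- The recursive summand cancels the predecessor's virtual acceleration, which decouples this
    -- pair from the rest of the platoon.
    rw [aVirt_follower R P (X u) (Finset.mem_Icc.1 hi).1]
    unfold dRho
    ring

theorem latMotion (h : IsClosedLoop R P X J) (hJ : IsHorizon J) (ht : t ∈ J)
    (hS : ∀ u ∈ Icc 0 t, Safe R P (X u)) (hi : i ∈ Finset.Icc 2 P.n) :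
    LatMotion P (safeWidth R) (fun τ => (X τ i).y) (fun τ => thErr R (X τ i)) (fun τ => (X τ i).v)
      0 t := by
  have hsub := horizon_Icc_subset hJ ht
  have hmono : ∀ u ∈ Ico 0 t, J ∈ 𝓝[Ici u] u := fun u hu =>
    horizon_mem_nhdsGE hJ (hsub ⟨hu.1, hu.2.le⟩)
  refine ⟨(h.cont_y i (mem_of_follower hi)).mono hsub, (h.cont_thErr (mem_of_follower hi)).mono hsub,
    fun u hu => (hS u hu i hi).2.1, fun u hu => (hS u hu i hi).2.2.le, fun u hu => ?_, fun u hu => ?_⟩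
  · have hu' : u ∈ Icc 0 t := ⟨hu.1, hu.2.le⟩
    exact (h.hasDeriv_sy (hsub hu') (hS u hu') (mem_of_follower hi)).2.mono_of_mem_nhdsWithin
      (hmono u hu)
  · have hu' : u ∈ Icc 0 t := ⟨hu.1, hu.2.le⟩
    rw [← thErrRate_eq]
    exact (h.hasDeriv_thErr (hsub hu') (hS u hu') hi).mono_of_mem_nhdsWithin (hmono u hu)

end IsClosedLoop

/-! ### Elementary estimates -/

theorem abs_le_sqrt_mul {x a b N : ℝ} (ha : 0 < a) (hb : 0 ≤ b) (hN : 0 ≤ N)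
    (h : a * x ^ 2 ≤ b * N ^ 2) : |x| ≤ √(b / a) * N := by
  refine abs_le_of_sq_le_sq ?_ (by positivity)
  rw [mul_pow, Real.sq_sqrt (by positivity), div_mul_eq_mul_div, le_div_iff₀ ha]
  linarith

theorem abs_nu_le_sqrt (P : Params) (ds d ν : ℝ) : |ν| ≤ √(2 * lonEnergy P ds d ν) := by
  refine abs_le_sqrt ?_
  have := P.k4_pos
  have : 0 ≤ P.k4 * (d - ds) ^ 2 := by positivity
  unfold lonEnergy; linarith

theorem abs_gap_le_sqrt (P : Params) (ds d ν : ℝ) :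
    |d - ds| ≤ √(2 * lonEnergy P ds d ν / P.k4) := by
  refine abs_le_sqrt ?_
  rw [le_div_iff₀ P.k4_pos]
  have := sq_nonneg ν
  unfold lonEnergy; linarith

theorem dstar_pos {P : Params} {i : ℕ} (hi : i ∈ Finset.Icc 2 P.n) : 0 < P.estar i - P.eps := by
  have := P.L_pos i hi; have := P.estar_gt i hi; linarith

theorem vVirt_eq_sub_sum (R : Road) (X : State) {i : ℕ} (hi : 1 ≤ i) :
    vVirt R (X i) = vVirt R (X 1) - ∑ j ∈ Finset.Icc 2 i, nu R X j := by
  induction i, hi using Nat.le_induction with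
  | base => simp
  | succ k hk ih =>
    rw [Finset.sum_Icc_succ_top (by omega), ← sub_sub, ← ih]
    simp [nu]

theorem lonErr_fst (P : Params) (X : State) {i : ℕ} (hi : 1 ≤ i) :
    (lonErr P X i).1 = -∑ j ∈ Finset.Icc 2 i, (gap X j - P.estar j) := by
  induction i, hi using Nat.le_induction with
  | base => simp [lonErr, sStar]
  | succ k hk ih =>
    rw [Finset.sum_Icc_succ_top (by omega), neg_add, ← ih]
    simp only [lonErr, sStar, gap, Finset.sum_Icc_succ_top (show 2 ≤ k + 1 by omega),
      Nat.add_sub_cancel]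
    ring

theorem abs_one_sub_cos_le (θ : ℝ) : |1 - cos θ| ≤ |θ| := by
  rcases le_or_gt |θ| 1 with h | h
  · rw [abs_of_nonneg (by linarith [cos_le_one θ])]
    have := one_sub_sq_div_two_le_cos (x := θ)
    nlinarith [sq_abs θ, abs_nonneg θ]
  · have := neg_one_le_cos θ
    have h2 := cos_le_one θ
    rw [abs_of_nonneg (by linarith)]
    rcases le_or_gt |θ| 2 with h' | h'
    · have := one_sub_sq_div_two_le_cos (x := θ)
      nlinarith [sq_abs θ, abs_nonneg θ]
    · linarith

section speed
variable (R : Road) (P : Params) {x : VehicleState}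

theorem v_eq (hy : |x.y| < safeWidth R) (hc : 0 < cos (thErr R x)) :
    x.v = vVirt R x * (1 - R.curv x.s * x.y) / cos (thErr R x) := by
  have := one_sub_curv_mul_pos R x.s hy
  unfold vVirt; field_simp

theorem abs_speedDefect_le :
    |P.vstar * (cos (thErr R x) - 1 + R.curv x.s * x.y)| ≤
      P.vstar * (|thErr R x| + |x.y| / R.w) := by
  rw [abs_mul, abs_of_pos P.vstar_pos]
  have := P.vstar_pos
  gcongr
  refine (abs_add_le _ _).trans (add_le_add ?_ (abs_curv_mul_le R _ _))
  rw [abs_sub_comm]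
  exact abs_one_sub_cos_le _

theorem abs_vVirt_sub_le (hy : |x.y| < safeWidth R) :
    |vVirt R x - P.vstar| ≤
      (|x.v - P.vstar| + P.vstar * (|thErr R x| + |x.y| / R.w)) / (R.epsw / R.w) := by
  have h1 := one_sub_curv_mul_pos R x.s hy
  have h2 : vVirt R x - P.vstar = ((x.v - P.vstar) * cos (thErr R x) +
      P.vstar * (cos (thErr R x) - 1 + R.curv x.s * x.y)) / (1 - R.curv x.s * x.y) := by
    unfold vVirt; field_simp; ring
  rw [h2, abs_div, abs_of_pos h1]
  have h3 := epsw_div_w_pos R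
  refine div_le_div₀ ?_ ?_ h3 (le_one_sub_curv_mul R _ hy)
  · have := P.vstar_pos; have := w_pos R
    positivity
  · refine (abs_add_le _ _).trans (add_le_add ?_ (abs_speedDefect_le R P))
    rw [abs_mul]
    exact mul_le_of_le_one_right (abs_nonneg _) (abs_cos_le_one _)

theorem abs_v_sub_le (hy : |x.y| < safeWidth R) (hc : sin P.eps1 ≤ cos (thErr R x)) :
    |x.v - P.vstar| ≤
      (2 * |vVirt R x - P.vstar| + P.vstar * (|thErr R x| + |x.y| / R.w)) / sin P.eps1 := by
  have h0 := sin_eps1_pos P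
  have hcos := h0.trans_le hc
  have h1 := one_sub_curv_mul_pos R x.s hy
  have h2 : x.v - P.vstar = ((vVirt R x - P.vstar) * (1 - R.curv x.s * x.y) -
      P.vstar * (cos (thErr R x) - 1 + R.curv x.s * x.y)) / cos (thErr R x) := by
    unfold vVirt; field_simp; ring
  rw [h2, abs_div, abs_of_pos hcos]
  refine div_le_div₀ ?_ ?_ h0 hc
  · have := P.vstar_pos; have := w_pos R
    positivity
  · refine (abs_sub _ _).trans (add_le_add ?_ (abs_speedDefect_le R P))
    rw [abs_mul, abs_of_pos h1, mul_comm]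
    gcongr
    exact one_sub_curv_mul_le R _ hy

theorem abs_v_le (hy : |x.y| < safeWidth R) (hc : sin P.eps1 ≤ cos (thErr R x)) {B : ℝ}
    (hB : |vVirt R x| ≤ B) : |x.v| ≤ B * 2 / sin P.eps1 := by
  have h0 := sin_eps1_pos P
  have hcos := h0.trans_le hc
  have h1 := one_sub_curv_mul_pos R x.s hy
  have hB0 := (abs_nonneg _).trans hB
  rw [v_eq R hy hcos, abs_div, abs_mul, abs_of_pos h1, abs_of_pos hcos]
  gcongr
  exact one_sub_curv_mul_le R _ hy

theorem le_v (hy : |x.y| < safeWidth R) (hc : 0 < cos (thErr R x)) {c : ℝ} (hc0 : 0 ≤ c)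
    (hB : c ≤ vVirt R x) : c * (R.epsw / R.w) ≤ x.v := by
  have h1 := le_one_sub_curv_mul R x.s hy
  have h2 := epsw_div_w_pos R
  rw [v_eq R hy hc, le_div_iff₀ hc]
  have h3 : c * (R.epsw / R.w) ≤ vVirt R x * (1 - R.curv x.s * x.y) := by
    gcongr
    exact hc0.trans hB
  refine le_trans ?_ h3
  exact mul_le_of_le_one_right (by positivity) (cos_le_one _)

end speed

/-! ### Safety -/

/-- bound of the relative virtual speed `ν_i` along a motion from `X₀` -/
def nuBound (R : Road) (P : Params) (X₀ : State) (i : ℕ) : ℝ :=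
  √(2 * lonEnergy P (P.estar i - P.eps) (dRho P X₀ i) (nu R X₀ i))

/-- bound of the virtual speeds along a motion from `X₀` -/
def virtSpeedBound (R : Road) (P : Params) (X₀ : State) : ℝ :=
  P.vstar + ∑ j ∈ Finset.Icc 2 P.n, nuBound R P X₀ j

/-- bound of the speeds along a motion from `X₀` -/
def speedBound (R : Road) (P : Params) (X₀ : State) : ℝ :=
  virtSpeedBound R P X₀ * 2 / sin P.eps1

theorem nuBound_nonneg (R : Road) (P : Params) (X₀ : State) (i : ℕ) : 0 ≤ nuBound R P X₀ i :=
  Real.sqrt_nonneg _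

/-- lower bound of the distance `d_i^ρ` along a motion from `X₀` -/
def rhoBound (R : Road) (P : Params) (X₀ : State) (i : ℕ) : ℝ :=
  exp (-(lonLyap P (P.estar i - P.eps) (dRho P X₀ i) (nu R X₀ i) /
    (P.k6 * (P.estar i - P.eps))))

/-- loss rate of the logarithm of the distance to a road edge for speeds up to `M` -/
def logRate (P : Params) (m M : ℝ) : ℝ := M * (1 + P.k1 * m / P.k3)

theorem SafeInitial.abs_y_lt {R : Road} {P : Params} {X : State} (h : SafeInitial R P X) {i : ℕ}
    (hi : i ∈ Finset.Icc 2 P.n) : |(X i).y| < safeWidth R := by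
  have h1 := h.left_pos i hi
  have h2 := h.right_pos i hi
  rw [dL_eq] at h1
  rw [dR_eq] at h2
  rw [abs_lt]
  constructor <;> linarith

theorem SafeInitial.latEnergy_lt {R : Road} {P : Params} {X : State} (h : SafeInitial R P X)
    {i : ℕ} (hi : i ∈ Finset.Icc 2 P.n) :
    latEnergy P (X i).y (thErr R (X i)) < (π / 2 - P.eps1) ^ 2 := h.lyap i hi

theorem SafeInitial.safe {R : Road} {P : Params} {X : State} (h : SafeInitial R P X) :
    Safe R P X := fun i hi =>
  ⟨h.rho_pos i hi, h.abs_y_lt hi,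
    (abs_th_lt_of_latEnergy P (h.latEnergy_lt hi)).trans (by linarith [P.eps1_pos])⟩

namespace IsClosedLoop
variable {R : Road} {P : Params} {X : ℝ → State} {J : Set ℝ} {t : ℝ} {i : ℕ}

theorem lonEnergy_le (h : IsClosedLoop R P X J) (hJ : IsHorizon J) (ht : t ∈ J)
    (hS : ∀ u ∈ Icc 0 t, Safe R P (X u)) (hi : i ∈ Finset.Icc 2 P.n) :
    lonEnergy P (P.estar i - P.eps) (dRho P (X t) i) (nu R (X t) i) ≤
      lonEnergy P (P.estar i - P.eps) (dRho P (X 0) i) (nu R (X 0) i) :=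
  (h.lonMotion hJ ht hS hi).energy_le (horizon_nonneg hJ ht)

theorem abs_nu_le (h : IsClosedLoop R P X J) (hJ : IsHorizon J) (ht : t ∈ J)
    (hS : ∀ u ∈ Icc 0 t, Safe R P (X u)) (hi : i ∈ Finset.Icc 2 P.n) :
    |nu R (X t) i| ≤ nuBound R P (X 0) i := by
  refine (abs_nu_le_sqrt P (P.estar i - P.eps) (dRho P (X t) i) _).trans ?_
  unfold nuBound
  gcongr
  exact h.lonEnergy_le hJ ht hS hi

theorem rhoBound_le (h : IsClosedLoop R P X J) (hJ : IsHorizon J) (ht : t ∈ J)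
    (hS : ∀ u ∈ Icc 0 t, Safe R P (X u)) (hi : i ∈ Finset.Icc 2 P.n) :
    rhoBound R P (X 0) i ≤ dRho P (X t) i :=
  (h.lonMotion hJ ht hS hi).exp_le (horizon_nonneg hJ ht) (dstar_pos hi)

theorem latEnergy_le (h : IsClosedLoop R P X J) (hJ : IsHorizon J) (ht : t ∈ J)
    (hS : ∀ u ∈ Icc 0 t, Safe R P (X u)) (hi : i ∈ Finset.Icc 2 P.n) :
    latEnergy P (X t i).y (thErr R (X t i)) ≤ latEnergy P (X 0 i).y (thErr R (X 0 i)) :=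
  (h.latMotion hJ ht hS hi).energy_le (horizon_nonneg hJ ht)

theorem sin_eps1_le_cos (h : IsClosedLoop R P X J) (hJ : IsHorizon J) (h0 : SafeInitial R P (X 0))
    (ht : t ∈ J) (hS : ∀ u ∈ Icc 0 t, Safe R P (X u)) (hi : i ∈ Finset.Icc 2 P.n) :
    sin P.eps1 ≤ cos (thErr R (X t i)) :=
  Platoon.sin_eps1_le_cos P (abs_th_lt_of_latEnergy P
    ((h.latEnergy_le hJ ht hS hi).trans_lt (h0.latEnergy_lt hi)))

theorem vVirt_sub_vstar (h : IsClosedLoop R P X J) (ht : t ∈ J) (hi : i ∈ Finset.Icc 1 P.n) :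
    vVirt R (X t i) - P.vstar = -∑ j ∈ Finset.Icc 2 i, nu R (X t) j := by
  rw [vVirt_eq_sub_sum R (X t) (Finset.mem_Icc.1 hi).1, vVirt_of_onTrack (h.leader_track t ht)]
  ring

theorem abs_vVirt_le (h : IsClosedLoop R P X J) (hJ : IsHorizon J) (ht : t ∈ J)
    (hS : ∀ u ∈ Icc 0 t, Safe R P (X u)) (hi : i ∈ Finset.Icc 1 P.n) :
    |vVirt R (X t i)| ≤ virtSpeedBound R P (X 0) := by
  have hsub : Finset.Icc 2 i ⊆ Finset.Icc 2 P.n :=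
    Finset.Icc_subset_Icc_right (Finset.mem_Icc.1 hi).2
  have h1 : vVirt R (X t i) = P.vstar + -∑ j ∈ Finset.Icc 2 i, nu R (X t) j := by
    rw [← h.vVirt_sub_vstar ht hi]; ring
  rw [h1]
  refine (abs_add_le _ _).trans ?_
  rw [abs_of_pos P.vstar_pos, abs_neg]
  unfold virtSpeedBound
  gcongr
  calc |∑ j ∈ Finset.Icc 2 i, nu R (X t) j| ≤ ∑ j ∈ Finset.Icc 2 i, |nu R (X t) j| :=
        Finset.abs_sum_le_sum_abs _ _
    _ ≤ ∑ j ∈ Finset.Icc 2 i, nuBound R P (X 0) j :=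
        Finset.sum_le_sum fun j hj => h.abs_nu_le hJ ht hS (hsub hj)
    _ ≤ ∑ j ∈ Finset.Icc 2 P.n, nuBound R P (X 0) j :=
        Finset.sum_le_sum_of_subset_of_nonneg hsub fun j _ _ => nuBound_nonneg R P _ j

theorem abs_v_le (h : IsClosedLoop R P X J) (hJ : IsHorizon J) (h0 : SafeInitial R P (X 0))
    (ht : t ∈ J) (hS : ∀ u ∈ Icc 0 t, Safe R P (X u)) (hi : i ∈ Finset.Icc 2 P.n) :
    |(X t i).v| ≤ speedBound R P (X 0) :=
  Platoon.abs_v_le R P (hS t (right_mem_Icc.2 (horizon_nonneg hJ ht)) i hi).2.1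
    (h.sin_eps1_le_cos hJ h0 ht hS hi) (h.abs_vVirt_le hJ ht hS (mem_of_follower hi))

theorem speedBound_nonneg (R : Road) (P : Params) (X₀ : State) : 0 ≤ speedBound R P X₀ := by
  have := P.vstar_pos; have := sin_eps1_pos P
  have := Finset.sum_nonneg fun j (_ : j ∈ Finset.Icc 2 P.n) => nuBound_nonneg R P X₀ j
  unfold speedBound virtSpeedBound
  positivity

/-- The distances to the road edges stay away from zero on bounded time intervals. -/
theorem exp_le_edge_gaps (h : IsClosedLoop R P X J) (hJ : IsHorizon J) (h0 : SafeInitial R P (X 0))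
    (ht : t ∈ J) (hS : ∀ u ∈ Icc 0 t, Safe R P (X u)) (hi : i ∈ Finset.Icc 2 P.n) {T : ℝ}
    (hT : t ≤ T) :
    exp (log (safeWidth R - (X 0 i).y) - (π / 2 + 1) / P.k3 -
        logRate P (safeWidth R) (speedBound R P (X 0)) * T) ≤ safeWidth R - (X t i).y ∧
      exp (log (safeWidth R + (X 0 i).y) - (π / 2 + 1) / P.k3 -
        logRate P (safeWidth R) (speedBound R P (X 0)) * T) ≤ safeWidth R + (X t i).y := by
  have ht0 := horizon_nonneg hJ ht
  have hL := h.latMotion hJ ht hS hi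
  have hM : ∀ u ∈ Ico 0 t, |(X u i).v| ≤ speedBound R P (X 0) := fun u hu =>
    h.abs_v_le hJ h0 (horizon_Icc_subset hJ ht ⟨hu.1, hu.2.le⟩)
      (fun s hs => hS s ⟨hs.1, hs.2.trans hu.2.le⟩) hi
  have h1 := hL.log_gap_ge ht0 hM
  have h2 := hL.neg.log_gap_ge ht0 hM
  simp only [sub_neg_eq_add, sub_zero] at h1 h2
  obtain ⟨g1, g2⟩ := hL.gaps_pos (right_mem_Icc.2 ht0)
  have hr : logRate P (safeWidth R) (speedBound R P (X 0)) * t ≤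
      logRate P (safeWidth R) (speedBound R P (X 0)) * T := by
    have := speedBound_nonneg R P (X 0)
    have := P.k1_pos; have := P.k3_pos; have := safeWidth_pos R
    unfold logRate
    gcongr
  rw [← le_log_iff_exp_le g1, ← le_log_iff_exp_le g2]
  unfold logRate at *
  constructor <;> linarith

/-- Motions from safe initial states are safe. -/
theorem safe (h : IsClosedLoop R P X J) (hJ : IsHorizon J) (h0 : SafeInitial R P (X 0))
    (ht : t ∈ J) : Safe R P (X t) := by
  have hsub := horizon_Icc_subset hJ ht
  have ht0 := horizon_nonneg hJ ht
  -- Safety is an open condition. It survives at the right end of an interval because the a priori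
  -- bounds, valid before that end, pass to the limit with constants that depend only on the initial
  -- state and the horizon.
  refine trapping (S := fun u => Safe R P (X u)) h0.safe ?_ ?_ t (right_mem_Icc.2 ht0)
  · intro u hu hSu
    have huJ : u ∈ J := hsub ⟨hu.1, hu.2.le⟩
    have hle : 𝓝[>] u ≤ 𝓝[J] u :=
      (nhdsWithin_mono _ Ioi_subset_Ici_self).trans
        (nhdsWithin_le_iff.2 (horizon_mem_nhdsGE hJ huJ))
    refine hle ?_
    rw [← Filter.Eventually]
    refine (Filter.eventually_all_finset _).2 fun i hi => ?_
    obtain ⟨h1, h2, h3⟩ := hSu i hi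
    exact (((h.cont_dRho hi) u huJ).eventually (lt_mem_nhds h1)).and
      ((((h.cont_y i (mem_of_follower hi)) u huJ).abs.eventually (gt_mem_nhds h2)).and
        ((((h.cont_thErr (mem_of_follower hi)) u huJ).abs).eventually (gt_mem_nhds h3)))
  · intro u hu hS i hi
    have huJ : u ∈ J := hsub ⟨hu.1.le, hu.2⟩
    have hS' : ∀ s ∈ Ico 0 u, ∀ r ∈ Icc 0 s, Safe R P (X r) := fun s hs r hr =>
      hS r ⟨hr.1, hr.2.trans_lt hs.2⟩
    have hJ' : ∀ s ∈ Ico 0 u, s ∈ J := fun s hs => hsub ⟨hs.1, hs.2.le.trans hu.2⟩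
    have hmem : ∀ᶠ s in 𝓝[<] u, s ∈ Ico 0 u := Ico_mem_nhdsLT hu.1
    have hlim : 𝓝[<] u ≤ 𝓝[J] u := by
      refine nhdsWithin_le_iff.2 ?_
      filter_upwards [hmem] with s hs using hJ' s hs
    have c1 := ((h.cont_dRho hi) u huJ).tendsto.mono_left hlim
    have c2 := ((h.cont_y i (mem_of_follower hi)) u huJ).tendsto.mono_left hlim
    have c3 := ((h.cont_thErr (mem_of_follower hi)) u huJ).tendsto.mono_left hlim
    have b1 : rhoBound R P (X 0) i ≤ dRho P (X u) i := ge_of_tendsto c1 (by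
      filter_upwards [hmem] with s hs using h.rhoBound_le hJ (hJ' s hs) (hS' s hs) hi)
    have b2 := ge_of_tendsto (c2.const_sub (safeWidth R)) (by
      filter_upwards [hmem] with s hs using
        (h.exp_le_edge_gaps hJ h0 (hJ' s hs) (hS' s hs) hi hs.2.le).1)
    have b3 := ge_of_tendsto (c2.const_add (safeWidth R)) (by
      filter_upwards [hmem] with s hs using
        (h.exp_le_edge_gaps hJ h0 (hJ' s hs) (hS' s hs) hi hs.2.le).2)
    have b4 : |thErr R (X u i)| ≤ π / 2 - P.eps1 := le_of_tendsto c3.abs (by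
      filter_upwards [hmem] with s hs using (abs_th_lt_of_latEnergy P
        ((h.latEnergy_le hJ (hJ' s hs) (hS' s hs) hi).trans_lt (h0.latEnergy_lt hi))).le)
    refine ⟨(exp_pos _).trans_le b1, abs_lt.2 ⟨?_, ?_⟩, b4.trans_lt (by linarith [P.eps1_pos])⟩
    · linarith [(exp_pos _).trans_le b3]
    · linarith [(exp_pos _).trans_le b2]

theorem safe_on (h : IsClosedLoop R P X J) (hJ : IsHorizon J) (h0 : SafeInitial R P (X 0))
    (ht : t ∈ J) : ∀ u ∈ Icc 0 t, Safe R P (X u) := fun _ hu =>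
  h.safe hJ h0 (horizon_Icc_subset hJ ht hu)

end IsClosedLoop

/-! ### Convergence -/

namespace SafeMotion
variable {R : Road} {P : Params} {X : ℝ → State} {i : ℕ}

theorem isHorizon_Ici : IsHorizon (Ici 0) := Or.inl rfl

theorem safe_on (h : SafeMotion R P X) {t : ℝ} (ht : 0 ≤ t) : ∀ u ∈ Icc 0 t, Safe R P (X u) :=
  h.1.safe_on isHorizon_Ici h.2 ht

theorem safe (h : SafeMotion R P X) {t : ℝ} (ht : 0 ≤ t) : Safe R P (X t) :=
  h.1.safe isHorizon_Ici h.2 ht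

theorem tendsto_lonEnergy (h : SafeMotion R P X) (hi : i ∈ Finset.Icc 2 P.n) :
    Tendsto (fun t => lonEnergy P (P.estar i - P.eps) (dRho P (X t) i) (nu R (X t) i))
      atTop (𝓝 0) :=
  LonMotion.tendsto_energy (d := fun t => dRho P (X t) i) (ν := fun t => nu R (X t) i)
    (fun _ hb => h.1.lonMotion isHorizon_Ici hb (h.safe_on hb) hi) (dstar_pos hi)

theorem tendsto_nu (h : SafeMotion R P X) (hi : i ∈ Finset.Icc 2 P.n) :
    Tendsto (fun t => nu R (X t) i) atTop (𝓝 0) := by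
  refine squeeze_zero_norm (fun t => abs_nu_le_sqrt P (P.estar i - P.eps) (dRho P (X t) i) _) ?_
  simpa using ((h.tendsto_lonEnergy hi).const_mul 2).sqrt

theorem tendsto_gap (h : SafeMotion R P X) (hi : i ∈ Finset.Icc 2 P.n) :
    Tendsto (fun t => gap (X t) i - P.estar i) atTop (𝓝 0) := by
  refine squeeze_zero_norm (a := fun t => √(2 * lonEnergy P (P.estar i - P.eps)
    (dRho P (X t) i) (nu R (X t) i) / P.k4)) (fun t => ?_) ?_
  · have := abs_gap_le_sqrt P (P.estar i - P.eps) (dRho P (X t) i) (nu R (X t) i)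
    rw [Real.norm_eq_abs]
    convert this using 2
    unfold dRho; ring
  · simpa using (((h.tendsto_lonEnergy hi).const_mul 2).div_const P.k4).sqrt

theorem tendsto_vVirt (h : SafeMotion R P X) (hi : i ∈ Finset.Icc 1 P.n) :
    Tendsto (fun t => vVirt R (X t i) - P.vstar) atTop (𝓝 0) := by
  have h1 : Tendsto (fun t => -∑ j ∈ Finset.Icc 2 i, nu R (X t) j) atTop (𝓝 0) := by
    have := (tendsto_finsetSum (Finset.Icc 2 i) fun j hj =>
      h.tendsto_nu (Finset.Icc_subset_Icc_right (Finset.mem_Icc.1 hi).2 hj)).neg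
    simpa using this
  refine h1.congr' ?_
  filter_upwards [eventually_ge_atTop 0] with t ht using (h.1.vVirt_sub_vstar ht hi).symm

theorem tendsto_latEnergy (h : SafeMotion R P X) (hi : i ∈ Finset.Icc 2 P.n) :
    Tendsto (fun t => latEnergy P (X t i).y (thErr R (X t i))) atTop (𝓝 0) := by
  have hv := P.vstar_pos
  -- Eventually the virtual speed exceeds `v^* / 2`, hence `v_i` has a positive lower bound as the
  -- strict lateral Lyapunov function requires.
  have h1 : ∀ᶠ t in atTop, -(P.vstar / 2) < vVirt R (X t i) - P.vstar :=
    (h.tendsto_vVirt (mem_of_follower hi)).eventually (lt_mem_nhds (by linarith))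
  obtain ⟨t₀, ht₀⟩ := eventually_atTop.1 (h1.and (eventually_ge_atTop 0))
  have ht₀0 := (ht₀ t₀ le_rfl).2
  refine LatMotion.tendsto_energy (m := safeWidth R) (y := fun t => (X t i).y)
    (θ := fun t => thErr R (X t i)) (v := fun t => (X t i).v)
    (fun _ hb => h.1.latMotion isHorizon_Ici hb (h.safe_on hb) hi) ht₀0
    (mul_pos (half_pos hv) (epsw_div_w_pos R)) fun t ht => ?_
  obtain ⟨h2, h3⟩ := ht₀ t ht
  obtain ⟨-, hy, hth⟩ := h.safe h3 i hi
  exact le_v R hy (cos_pos_of_mem_Ioo (abs_lt.1 hth)) (by positivity) (by linarith)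

theorem tendsto_y (h : SafeMotion R P X) (hi : i ∈ Finset.Icc 2 P.n) :
    Tendsto (fun t => (X t i).y) atTop (𝓝 0) := by
  refine squeeze_zero_norm (a := fun t => √(latEnergy P (X t i).y (thErr R (X t i)) / P.k1))
    (fun t => abs_le_sqrt ?_) (by simpa using ((h.tendsto_latEnergy hi).div_const P.k1).sqrt)
  rw [le_div_iff₀ P.k1_pos]
  unfold latEnergy
  linarith [sq_nonneg (thErr R (X t i))]

theorem tendsto_thErr (h : SafeMotion R P X) (hi : i ∈ Finset.Icc 2 P.n) :
    Tendsto (fun t => thErr R (X t i)) atTop (𝓝 0) := by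
  refine squeeze_zero_norm (a := fun t => √(latEnergy P (X t i).y (thErr R (X t i))))
    (fun t => abs_le_sqrt ?_) (by simpa using (h.tendsto_latEnergy hi).sqrt)
  have := P.k1_pos
  have : 0 ≤ P.k1 * (X t i).y ^ 2 := by positivity
  unfold latEnergy
  linarith

theorem tendsto_latErr (h : SafeMotion R P X) (hi : i ∈ Finset.Icc 2 P.n) :
    Tendsto (fun t => latErr R (X t) i) atTop (𝓝 0) :=
  (h.tendsto_y hi).prodMk_nhds (h.tendsto_thErr hi)

theorem tendsto_v (h : SafeMotion R P X) (hi : i ∈ Finset.Icc 2 P.n) :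
    Tendsto (fun t => (X t i).v - P.vstar) atTop (𝓝 0) := by
  have h1 : Tendsto (fun t => (2 * |vVirt R (X t i) - P.vstar| +
      P.vstar * (|thErr R (X t i)| + |(X t i).y| / R.w)) / sin P.eps1) atTop (𝓝 0) := by
    have := ((((h.tendsto_vVirt (mem_of_follower hi)).abs.const_mul 2).add
      (((h.tendsto_thErr hi).abs.add ((h.tendsto_y hi).abs.div_const R.w)).const_mul
        P.vstar))).div_const (sin P.eps1)
    simpa using this
  refine squeeze_zero_norm' ?_ h1
  filter_upwards [eventually_ge_atTop 0] with t ht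
  exact abs_v_sub_le R P (h.safe ht i hi).2.1
    (h.1.sin_eps1_le_cos isHorizon_Ici h.2 ht (h.safe_on ht) hi)

theorem tendsto_lonErr (h : SafeMotion R P X) (hi : i ∈ Finset.Icc 2 P.n) :
    Tendsto (fun t => lonErr P (X t) i) atTop (𝓝 0) := by
  refine Tendsto.prodMk_nhds ?_ (h.tendsto_v hi)
  have h1 := (tendsto_finsetSum (Finset.Icc 2 i) fun j hj =>
    h.tendsto_gap (Finset.Icc_subset_Icc_right (Finset.mem_Icc.1 hi).2 hj)).neg
  simp only [Finset.sum_const_zero, neg_zero] at h1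
  refine h1.congr fun t => ?_
  exact (lonErr_fst P (X t) (Finset.mem_Icc.1 (mem_of_follower hi)).1).symm

/-! ### Linear bounds of the errors -/

/-- The nonincreasing lateral energy is equivalent to the squared norm, so no smallness of the
longitudinal error is needed. -/
theorem norm_latErr_le (h : SafeMotion R P X) (hi : i ∈ Finset.Icc 2 P.n) {t N : ℝ} (ht : 0 ≤ t)
    (hN : ‖latErr R (X 0) i‖ ≤ N) :
    ‖latErr R (X t) i‖ ≤ (√((P.k1 + 1) / P.k1) + √((P.k1 + 1) / 1)) * N := by
  have k1 := P.k1_pos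
  have hN0 := (norm_nonneg _).trans hN
  have hy : |(X 0 i).y| ≤ N := (norm_fst_le (latErr R (X 0) i)).trans hN
  have hth : |thErr R (X 0 i)| ≤ N := (norm_snd_le (latErr R (X 0) i)).trans hN
  have h1 := h.1.latEnergy_le isHorizon_Ici ht (h.safe_on ht) hi
  have h2 : latEnergy P (X 0 i).y (thErr R (X 0 i)) ≤ (P.k1 + 1) * N ^ 2 := by
    have e1 : (X 0 i).y ^ 2 ≤ N ^ 2 := sq_le_sq' (by linarith [(abs_le.1 hy).1]) (abs_le.1 hy).2
    have e2 : thErr R (X 0 i) ^ 2 ≤ N ^ 2 :=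
      sq_le_sq' (by linarith [(abs_le.1 hth).1]) (abs_le.1 hth).2
    unfold latEnergy
    nlinarith
  have h3 := h1.trans h2
  unfold latEnergy at h3
  have e1 : |(X t i).y| ≤ √((P.k1 + 1) / P.k1) * N :=
    abs_le_sqrt_mul k1 (by positivity) hN0 (by linarith [sq_nonneg (thErr R (X t i))])
  have e2 : |thErr R (X t i)| ≤ √((P.k1 + 1) / 1) * N := by
    refine abs_le_sqrt_mul one_pos (by positivity) hN0 ?_
    have : 0 ≤ P.k1 * (X t i).y ^ 2 := by positivity
    linarith
  have e3 : 0 ≤ √((P.k1 + 1) / P.k1) * N := by positivity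
  have e4 : 0 ≤ √((P.k1 + 1) / 1) * N := by positivity
  rw [add_mul]
  exact max_le (e1.trans (by linarith)) (e2.trans (by linarith))

/-- Lipschitz constant of the virtual speed with respect to the errors of a vehicle. -/
def virtLip (R : Road) (P : Params) : ℝ :=
  (1 + P.vstar * (1 + 1 / R.w)) / (R.epsw / R.w)

theorem virtLip_nonneg (R : Road) (P : Params) : 0 ≤ virtLip R P := by
  have := P.vstar_pos; have := w_pos R; have := R.epsw_pos
  unfold virtLip; positivity

/-- Virtual speeds depend on the lateral errors too, with constant `virtLip`. Both `ν_i` and the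
spacing error are differences between two neighbours, hence the factor `4` after squaring; the
leader contributes nothing. -/
theorem lonEnergy_initial_le (h : SafeMotion R P X) (hi : i ∈ Finset.Icc 2 P.n) {N : ℝ}
    (hN : ∀ j ∈ Finset.Icc 2 i, ‖latErr R (X 0) j‖ ≤ N ∧ ‖lonErr P (X 0) j‖ ≤ N) :
    2 * lonEnergy P (P.estar i - P.eps) (dRho P (X 0) i) (nu R (X 0) i) ≤
      4 * (virtLip R P ^ 2 + P.k4) * N ^ 2 := by
  have hvs := P.vstar_pos
  have hw := w_pos R
  have hi2 := Finset.mem_Icc.1 hi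
  have hN0 : 0 ≤ N := (norm_nonneg _).trans (hN i (Finset.mem_Icc.2 ⟨hi2.1, le_rfl⟩)).1
  have hA := virtLip_nonneg R P
  have hu : ∀ j ∈ Finset.Icc 1 i, |vVirt R (X 0 j) - P.vstar| ≤ virtLip R P * N := by
    intro j hj
    rw [Finset.mem_Icc] at hj
    rcases hj.1.eq_or_lt with rfl | hj1
    · rw [vVirt_of_onTrack h.2.leader_track, sub_self, abs_zero]
      positivity
    · have hjn : j ∈ Finset.Icc 2 P.n := Finset.mem_Icc.2 ⟨hj1, hj.2.trans hi2.2⟩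
      obtain ⟨h1, h2⟩ := hN j (Finset.mem_Icc.2 ⟨hj1, hj.2⟩)
      have hy : |(X 0 j).y| ≤ N := (norm_fst_le (latErr R (X 0) j)).trans h1
      have hth : |thErr R (X 0 j)| ≤ N := (norm_snd_le (latErr R (X 0) j)).trans h1
      have hv : |(X 0 j).v - P.vstar| ≤ N := (norm_snd_le (lonErr P (X 0) j)).trans h2
      refine (abs_vVirt_sub_le R P (h.2.abs_y_lt hjn)).trans ?_
      have := epsw_div_w_pos R
      unfold virtLip
      rw [div_mul_eq_mul_div]
      gcongr
      calc _ ≤ N + P.vstar * (N + N / R.w) := by gcongr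
        _ = _ := by ring
  have hs : ∀ j ∈ Finset.Icc 1 i, |(lonErr P (X 0) j).1| ≤ N := by
    intro j hj
    rw [Finset.mem_Icc] at hj
    rcases hj.1.eq_or_lt with rfl | hj1
    · simpa [lonErr, sStar] using hN0
    · exact (norm_fst_le (lonErr P (X 0) j)).trans (hN j (Finset.mem_Icc.2 ⟨hj1, hj.2⟩)).2
  have hm1 : i ∈ Finset.Icc 1 i := Finset.mem_Icc.2 ⟨by omega, le_rfl⟩
  have hm2 : i - 1 ∈ Finset.Icc 1 i := Finset.mem_Icc.2 ⟨by omega, by omega⟩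
  have e1 : |nu R (X 0) i| ≤ 2 * (virtLip R P * N) := by
    have : nu R (X 0) i = (vVirt R (X 0 (i - 1)) - P.vstar) - (vVirt R (X 0 i) - P.vstar) := by
      unfold nu; ring
    rw [this]
    refine (abs_sub _ _).trans ?_
    linarith [hu _ hm1, hu _ hm2]
  have e2 : |dRho P (X 0) i - (P.estar i - P.eps)| ≤ 2 * N := by
    have : dRho P (X 0) i - (P.estar i - P.eps) =
        (lonErr P (X 0) (i - 1)).1 - (lonErr P (X 0) i).1 := by
      obtain ⟨k, rfl⟩ := Nat.exists_eq_add_of_le' hi2.1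
      simp only [dRho, gap, lonErr, sStar, show k + 2 - 1 = k + 1 from rfl,
        Finset.sum_Icc_succ_top (show 2 ≤ k + 1 + 1 by omega)]
      ring
    rw [this]
    refine (abs_sub _ _).trans ?_
    linarith [hs _ hm1, hs _ hm2]
  have q1 := sq_le_sq' (by linarith [(abs_le.1 e1).1]) (abs_le.1 e1).2
  have q2 := sq_le_sq' (by linarith [(abs_le.1 e2).1]) (abs_le.1 e2).2
  have k4 := P.k4_pos
  unfold lonEnergy
  nlinarith

/-- Position and virtual speed errors telescope into fewer than `i` spacing errors and relative
speeds, each controlled by its energy. Passing from virtual to actual speed brings in the lateral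
bound and the division by `sin ε₁`. -/
theorem norm_lonErr_le (h : SafeMotion R P X) (hi : i ∈ Finset.Icc 2 P.n) {t N : ℝ} (ht : 0 ≤ t)
    (hN : ∀ j ∈ Finset.Icc 2 i, ‖latErr R (X 0) j‖ ≤ N ∧ ‖lonErr P (X 0) j‖ ≤ N) :
    ‖lonErr P (X t) i‖ ≤
      (i * √(4 * (virtLip R P ^ 2 + P.k4) / P.k4) +
      (2 * (i * √(4 * (virtLip R P ^ 2 + P.k4) / 1)) +
        P.vstar * ((√((P.k1 + 1) / P.k1) + √((P.k1 + 1) / 1)) * (1 + 1 / R.w))) / sin P.eps1) * N := by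
  have k1 := P.k1_pos
  have k4 := P.k4_pos
  have hvs := P.vstar_pos
  have hw := w_pos R
  have hsin := sin_eps1_pos P
  have hi2 := Finset.mem_Icc.1 hi
  have hii : i ∈ Finset.Icc 2 i := Finset.mem_Icc.2 ⟨hi2.1, le_rfl⟩
  have hN0 : 0 ≤ N := (norm_nonneg _).trans (hN i hii).1
  have hA := virtLip_nonneg R P
  set b := 4 * (virtLip R P ^ 2 + P.k4) with hb
  have hb0 : 0 ≤ b := by positivity
  have hE : ∀ j ∈ Finset.Icc 2 i, 2 * lonEnergy P (P.estar j - P.eps) (dRho P (X t) j)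
      (nu R (X t) j) ≤ b * N ^ 2 := by
    intro j hj
    have hjn : j ∈ Finset.Icc 2 P.n := Finset.Icc_subset_Icc_right hi2.2 hj
    have h1 := h.1.lonEnergy_le isHorizon_Ici ht (h.safe_on ht) hjn
    have h2 := h.lonEnergy_initial_le hjn fun k hk =>
      hN k (Finset.Icc_subset_Icc_right (Finset.mem_Icc.1 hj).2 hk)
    linarith
  have hν : ∀ j ∈ Finset.Icc 2 i, |nu R (X t) j| ≤ √(b / 1) * N := by
    intro j hj
    refine abs_le_sqrt_mul one_pos hb0 hN0 ((le_trans ?_ (hE j hj)))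
    have : 0 ≤ P.k4 * (dRho P (X t) j - (P.estar j - P.eps)) ^ 2 := by positivity
    unfold lonEnergy
    linarith
  have hz : ∀ j ∈ Finset.Icc 2 i, |gap (X t) j - P.estar j| ≤ √(b / P.k4) * N := by
    intro j hj
    refine abs_le_sqrt_mul k4 hb0 hN0 ((le_trans ?_ (hE j hj)))
    have : gap (X t) j - P.estar j = dRho P (X t) j - (P.estar j - P.eps) := by unfold dRho; ring
    rw [this]
    unfold lonEnergy
    linarith [sq_nonneg (nu R (X t) j)]
  have hsum : ∀ (f : ℕ → ℝ) (c : ℝ), 0 ≤ c → (∀ j ∈ Finset.Icc 2 i, |f j| ≤ c) →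
      |∑ j ∈ Finset.Icc 2 i, f j| ≤ i * c := by
    intro f c hc hf
    refine (Finset.abs_sum_le_sum_abs _ _).trans ((Finset.sum_le_card_nsmul _ _ c hf).trans ?_)
    rw [nsmul_eq_mul]
    gcongr
    simp
  have e1 : |(lonErr P (X t) i).1| ≤ i * √(b / P.k4) * N := by
    rw [lonErr_fst P (X t) (by omega), abs_neg, mul_assoc]
    exact hsum _ _ (by positivity) hz
  have e2 : |vVirt R (X t i) - P.vstar| ≤ i * √(b / 1) * N := by
    rw [h.1.vVirt_sub_vstar ht (mem_of_follower hi), abs_neg, mul_assoc]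
    exact hsum _ _ (by positivity) hν
  have e3 := h.norm_latErr_le hi ht (hN i hii).1
  set a := √((P.k1 + 1) / P.k1) + √((P.k1 + 1) / 1)
  have e4 : |(X t i).y| ≤ a * N := (norm_fst_le (latErr R (X t) i)).trans e3
  have e5 : |thErr R (X t i)| ≤ a * N := (norm_snd_le (latErr R (X t) i)).trans e3
  have e6 : |(lonErr P (X t) i).2| ≤
      (2 * (i * √(b / 1)) + P.vstar * (a * (1 + 1 / R.w))) / sin P.eps1 * N := by
    refine (abs_v_sub_le R P (h.safe ht i hi).2.1
      (h.1.sin_eps1_le_cos isHorizon_Ici h.2 ht (h.safe_on ht) hi)).trans ?_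
    rw [div_mul_eq_mul_div]
    gcongr
    calc _ ≤ 2 * (i * √(b / 1) * N) + P.vstar * (a * N + a * N / R.w) := by gcongr
      _ = _ := by ring
  rw [add_mul]
  exact max_le (e1.trans (le_add_of_nonneg_right ((abs_nonneg _).trans e6)))
    (e6.trans (le_add_of_nonneg_left ((abs_nonneg _).trans e1)))

end SafeMotion

theorem originAsymptoticallyStable_of_linear_bound {R : Road} {P : Params} {E F : Type*}
    [NormedAddCommGroup E] [NormedAddCommGroup F] {z₀ : State → F} {z : State → E} {C : ℝ}
    (hC : ∀ X, SafeMotion R P X → ∀ t, 0 ≤ t → ‖z (X t)‖ ≤ C * ‖z₀ (X 0)‖)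
    (hlim : ∀ X, SafeMotion R P X → Tendsto (fun t => z (X t)) atTop (𝓝 0)) :
    OriginAsymptoticallyStable R P z₀ z := by
  refine ⟨fun η hη => ⟨η / (|C| + 1), by positivity, fun X hX hδ t ht => ?_⟩, hlim⟩
  calc ‖z (X t)‖ ≤ C * ‖z₀ (X 0)‖ := hC X hX t ht
    _ ≤ (|C| + 1) * ‖z₀ (X 0)‖ := by
        gcongr
        linarith [le_abs_self C]
    _ < (|C| + 1) * (η / (|C| + 1)) := by gcongr
    _ = η := by field_simp

theorem asymptoticallyStable_latErr (R : Road) (P : Params) {i : ℕ} (hi : i ∈ Finset.Icc 2 P.n) :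
    OriginAsymptoticallyStable R P (fun X => latErr R X i) (fun X => latErr R X i) :=
  originAsymptoticallyStable_of_linear_bound (fun _ hX _ ht => hX.norm_latErr_le hi ht le_rfl)
    fun _ hX => hX.tendsto_latErr hi

theorem asymptoticallyStable_lonErr (R : Road) (P : Params) {i : ℕ} (hi : i ∈ Finset.Icc 2 P.n) :
    OriginAsymptoticallyStable R P (chainErr R P i) (fun X => lonErr P X i) :=
  originAsymptoticallyStable_of_linear_bound (fun X hX _ ht => hX.norm_lonErr_le hi ht fun j hj => by
      have h1 := norm_le_pi_norm (chainErr R P i (X 0)) ⟨j, hj⟩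
      exact ⟨(norm_fst_le _).trans h1, (norm_snd_le _).trans h1⟩)
    fun _ hX => hX.tendsto_lonErr hi

/-! ### Bounded controls -/

def BoundedOn (f : ℝ → ℝ) (J : Set ℝ) : Prop := ∃ B : ℝ, ∀ t ∈ J, |f t| ≤ B

namespace BoundedOn
variable {f g : ℝ → ℝ} {J : Set ℝ}

theorem const (c : ℝ) : BoundedOn (fun _ => c) J := ⟨|c|, fun _ _ => le_rfl⟩

theorem add (hf : BoundedOn f J) (hg : BoundedOn g J) : BoundedOn (fun t => f t + g t) J := by
  obtain ⟨A, hA⟩ := hf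
  obtain ⟨B, hB⟩ := hg
  exact ⟨A + B, fun t ht => (abs_add_le _ _).trans (add_le_add (hA t ht) (hB t ht))⟩

theorem neg (hf : BoundedOn f J) : BoundedOn (fun t => -f t) J := by
  obtain ⟨A, hA⟩ := hf
  exact ⟨A, fun t ht => by rw [abs_neg]; exact hA t ht⟩

theorem sub (hf : BoundedOn f J) (hg : BoundedOn g J) : BoundedOn (fun t => f t - g t) J := by
  simpa only [sub_eq_add_neg] using hf.add hg.neg

theorem mul (hf : BoundedOn f J) (hg : BoundedOn g J) : BoundedOn (fun t => f t * g t) J := by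
  obtain ⟨A, hA⟩ := hf
  obtain ⟨B, hB⟩ := hg
  refine ⟨A * B, fun t ht => ?_⟩
  rw [abs_mul]
  exact mul_le_mul (hA t ht) (hB t ht) (abs_nonneg _) ((abs_nonneg _).trans (hA t ht))

theorem div (hf : BoundedOn f J) {c : ℝ} (hc : 0 < c) (hg : ∀ t ∈ J, c ≤ g t) :
    BoundedOn (fun t => f t / g t) J := by
  simp only [div_eq_mul_inv]
  refine hf.mul ⟨c⁻¹, fun t ht => ?_⟩
  rw [abs_of_nonneg (inv_nonneg.2 (hc.le.trans (hg t ht)))]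
  exact inv_anti₀ hc (hg t ht)

end BoundedOn

theorem abs_sign_le (v : ℝ) : |Real.sign v| ≤ 1 := by
  rcases Real.sign_apply_eq v with h | h | h <;> rw [h] <;> norm_num

namespace IsClosedLoop
variable {R : Road} {P : Params} {X : ℝ → State} {J : Set ℝ} {i : ℕ}

/-- The bound of `exp_le_edge_gaps` suffices on a finite horizon. On the half line it is used only
until convergence has brought `ỹ` within half the safe width. -/
theorem exists_le_edge_gaps (h : IsClosedLoop R P X J) (hJ : IsHorizon J)
    (h0 : SafeInitial R P (X 0)) (hi : i ∈ Finset.Icc 2 P.n) :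
    ∃ δ, 0 < δ ∧ ∀ t ∈ J, δ ≤ dL R (X t i) ∧ δ ≤ dR R (X t i) := by
  simp only [dL_eq, dR_eq]
  have hloc : ∀ T : ℝ, ∃ δ, 0 < δ ∧ ∀ t ∈ J, t ≤ T →
      δ ≤ safeWidth R - (X t i).y ∧ δ ≤ safeWidth R + (X t i).y := fun T =>
    ⟨_, lt_min (exp_pos _) (exp_pos _), fun t ht htT =>
      ⟨(min_le_left _ _).trans (h.exp_le_edge_gaps hJ h0 ht (h.safe_on hJ h0 ht) hi htT).1,
        (min_le_right _ _).trans (h.exp_le_edge_gaps hJ h0 ht (h.safe_on hJ h0 ht) hi htT).2⟩⟩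
  rcases id hJ with rfl | ⟨T, -, rfl⟩
  · have hm := safeWidth_pos R
    have hX : SafeMotion R P X := ⟨h, h0⟩
    obtain ⟨T, hT⟩ := eventually_atTop.1
      ((hX.tendsto_y hi).abs.eventually (gt_mem_nhds (by rw [abs_zero]; exact half_pos hm)))
    obtain ⟨δ, hδ, hle⟩ := hloc T
    refine ⟨min δ (safeWidth R / 2), lt_min hδ (half_pos hm), fun t ht => ?_⟩
    rcases le_total t T with htT | htT
    · exact ⟨(min_le_left _ _).trans (hle t ht htT).1, (min_le_left _ _).trans (hle t ht htT).2⟩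
    · have h1 := abs_lt.1 (hT t htT)
      have h2 := min_le_right δ (safeWidth R / 2)
      constructor <;> linarith
  · obtain ⟨δ, hδ, hle⟩ := hloc T
    exact ⟨δ, hδ, fun t ht => hle t ht ht.2.le⟩

theorem bounded_y (h : IsClosedLoop R P X J) (hJ : IsHorizon J) (h0 : SafeInitial R P (X 0))
    (hi : i ∈ Finset.Icc 2 P.n) : BoundedOn (fun t => (X t i).y) J :=
  ⟨_, fun _ ht => (h.safe hJ h0 ht i hi).2.1.le⟩

theorem bounded_thErr (h : IsClosedLoop R P X J) (hJ : IsHorizon J) (h0 : SafeInitial R P (X 0))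
    (hi : i ∈ Finset.Icc 2 P.n) : BoundedOn (fun t => thErr R (X t i)) J :=
  ⟨_, fun _ ht => (h.safe hJ h0 ht i hi).2.2.le⟩

theorem bounded_curv (R : Road) (X : ℝ → State) (J : Set ℝ) (i : ℕ) :
    BoundedOn (fun t => R.curv (X t i).s) J := ⟨_, fun _ _ => abs_curv_le R _⟩

theorem bounded_sign (X : ℝ → State) (J : Set ℝ) (i : ℕ) :
    BoundedOn (fun t => Real.sign (X t i).v) J := ⟨_, fun _ _ => abs_sign_le _⟩

theorem bounded_pathTerm (h : IsClosedLoop R P X J) (hJ : IsHorizon J)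
    (h0 : SafeInitial R P (X 0)) (hi : i ∈ Finset.Icc 2 P.n) :
    BoundedOn (fun t => R.curv (X t i).s * cos (thErr R (X t i)) /
      (1 - R.curv (X t i).s * (X t i).y)) J :=
  ((bounded_curv R X J i).mul ⟨1, fun _ _ => abs_cos_le_one _⟩).div (epsw_div_w_pos R)
    fun _ ht => le_one_sub_curv_mul R _ (h.safe hJ h0 ht i hi).2.1

theorem bounded_chi (h : IsClosedLoop R P X J) (hJ : IsHorizon J) (h0 : SafeInitial R P (X 0))
    (hi : i ∈ Finset.Icc 2 P.n) : BoundedOn (fun t => chi R P (X t i)) J := by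
  obtain ⟨δ, hδ, hle⟩ := h.exists_le_edge_gaps hJ h0 hi
  have hsin : BoundedOn (fun t => Real.sign (X t i).v * sin (thErr R (X t i))) J :=
    (bounded_sign X J i).mul ⟨1, fun _ _ => abs_sin_le_one _⟩
  have hnom : BoundedOn (fun t => chiNom R P (X t i)) J :=
    ((((BoundedOn.const (-P.k1)).mul ⟨1, fun _ _ => abs_sinc_le_one _⟩).mul
      (h.bounded_y hJ h0 hi)).sub
      (((BoundedOn.const P.k2).mul (bounded_sign X J i)).mul (h.bounded_thErr hJ h0 hi))).add
      (h.bounded_pathTerm hJ h0 hi)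
  exact hnom.add ((BoundedOn.const (-P.k3)).mul
    ((hsin.div hδ fun t ht => (hle t ht).2).sub (hsin.neg.div hδ fun t ht => (hle t ht).1)))

theorem bounded_nu (h : IsClosedLoop R P X J) (hJ : IsHorizon J) (h0 : SafeInitial R P (X 0))
    (hi : i ∈ Finset.Icc 2 P.n) : BoundedOn (fun t => nu R (X t) i) J :=
  ⟨_, fun _ ht => h.abs_nu_le hJ ht (h.safe_on hJ h0 ht) hi⟩

theorem bounded_gap (h : IsClosedLoop R P X J) (hJ : IsHorizon J) (h0 : SafeInitial R P (X 0))
    (hi : i ∈ Finset.Icc 2 P.n) : BoundedOn (fun t => gap (X t) i - P.estar i) J := by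
  refine ⟨√(2 * lonEnergy P (P.estar i - P.eps) (dRho P (X 0) i) (nu R (X 0) i) / P.k4),
    fun t ht => ?_⟩
  have h1 : gap (X t) i - P.estar i = dRho P (X t) i - (P.estar i - P.eps) := by unfold dRho; ring
  beta_reduce
  rw [h1]
  refine (abs_gap_le_sqrt P _ _ (nu R (X t) i)).trans ?_
  have := P.k4_pos
  gcongr
  exact h.lonEnergy_le hJ ht (h.safe_on hJ h0 ht) hi

theorem bounded_aVirt (h : IsClosedLoop R P X J) (hJ : IsHorizon J) (h0 : SafeInitial R P (X 0))
    (hi : 1 ≤ i) (hn : i ≤ P.n) : BoundedOn (fun t => aVirt R P (X t) i) J := by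
  induction i, hi using Nat.le_induction with
  | base => exact BoundedOn.const 0
  | succ k hk ih =>
    have hi : k + 1 ∈ Finset.Icc 2 P.n := Finset.mem_Icc.2 ⟨by omega, hn⟩
    have hν := h.bounded_nu hJ h0 hi
    have := ((((BoundedOn.const P.k4).mul (h.bounded_gap hJ h0 hi)).add
      ((BoundedOn.const P.k5).mul hν)).add (ih (by omega))).add
      ((BoundedOn.const P.k6).mul (hν.div (exp_pos _) fun t ht =>
        h.rhoBound_le hJ ht (h.safe_on hJ h0 ht) hi))
    simpa only [aVirt_follower R P _ (Finset.mem_Icc.1 hi).1, Nat.add_sub_cancel] using this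

theorem bounded_acc (h : IsClosedLoop R P X J) (hJ : IsHorizon J) (h0 : SafeInitial R P (X 0))
    (hi : i ∈ Finset.Icc 2 P.n) (hcurv : BoundedOn (fun t => deriv R.curv (X t i).s) J) :
    BoundedOn (fun t => acc R P (X t) i) J := by
  have hi1 := Finset.mem_Icc.1 (mem_of_follower hi)
  have hcos : ∀ t ∈ J, sin P.eps1 ≤ cos (thErr R (X t i)) := fun t ht =>
    h.sin_eps1_le_cos hJ h0 ht (h.safe_on hJ h0 ht) hi
  have hs0 := sin_eps1_pos P
  have hv : BoundedOn (fun t => (X t i).v) J :=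
    ⟨_, fun t ht => h.abs_v_le hJ h0 ht (h.safe_on hJ h0 ht) hi⟩
  have hvv : BoundedOn (fun t => vVirt R (X t i)) J :=
    ⟨_, fun t ht => h.abs_vVirt_le hJ ht (h.safe_on hJ h0 ht) (mem_of_follower hi)⟩
  have hsin : BoundedOn (fun t => sin (thErr R (X t i))) J := ⟨1, fun _ _ => abs_sin_le_one _⟩
  have hy := h.bounded_y hJ h0 hi
  have hχ := bounded_curv R X J i
  have hf : BoundedOn (fun t => 1 - R.curv (X t i).s * (X t i).y) J :=
    (BoundedOn.const 1).sub (hχ.mul hy)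
  have hrate : BoundedOn (fun t => thErrRate R P (X t i)) J :=
    hv.mul ((h.bounded_chi hJ h0 hi).sub (h.bounded_pathTerm hJ h0 hi))
  exact (((BoundedOn.const 1).div hs0 hcos).mul
    ((((h.bounded_aVirt hJ h0 hi1.1 hi1.2).mul hf).add ((hv.mul hsin).mul hrate)).sub
      (hvv.mul (((hcurv.mul hvv).mul hy).add (hχ.mul (hv.mul hsin)))))).sub
    ((BoundedOn.const P.k).mul ((hvv.mul (hf.div hs0 hcos)).sub hv))

theorem safety_claims (h : IsClosedLoop R P X J) (hJ : IsHorizon J) (h0 : SafeInitial R P (X 0))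
    (hi : i ∈ Finset.Icc 2 P.n) {t : ℝ} (ht : t ∈ J) :
    (|thErr R (X t i)| < π / 2 ∧ |R.curv (X t i).s| * |(X t i).y| < 1 ∧ 0 < dRho P (X t) i ∧
      0 < dL R (X t i) ∧ 0 < dR R (X t i)) ∧ ControlsDefined R P (X t) i := by
  have hS := h.safe hJ h0 ht
  obtain ⟨h1, h2, h3⟩ := hS i hi
  have hLR := abs_lt.1 h2
  have hL : 0 < dL R (X t i) := by rw [dL_eq]; linarith
  have hR : 0 < dR R (X t i) := by rw [dR_eq]; linarith
  have hin := (Finset.mem_Icc.1 hi).2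
  refine ⟨⟨h3, ?_, h1, hL, hR⟩, (cos_pos_of_mem_Ioo (abs_lt.1 h3)).ne',
    (one_sub_curv_mul_pos R _ h2).ne', hL.ne', hR.ne', fun j hj => ?_, fun j hj => ?_⟩
  · rw [← abs_mul]
    linarith [abs_curv_mul_lt R (X t i).s h2, epsw_div_w_pos R]
  · exact (hS j (Finset.Icc_subset_Icc_right hin hj)).1.ne'
  · exact (one_sub_curv_mul_pos R _
      (h.abs_y_lt ht hS (Finset.Icc_subset_Icc_right hin hj))).ne'

end IsClosedLoop

/-! ### Global solutions of the reduced dynamics -/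

theorem mem_interior_box {a b x : ℝ × ℝ} (h1 : a.1 < x.1) (h2 : x.1 < b.1) (h3 : a.2 < x.2)
    (h4 : x.2 < b.2) : x ∈ interior (Icc a b) := by
  rw [← Prod.mk.eta (p := a), ← Prod.mk.eta (p := b), ← Icc_prod_Icc, interior_prod_eq,
    interior_Icc, interior_Icc]
  exact ⟨⟨h1, h2⟩, ⟨h3, h4⟩⟩

theorem hasDerivWithinAt_fst {γ : ℝ → ℝ × ℝ} {γ' : ℝ × ℝ} {s : Set ℝ} {t : ℝ}
    (h : HasDerivWithinAt γ γ' s t) : HasDerivWithinAt (fun t => (γ t).1) γ'.1 s t :=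
  (ContinuousLinearMap.fst ℝ ℝ ℝ).hasFDerivAt.comp_hasDerivWithinAt t h

theorem hasDerivWithinAt_snd {γ : ℝ → ℝ × ℝ} {γ' : ℝ × ℝ} {s : Set ℝ} {t : ℝ}
    (h : HasDerivWithinAt γ γ' s t) : HasDerivWithinAt (fun t => (γ t).2) γ'.2 s t :=
  (ContinuousLinearMap.snd ℝ ℝ ℝ).hasFDerivAt.comp_hasDerivWithinAt t h

theorem exists_lon_solution (P : Params) {ds d₀ : ℝ} (hds : 0 < ds) (hd₀ : 0 < d₀) (ν₀ : ℝ) :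
    ∃ d ν : ℝ → ℝ, d 0 = d₀ ∧ ν 0 = ν₀ ∧ (∃ N, ∀ t, 0 ≤ t → |ν t| ≤ N) ∧ ∀ t, 0 ≤ t → 0 < d t ∧
      HasDerivWithinAt d (ν t) (Ici 0) t ∧
      HasDerivWithinAt ν (-(P.k4 * (d t - ds) + P.k5 * ν t + P.k6 * (ν t / d t))) (Ici 0) t := by
  set E := 2 * lonEnergy P ds d₀ ν₀ with hE
  set δ := exp (-(lonLyap P ds d₀ ν₀ / (P.k6 * ds))) with hδ
  have hδ0 : 0 < δ := exp_pos _
  set f : ℝ → ℝ × ℝ → ℝ × ℝ := fun _ x =>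
    (x.2, -(P.k4 * (x.1 - ds) + P.k5 * x.2 + P.k6 * (x.2 / x.1))) with hf
  -- Halving `δ` and adding `1` put the a priori region into the interior of the box; these bounds
  -- do not depend on time, so one box serves all horizons.
  set a : ℝ × ℝ := (δ / 2, -(√E + 1)) with ha
  set b : ℝ × ℝ := (ds + √(E / P.k4) + 1, √E + 1) with hb
  have hpos : ∀ x ∈ Icc a b, 0 < x.1 := fun x hx => (half_pos hδ0).trans_le hx.1.1
  have hmem : ∀ d ν : ℝ, lonEnergy P ds d ν ≤ lonEnergy P ds d₀ ν₀ → δ ≤ d →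
      (d, ν) ∈ interior (Icc a b) := by
    intro d ν h1 h2
    have h3 : |ν| ≤ √E := (abs_nu_le_sqrt P ds d ν).trans (Real.sqrt_le_sqrt (by linarith))
    have h4 : |d - ds| ≤ √(E / P.k4) := (abs_gap_le_sqrt P ds d ν).trans (Real.sqrt_le_sqrt (by
      have := P.k4_pos
      gcongr
      linarith))
    rw [abs_le] at h3 h4
    exact mem_interior_box (by simp only [ha]; linarith) (by simp only [hb]; linarith)
      (by simp only [ha]; linarith) (by simp only [hb]; linarith)
  have hlip : ∃ K, ∀ t, LipschitzOnWith K (f t) (Icc a b) := by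
    have hC : ContDiffOn ℝ 1 (f 0) (Icc a b) := by
      have hdiv : ContDiffOn ℝ 1 (fun x : ℝ × ℝ => x.2 / x.1) (Icc a b) :=
        contDiffOn_snd.div contDiffOn_fst fun x hx => (hpos x hx).ne'
      simp only [hf]
      fun_prop
    obtain ⟨K, hK⟩ := hC.exists_lipschitzOnWith one_ne_zero (convex_Icc a b) isCompact_Icc
    exact ⟨K, fun _ => hK⟩
  obtain ⟨K, hK⟩ := hlip
  obtain ⟨γ, h0, hm, hd⟩ := exists_global_solution (f := f) (x₀ := (d₀, ν₀)) (a := fun _ => a)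
    (b := fun _ => b) (fun T _ => ⟨K, fun t _ => hK t⟩)
    (fun T _ x _ => continuousOn_const)
    (fun T _ => hmem _ _ le_rfl (exp_le_of_lonLyap P hds hd₀))
    (fun T _ γ τ hτ _ h0 hc hm hd => by
      have hL : LonMotion P ds (fun t => (γ t).1) (fun t => (γ t).2) 0 τ :=
        ⟨continuous_fst.comp_continuousOn hc, continuous_snd.comp_continuousOn hc,
          fun t ht => hpos _ (hm t ht), fun t ht => hasDerivWithinAt_fst (hd t ht),
          fun t ht => hasDerivWithinAt_snd (hd t ht)⟩
      have h1 := hL.energy_le hτ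
      have h2 := hL.exp_le hτ hds
      rw [h0] at h1 h2
      exact hmem _ _ h1 h2)
  refine ⟨fun t => (γ t).1, fun t => (γ t).2, congrArg Prod.fst h0, congrArg Prod.snd h0, ⟨√E + 1, fun t ht => ?_⟩,
    fun t ht => ?_⟩
  · obtain ⟨-, -, hmt⟩ := hm t ht
    exact abs_le.2 ⟨hmt.1.2, hmt.2.2⟩
  · obtain ⟨-, -, hmt⟩ := hm t ht
    exact ⟨hpos _ hmt, hasDerivWithinAt_fst (hd t ht), hasDerivWithinAt_snd (hd t ht)⟩

/-- The lateral vector field for the virtual speed `p.1`, its absolute value `p.2.1` and the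
curvature `p.2.2` of the road. -/
def latField (P : Params) (m : ℝ) (z : (ℝ × ℝ × ℝ) × (ℝ × ℝ)) : ℝ × ℝ :=
  (z.1.1 * (1 - z.1.2.2 * z.2.1) / cos z.2.2 * sin z.2.2,
    -(P.k1 * sinc z.2.2 * z.2.1 * (z.1.1 * (1 - z.1.2.2 * z.2.1) / cos z.2.2)) -
      z.1.2.1 * (1 - z.1.2.2 * z.2.1) / cos z.2.2 *
        (P.k2 * z.2.2 + P.k3 * (1 / (m - z.2.1) + 1 / (m + z.2.1)) * sin z.2.2))

/-- Treating `|u|` as a parameter separate from `u` avoids the kink of the absolute value and makes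
the field continuously differentiable jointly in parameters and state. -/
theorem contDiffOn_latField (P : Params) (m : ℝ) {S : Set ((ℝ × ℝ × ℝ) × (ℝ × ℝ))}
    (h1 : ∀ z ∈ S, cos z.2.2 ≠ 0) (h2 : ∀ z ∈ S, m - z.2.1 ≠ 0) (h3 : ∀ z ∈ S, m + z.2.1 ≠ 0) :
    ContDiffOn ℝ 1 (latField P m) S := by
  have hs : ContDiffOn ℝ 1 (fun z : (ℝ × ℝ × ℝ) × (ℝ × ℝ) => sinc z.2.2) S :=
    (contDiff_sinc.comp (contDiff_snd.comp contDiff_snd)).contDiffOn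
  have hc : ContDiffOn ℝ 1 (fun z : (ℝ × ℝ × ℝ) × (ℝ × ℝ) => (cos z.2.2)⁻¹) S :=
    ContDiffOn.inv (by fun_prop) h1
  have hl : ContDiffOn ℝ 1 (fun z : (ℝ × ℝ × ℝ) × (ℝ × ℝ) => (m - z.2.1)⁻¹) S :=
    ContDiffOn.inv (by fun_prop) h2
  have hr : ContDiffOn ℝ 1 (fun z : (ℝ × ℝ × ℝ) × (ℝ × ℝ) => (m + z.2.1)⁻¹) S :=
    ContDiffOn.inv (by fun_prop) h3
  unfold latField
  simp only [div_eq_mul_inv]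
  fun_prop

/-- The virtual speed `u` and the curvature `χ` met along the road are given inputs from the
longitudinal problem; the actual speed is recovered as `u (1 - χ y) / cos θ`. -/
theorem exists_lat_solution (R : Road) (P : Params) {u χ : ℝ → ℝ} (hu : ContinuousOn u (Ici 0))
    (hχ : ContinuousOn χ (Ici 0)) {B : ℝ} (hB : ∀ t, 0 ≤ t → |u t| ≤ B)
    (hχw : ∀ t, 0 ≤ t → ∃ s, χ t = R.curv s) {y₀ θ₀ : ℝ} (hy₀ : |y₀| < safeWidth R)
    (h₀ : latEnergy P y₀ θ₀ < (π / 2 - P.eps1) ^ 2) :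
    ∃ y θ : ℝ → ℝ, y 0 = y₀ ∧ θ 0 = θ₀ ∧ ∀ t, 0 ≤ t → |y t| < safeWidth R ∧ |θ t| < π / 2 ∧
      HasDerivWithinAt y (u t * (1 - χ t * y t) / cos (θ t) * sin (θ t)) (Ici 0) t ∧
      HasDerivWithinAt θ (thField P (safeWidth R) (y t) (θ t)
        (u t * (1 - χ t * y t) / cos (θ t))) (Ici 0) t := by
  set m := safeWidth R with hmdef
  have hm0 : 0 < m := safeWidth_pos R
  have hB0 : 0 ≤ B := (abs_nonneg _).trans (hB 0 le_rfl)
  have hsin := sin_eps1_pos P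
  have k1 := P.k1_pos
  have k3 := P.k3_pos
  have heps := P.eps1_pos
  set M := B * 2 / sin P.eps1 with hM
  have hM0 : 0 ≤ M := by positivity
  set δ : ℝ → ℝ := fun T =>
    min (exp (log (m - y₀) - (π / 2 + 1) / P.k3 - logRate P m M * T))
      (exp (log (m + y₀) - (π / 2 + 1) / P.k3 - logRate P m M * T)) with hδ
  have hδ0 : ∀ T, 0 < δ T := fun T => lt_min (exp_pos _) (exp_pos _)
  set r := π / 2 - P.eps1 with hr
  -- Only the lateral sides need slack: the energy stays strictly below `r ^ 2`, which already gives
  -- `|θ| < r`.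
  set a : ℝ → ℝ × ℝ := fun T => (-(m - δ T / 2), -r) with ha
  set b : ℝ → ℝ × ℝ := fun T => (m - δ T / 2, r) with hb
  set f : ℝ → ℝ × ℝ → ℝ × ℝ := fun t x => latField P m ((u t, |u t|, χ t), x) with hf
  have hbox : ∀ T, ∀ x ∈ Icc (a T) (b T), |x.1| < m ∧ |x.2| ≤ r := by
    intro T x hx
    have := hδ0 T
    have h1 := hx.1.1
    have h2 := hx.2.1
    simp only [ha, hb] at h1 h2
    exact ⟨abs_lt.2 ⟨by linarith, by linarith⟩, abs_le.2 ⟨hx.1.2, hx.2.2⟩⟩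
  have hcos : ∀ θ : ℝ, |θ| ≤ r → sin P.eps1 ≤ cos θ := by
    intro θ hθ
    rw [← cos_pi_div_two_sub, ← cos_abs θ]
    exact cos_le_cos_of_nonneg_of_le_pi (abs_nonneg _) (by linarith [pi_pos]) hθ
  have hfac : ∀ t, 0 ≤ t → ∀ y, |y| < m → 0 < 1 - χ t * y ∧ 1 - χ t * y ≤ 2 := by
    intro t ht y hy
    obtain ⟨s, hs⟩ := hχw t ht
    rw [hs]
    exact ⟨one_sub_curv_mul_pos R s hy, one_sub_curv_mul_le R s hy⟩
  have hfield : ∀ t, 0 ≤ t → ∀ T, ∀ x ∈ Icc (a T) (b T), f t x =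
      (u t * (1 - χ t * x.1) / cos x.2 * sin x.2,
        thField P m x.1 x.2 (u t * (1 - χ t * x.1) / cos x.2)) := by
    intro t ht T x hx
    obtain ⟨h1, h2⟩ := hbox T x hx
    have h3 := hsin.trans_le (hcos _ h2)
    simp only [hf, latField, thField]
    rw [abs_div, abs_mul, abs_of_pos h3, abs_of_pos (hfac t ht _ h1).1]
  have hmem : ∀ T y θ, latEnergy P y θ < r ^ 2 → δ T ≤ m - y → δ T ≤ m + y →
      (y, θ) ∈ interior (Icc (a T) (b T)) := by
    intro T y θ h1 h2 h3
    have h4 := abs_lt.1 (abs_th_lt_of_latEnergy P h1)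
    have := hδ0 T
    exact mem_interior_box (by simp only [ha]; linarith) (by simp only [hb]; linarith) h4.1 h4.2
  have hrate0 : 0 ≤ logRate P m M := by unfold logRate; positivity
  obtain ⟨hy1, hy2⟩ := abs_lt.1 hy₀
  obtain ⟨γ, h0, hγm, hγd⟩ := exists_global_solution (f := f) (x₀ := (y₀, θ₀)) (a := a) (b := b)
    (fun T hT => by
      -- Compactness of the parameter box gives one Lipschitz constant for all times.
      set S : Set ((ℝ × ℝ × ℝ) × (ℝ × ℝ)) :=
        Icc (-B, 0, -(1 / R.w)) (B, B, 1 / R.w) ×ˢ Icc (a T) (b T) with hS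
      have hC : ContDiffOn ℝ 1 (latField P m) S := by
        refine contDiffOn_latField P m (fun z hz => ?_) (fun z hz => ?_) (fun z hz => ?_)
        · exact (hsin.trans_le (hcos _ (hbox T _ hz.2).2)).ne'
        · have := (abs_lt.1 (hbox T _ hz.2).1).2
          exact (by linarith : 0 < m - z.2.1).ne'
        · have := (abs_lt.1 (hbox T _ hz.2).1).1
          exact (by linarith : 0 < m + z.2.1).ne'
      obtain ⟨K, hK⟩ := hC.exists_lipschitzOnWith one_ne_zero
        ((convex_Icc _ _).prod (convex_Icc _ _)) (isCompact_Icc.prod isCompact_Icc)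
      refine ⟨K, fun t ht => LipschitzOnWith.of_dist_le_mul fun x hx z hz => ?_⟩
      have hp : (u t, |u t|, χ t) ∈ Icc ((-B, 0, -(1 / R.w)) : ℝ × ℝ × ℝ) (B, B, 1 / R.w) := by
        obtain ⟨s, hs⟩ := hχw t ht.1
        have h1 := abs_le.1 (hB t ht.1)
        have h2 := abs_le.1 (abs_curv_le R s)
        rw [hs]
        exact ⟨⟨h1.1, abs_nonneg _, h2.1⟩, ⟨h1.2, hB t ht.1, h2.2⟩⟩
      have := hK.dist_le_mul ((u t, |u t|, χ t), x) ⟨hp, hx⟩ ((u t, |u t|, χ t), z) ⟨hp, hz⟩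
      rwa [Prod.dist_eq (x := ((u t, |u t|, χ t), x)), dist_self,
        max_eq_right dist_nonneg] at this)
    (fun T hT x _ => by
      have h1 := hu.mono (Icc_subset_Ici_self : Icc 0 T ⊆ Ici 0)
      have h2 := hχ.mono (Icc_subset_Ici_self : Icc 0 T ⊆ Ici 0)
      simp only [hf, latField]
      fun_prop)
    (fun T hT => hmem T y₀ θ₀ h₀
      ((min_le_left _ _).trans (by
        rw [← le_log_iff_exp_le (by linarith)]
        have : 0 ≤ (π / 2 + 1) / P.k3 := by positivity
        have : 0 ≤ logRate P m M * T := by positivity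
        linarith))
      ((min_le_right _ _).trans (by
        rw [← le_log_iff_exp_le (by linarith)]
        have : 0 ≤ (π / 2 + 1) / P.k3 := by positivity
        have : 0 ≤ logRate P m M * T := by positivity
        linarith)))
    (fun T hT γ τ hτ hτT h0 hc hm hd => by
      set v : ℝ → ℝ := fun t => u t * (1 - χ t * (γ t).1) / cos (γ t).2 with hv
      have hL : LatMotion P m (fun t => (γ t).1) (fun t => (γ t).2) v 0 τ := by
        refine ⟨continuous_fst.comp_continuousOn hc, continuous_snd.comp_continuousOn hc,
          fun t ht => (hbox T _ (hm t ht)).1, fun t ht => ?_, fun t ht => ?_, fun t ht => ?_⟩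
        · linarith [(hbox T _ (hm t ht)).2]
        · have := hasDerivWithinAt_fst (hd t ht)
          rwa [hfield t ht.1 T _ (hm t ⟨ht.1, ht.2.le⟩)] at this
        · have := hasDerivWithinAt_snd (hd t ht)
          rwa [hfield t ht.1 T _ (hm t ⟨ht.1, ht.2.le⟩)] at this
      have hvM : ∀ t ∈ Ico 0 τ, |v t| ≤ M := by
        intro t ht
        obtain ⟨e1, e2⟩ := hbox T _ (hm t ⟨ht.1, ht.2.le⟩)
        have e3 := hcos _ e2
        obtain ⟨e4, e5⟩ := hfac t ht.1 _ e1
        simp only [hv, hM]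
        rw [abs_div, abs_mul, abs_of_pos e4, abs_of_pos (hsin.trans_le e3)]
        gcongr
        exact hB t ht.1
      have h1 := hL.energy_le hτ
      have h2 := hL.log_gap_ge hτ hvM
      have h3 := hL.neg.log_gap_ge hτ hvM
      simp only [sub_neg_eq_add, sub_zero, h0] at h1 h2 h3
      obtain ⟨g1, g2⟩ := hL.gaps_pos (right_mem_Icc.2 hτ)
      have hle : logRate P m M * τ ≤ logRate P m M * T := by gcongr
      refine hmem T _ _ (h1.trans_lt h₀) ((min_le_left _ _).trans ?_)
        ((min_le_right _ _).trans ?_)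
      · rw [← le_log_iff_exp_le g1]
        unfold logRate at *
        linarith
      · rw [← le_log_iff_exp_le g2]
        unfold logRate at *
        linarith)
  refine ⟨fun t => (γ t).1, fun t => (γ t).2, congrArg Prod.fst h0, congrArg Prod.snd h0, fun t ht => ?_⟩
  obtain ⟨T, -, hmt⟩ := hγm t ht
  obtain ⟨h1, h2⟩ := hbox T _ hmt
  have h3 := hγd t ht
  rw [hfield t ht T _ hmt] at h3
  exact ⟨h1, by linarith, hasDerivWithinAt_fst h3, hasDerivWithinAt_snd h3⟩

/-! ### Global motions of the closed loop -/

/-- The vehicle with path coordinates `(s, y)`, orientation error `θ` and virtual speed `u`. -/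
def ofPathState (R : Road) (s y θ u : ℝ) : VehicleState where
  px := R.cx s - y * sin (R.ang s)
  py := R.cy s + y * cos (R.ang s)
  th := θ + R.ang s
  v := u * (1 - R.curv s * y) / cos θ
  s := s
  y := y

section ofPathState
variable (R : Road) {s y θ u : ℝ}

theorem projects_ofPathState : Projects R (ofPathState R s y θ u) := ⟨rfl, rfl⟩

theorem thErr_ofPathState : thErr R (ofPathState R s y θ u) = θ := add_sub_cancel_right _ _

theorem vVirt_ofPathState (hθ : cos θ ≠ 0) (hy : 1 - R.curv s * y ≠ 0) :
    vVirt R (ofPathState R s y θ u) = u := by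
  unfold vVirt
  rw [thErr_ofPathState]
  simp only [ofPathState]
  field_simp

theorem ofPathState_eq {x : VehicleState} (hp : Projects R x) (hθ : cos (thErr R x) ≠ 0)
    (hy : 1 - R.curv x.s * x.y ≠ 0) : ofPathState R x.s x.y (thErr R x) (vVirt R x) = x := by
  obtain ⟨px, py, th, v, s, y⟩ := x
  obtain ⟨h1, h2⟩ := hp
  simp only [ofPathState, VehicleState.mk.injEq, vVirt, and_true]
  refine ⟨h1.symm, h2.symm, by unfold thErr; ring, ?_⟩
  field_simp

end ofPathState

section motion
variable (R : Road) {s y θ u : ℝ → ℝ} {J : Set ℝ} {t : ℝ}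

theorem hasDeriv_position (hθ : cos (θ t) ≠ 0) (hs : HasDerivWithinAt s (u t) J t)
    (hy : HasDerivWithinAt y
      ((ofPathState R (s t) (y t) (θ t) (u t)).v * sin (θ t)) J t) :
    HasDerivWithinAt (fun τ => (ofPathState R (s τ) (y τ) (θ τ) (u τ)).px)
        ((ofPathState R (s t) (y t) (θ t) (u t)).v *
          cos (ofPathState R (s t) (y t) (θ t) (u t)).th) J t ∧
      HasDerivWithinAt (fun τ => (ofPathState R (s τ) (y τ) (θ τ) (u τ)).py)
        ((ofPathState R (s t) (y t) (θ t) (u t)).v *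
          sin (ofPathState R (s t) (y t) (θ t) (u t)).th) J t := by
  have ha := (R.ang_deriv (s t)).comp_hasDerivWithinAt t hs
  have hv : (ofPathState R (s t) (y t) (θ t) (u t)).v * cos (θ t) =
      u t * (1 - R.curv (s t) * y t) := by
    simp only [ofPathState]; field_simp
  constructor
  · have h1 := ((R.cx_deriv (s t)).comp_hasDerivWithinAt t hs).sub (hy.mul ha.sin)
    refine h1.congr_deriv ?_
    have hth : (ofPathState R (s t) (y t) (θ t) (u t)).th = θ t + R.ang (s t) := rfl
    rw [hth, cos_add]
    simp only [Function.comp_apply]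
    linear_combination -cos (R.ang (s t)) * hv
  · have h1 := ((R.cy_deriv (s t)).comp_hasDerivWithinAt t hs).add (hy.mul ha.cos)
    refine h1.congr_deriv ?_
    have hth : (ofPathState R (s t) (y t) (θ t) (u t)).th = θ t + R.ang (s t) := rfl
    rw [hth, sin_add]
    simp only [Function.comp_apply]
    linear_combination -sin (R.ang (s t)) * hv

/-- Differentiating `v = u (1 - χ y) / cos θ` reproduces the acceleration law without its correction
term, which is zero on such states by `acc_eq_of_vVirt`. -/
theorem hasDeriv_speed {a θ' : ℝ} (hθ : cos (θ t) ≠ 0) (hs : HasDerivWithinAt s (u t) J t)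
    (hy : HasDerivWithinAt y
      ((ofPathState R (s t) (y t) (θ t) (u t)).v * sin (θ t)) J t)
    (hθ' : HasDerivWithinAt θ θ' J t) (hu : HasDerivWithinAt u a J t) :
    HasDerivWithinAt (fun τ => (ofPathState R (s τ) (y τ) (θ τ) (u τ)).v)
      (1 / cos (θ t) * (a * (1 - R.curv (s t) * y t) +
        (ofPathState R (s t) (y t) (θ t) (u t)).v * sin (θ t) * θ' -
        u t * (deriv R.curv (s t) * u t * y t +
          R.curv (s t) * ((ofPathState R (s t) (y t) (θ t) (u t)).v * sin (θ t))))) J t := by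
  have hχ := (R.curv_diff (s t)).hasDerivAt.comp_hasDerivWithinAt t hs
  have h1 := (hu.mul ((hχ.mul hy).const_sub 1)).div hθ'.cos hθ
  refine h1.congr_deriv ?_
  simp only [Pi.mul_apply, Function.comp_apply, ofPathState]
  field_simp
  ring

end motion

theorem s_eq_sub_sum (X : State) {i : ℕ} (hi : 1 ≤ i) :
    (X i).s = (X 1).s - ∑ j ∈ Finset.Icc 2 i, gap X j := by
  induction i, hi using Nat.le_induction with
  | base => simp
  | succ k hk ih =>
    rw [Finset.sum_Icc_succ_top (by omega), ← sub_sub, ← ih]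
    simp [gap]

theorem acc_eq_of_vVirt {R : Road} {P : Params} {X : State} {i : ℕ}
    (hθ : cos (thErr R (X i)) ≠ 0) (hy : 1 - R.curv (X i).s * (X i).y ≠ 0) :
    acc R P X i = 1 / cos (thErr R (X i)) *
      (aVirt R P X i * (1 - R.curv (X i).s * (X i).y)
        + (X i).v * sin (thErr R (X i)) * thErrRate R P (X i)
        - vVirt R (X i) * (curvRate R (X i) * (X i).y + R.curv (X i).s * yRate R (X i))) := by
  have hv : vVirt R (X i) * ((1 - R.curv (X i).s * (X i).y) / cos (thErr R (X i))) = (X i).v := by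
    unfold vVirt; field_simp
  unfold acc
  rw [hv, sub_self, mul_zero, sub_zero]

/-- The cascade is solved in order: spacings and relative speeds for each pair, their sums for arc
lengths and virtual speeds, then the lateral errors, from which the vehicle states are rebuilt. -/
theorem exists_motion (R : Road) (P : Params) {X₀ : State} (h₀ : SafeInitial R P X₀) :
    ∃ X : ℝ → State, X 0 = X₀ ∧ IsClosedLoop R P X (Ici 0) := by
  have hlon : ∀ j, ∃ d ν : ℝ → ℝ, j ∈ Finset.Icc 2 P.n → (d 0 = dRho P X₀ j ∧ ν 0 = nu R X₀ j ∧
      (∃ N, ∀ t, 0 ≤ t → |ν t| ≤ N) ∧ ∀ t, 0 ≤ t → 0 < d t ∧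
      HasDerivWithinAt d (ν t) (Ici 0) t ∧
      HasDerivWithinAt ν (-(P.k4 * (d t - (P.estar j - P.eps)) + P.k5 * ν t +
        P.k6 * (ν t / d t))) (Ici 0) t) := by
    intro j
    by_cases hj : j ∈ Finset.Icc 2 P.n
    · obtain ⟨d, ν, h⟩ := exists_lon_solution P (dstar_pos hj) (h₀.rho_pos j hj) (nu R X₀ j)
      exact ⟨d, ν, fun _ => h⟩
    · exact ⟨0, 0, fun h => absurd h hj⟩
  choose d ν hdν using hlon
  set s : ℕ → ℝ → ℝ := fun i t =>
    (X₀ 1).s + P.vstar * t - ∑ j ∈ Finset.Icc 2 i, (d j t + P.eps) with hs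
  set u : ℕ → ℝ → ℝ := fun i t => P.vstar - ∑ j ∈ Finset.Icc 2 i, ν j t with hu
  have hsub : ∀ i ∈ Finset.Icc 1 P.n, ∀ j ∈ Finset.Icc 2 i, j ∈ Finset.Icc 2 P.n :=
    fun i hi j hj => Finset.Icc_subset_Icc_right (Finset.mem_Icc.1 hi).2 hj
  have hsd : ∀ i ∈ Finset.Icc 1 P.n, ∀ t, 0 ≤ t → HasDerivWithinAt (s i) (u i t) (Ici 0) t := by
    intro i hi t ht
    have h1 := HasDerivWithinAt.fun_sum (u := Finset.Icc 2 i) fun j hj =>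
      (((hdν j (hsub i hi j hj)).2.2.2 t ht).2.1).add_const P.eps
    have h2 := ((hasDerivWithinAt_id t (Ici 0)).const_mul P.vstar).const_add (X₀ 1).s
    refine (h2.sub h1).congr_deriv ?_
    rw [mul_one]
  have hud : ∀ i ∈ Finset.Icc 1 P.n, ∀ t, 0 ≤ t → HasDerivWithinAt (u i)
      (∑ j ∈ Finset.Icc 2 i, (P.k4 * (d j t - (P.estar j - P.eps)) + P.k5 * ν j t +
        P.k6 * (ν j t / d j t))) (Ici 0) t := by
    intro i hi t ht
    have h1 := HasDerivWithinAt.fun_sum (u := Finset.Icc 2 i) fun j hj =>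
      ((hdν j (hsub i hi j hj)).2.2.2 t ht).2.2
    refine (h1.const_sub P.vstar).congr_deriv ?_
    rw [Finset.sum_neg_distrib, neg_neg]
  have hub : ∀ i ∈ Finset.Icc 1 P.n, ∃ B, ∀ t, 0 ≤ t → |u i t| ≤ B := by
    intro i hi
    have : ∀ j, ∃ N, j ∈ Finset.Icc 2 i → ∀ t, 0 ≤ t → |ν j t| ≤ N := by
      intro j
      by_cases hj : j ∈ Finset.Icc 2 i
      · obtain ⟨N, hN⟩ := (hdν j (hsub i hi j hj)).2.2.1
        exact ⟨N, fun _ => hN⟩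
      · exact ⟨0, fun h => absurd h hj⟩
    choose N hN using this
    refine ⟨|P.vstar| + ∑ j ∈ Finset.Icc 2 i, N j, fun t ht => (abs_sub _ _).trans ?_⟩
    gcongr
    exact (Finset.abs_sum_le_sum_abs _ _).trans (Finset.sum_le_sum fun j hj => hN j hj t ht)
  -- The zero functions chosen outside the followers are exactly the lateral motion of the leader.
  have hlat : ∀ i, ∃ y θ : ℝ → ℝ,
      (i ∈ Finset.Icc 2 P.n → (y 0 = (X₀ i).y ∧ θ 0 = thErr R (X₀ i) ∧
        ∀ t, 0 ≤ t → |y t| < safeWidth R ∧ |θ t| < π / 2 ∧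
        HasDerivWithinAt y (u i t * (1 - R.curv (s i t) * y t) / cos (θ t) * sin (θ t)) (Ici 0) t ∧
        HasDerivWithinAt θ (thField P (safeWidth R) (y t) (θ t)
          (u i t * (1 - R.curv (s i t) * y t) / cos (θ t))) (Ici 0) t)) ∧
      (i ∉ Finset.Icc 2 P.n → y = 0 ∧ θ = 0) := by
    intro i
    by_cases hi : i ∈ Finset.Icc 2 P.n
    · have hi1 := mem_of_follower hi
      obtain ⟨B, hB⟩ := hub i hi1
      obtain ⟨y, θ, h⟩ := exists_lat_solution R P (u := u i) (χ := fun t => R.curv (s i t))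
        (fun t ht => (hud i hi1 t ht).continuousWithinAt)
        (R.curv_diff.continuous.comp_continuousOn
          fun t ht => (hsd i hi1 t ht).continuousWithinAt) hB (fun t _ => ⟨_, rfl⟩)
        (h₀.abs_y_lt hi) (h₀.latEnergy_lt hi)
      exact ⟨y, θ, fun _ => h, fun h => absurd hi h⟩
    · exact ⟨0, 0, fun h => absurd h hi, fun _ => ⟨rfl, rfl⟩⟩
  choose y θ hyθ using hlat
  have h1n : 1 ∉ Finset.Icc 2 P.n := fun h => absurd (Finset.mem_Icc.1 h).1 (by norm_num)
  obtain ⟨hy1, hθ1⟩ := (hyθ 1).2 h1n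
  have hs1 : ∀ t, s 1 t = (X₀ 1).s + P.vstar * t := fun t => by simp [hs]
  have hu1 : ∀ t, u 1 t = P.vstar := fun t => by simp [hu]
  have hyt : ∀ i ∈ Finset.Icc 1 P.n, ∀ t, 0 ≤ t → |y i t| < safeWidth R ∧ |θ i t| < π / 2 ∧
      HasDerivWithinAt (y i)
        ((ofPathState R (s i t) (y i t) (θ i t) (u i t)).v * sin (θ i t)) (Ici 0) t := by
    intro i hi t ht
    rcases eq_one_or_follower hi with rfl | hi
    · rw [hy1, hθ1]
      refine ⟨?_, ?_, ?_⟩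
      · simpa using safeWidth_pos R
      · simpa using half_pos pi_pos
      · refine (hasDerivWithinAt_const t (Ici 0) (0 : ℝ)).congr_deriv ?_
        simp
    · obtain ⟨h1, h2, h3, -⟩ := ((hyθ i).1 hi).2.2 t ht
      exact ⟨h1, h2, h3⟩
  have hcos : ∀ i ∈ Finset.Icc 1 P.n, ∀ t, 0 ≤ t → cos (θ i t) ≠ 0 := fun i hi t ht =>
    (cos_pos_of_mem_Ioo (abs_lt.1 (hyt i hi t ht).2.1)).ne'
  have hfac : ∀ i ∈ Finset.Icc 1 P.n, ∀ t, 0 ≤ t → 1 - R.curv (s i t) * y i t ≠ 0 :=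
    fun i hi t ht => (one_sub_curv_mul_pos R _ (hyt i hi t ht).1).ne'
  -- Entries that are not vehicles stay frozen, so that `X 0 = X₀` holds for all indices.
  set X : ℝ → State := fun t i =>
    if i ∈ Finset.Icc 1 P.n then ofPathState R (s i t) (y i t) (θ i t) (u i t) else X₀ i with hX
  have hXi : ∀ i ∈ Finset.Icc 1 P.n, ∀ t,
      X t i = ofPathState R (s i t) (y i t) (θ i t) (u i t) := fun i hi t => if_pos hi
  have hXs : ∀ i ∈ Finset.Icc 1 P.n, ∀ t, (X t i).s = s i t := fun i hi t => by
    rw [hXi i hi]; rfl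
  have hXv : ∀ i ∈ Finset.Icc 1 P.n, ∀ t, 0 ≤ t → vVirt R (X t i) = u i t := fun i hi t ht => by
    rw [hXi i hi]; exact vVirt_ofPathState R (hcos i hi t ht) (hfac i hi t ht)
  have hdRho : ∀ j ∈ Finset.Icc 2 P.n, ∀ t, dRho P (X t) j = d j t := by
    intro j hj t
    obtain ⟨k, rfl⟩ := Nat.exists_eq_add_of_le' (Finset.mem_Icc.1 hj).1
    unfold dRho gap
    rw [hXs _ (pred_mem hj), hXs _ (mem_of_follower hj)]
    simp only [hs, show k + 2 - 1 = k + 1 from rfl,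
      Finset.sum_Icc_succ_top (show 2 ≤ k + 1 + 1 by omega)]
    ring
  have hnu : ∀ j ∈ Finset.Icc 2 P.n, ∀ t, 0 ≤ t → nu R (X t) j = ν j t := by
    intro j hj t ht
    obtain ⟨k, rfl⟩ := Nat.exists_eq_add_of_le' (Finset.mem_Icc.1 hj).1
    unfold nu
    rw [hXv _ (pred_mem hj) t ht, hXv _ (mem_of_follower hj) t ht]
    simp only [hu, show k + 2 - 1 = k + 1 from rfl,
      Finset.sum_Icc_succ_top (show 2 ≤ k + 1 + 1 by omega)]
    ring
  -- Unrolling the recursion gives the derivative of `u i` found in `hud`.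
  have haV : ∀ i, 1 ≤ i → i ≤ P.n → ∀ t, 0 ≤ t → aVirt R P (X t) i =
      ∑ j ∈ Finset.Icc 2 i, (P.k4 * (d j t - (P.estar j - P.eps)) + P.k5 * ν j t +
        P.k6 * (ν j t / d j t)) := by
    intro i hi
    induction i, hi using Nat.le_induction with
    | base => exact fun _ t _ => by simp [aVirt]
    | succ k hk ih =>
      intro hn t ht
      have hj : k + 1 ∈ Finset.Icc 2 P.n := Finset.mem_Icc.2 ⟨by omega, hn⟩
      have hg : gap (X t) (k + 1) = d (k + 1) t + P.eps := by
        rw [← hdRho _ hj]; unfold dRho; ring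
      rw [aVirt_follower R P _ (by omega), Finset.sum_Icc_succ_top (by omega), Nat.add_sub_cancel,
        ih (by omega) t ht, hnu _ hj t ht, hdRho _ hj, hg]
      ring
  refine ⟨X, ?_, ?_⟩
  · funext i
    by_cases hi : i ∈ Finset.Icc 1 P.n
    · rw [hXi i hi]
      have hi1 := (Finset.mem_Icc.1 hi).1
      have es : s i 0 = (X₀ i).s := by
        rw [s_eq_sub_sum X₀ hi1]
        simp only [hs, mul_zero, add_zero]
        congr 1
        refine Finset.sum_congr rfl fun j hj => ?_
        rw [(hdν j (hsub i hi j hj)).1]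
        unfold dRho; ring
      have eu : u i 0 = vVirt R (X₀ i) := by
        rw [vVirt_eq_sub_sum R X₀ hi1, vVirt_of_onTrack h₀.leader_track]
        simp only [hu]
        congr 1
        exact Finset.sum_congr rfl fun j hj => (hdν j (hsub i hi j hj)).2.1
      have eyθ : y i 0 = (X₀ i).y ∧ θ i 0 = thErr R (X₀ i) := by
        rcases eq_one_or_follower hi with rfl | hi
        · rw [hy1, hθ1, h₀.leader_track.1, h₀.leader_track.2.1]
          exact ⟨rfl, rfl⟩
        · exact ⟨((hyθ i).1 hi).1, ((hyθ i).1 hi).2.1⟩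
      have hc := hcos i hi 0 le_rfl
      have hf := hfac i hi 0 le_rfl
      rw [eyθ.2] at hc
      rw [es, eyθ.1] at hf
      rw [es, eu, eyθ.1, eyθ.2]
      exact ofPathState_eq R (h₀.projects i hi) hc hf
    · exact if_neg hi
  · have hpos : ∀ i ∈ Finset.Icc 1 P.n, ∀ t ∈ Ici (0 : ℝ),
        HasDerivWithinAt (fun τ => (X τ i).px) ((X t i).v * cos (X t i).th) (Ici 0) t ∧
        HasDerivWithinAt (fun τ => (X τ i).py) ((X t i).v * sin (X t i).th) (Ici 0) t := by
      intro i hi t ht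
      simp only [hXi i hi]
      exact hasDeriv_position R (hcos i hi t ht) (hsd i hi t ht) (hyt i hi t ht).2.2
    refine ⟨fun i hi t _ => ?_, fun i hi t ht => ?_, fun i hi t ht => ?_, ?_, fun t ht => ?_,
      fun t ht => ?_, fun i hi t ht => ?_⟩
    · rw [hXi i hi]
      exact projects_ofPathState R
    · simp only [hXs i hi]
      exact (hsd i hi t ht).continuousWithinAt
    · simp only [hXi i hi]
      exact (hyt i hi t ht).2.2.continuousWithinAt
    · have hm := one_mem P
      refine ⟨fun _ => 0, fun t => R.curv (s 1 t), fun t ht => ⟨(hpos 1 hm t ht).1,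
        (hpos 1 hm t ht).2, ?_, ?_⟩⟩
      · simp only [hXi 1 hm, ofPathState, hy1, hθ1, hu1]
        simpa using hasDerivWithinAt_const t (Ici 0) P.vstar
      · have h1 := (R.ang_deriv (s 1 t)).comp_hasDerivWithinAt t (hsd 1 hm t ht)
        simp only [hXi 1 hm, ofPathState, hy1, hθ1, hu1]
        rw [hu1] at h1
        simpa [mul_comm, Function.comp_def] using h1
    · rw [hXi 1 (one_mem P)]
      refine ⟨?_, ?_, ?_⟩
      · simp [ofPathState, hy1]
      · simp [thErr_ofPathState, hθ1]
      · simp [ofPathState, hy1, hθ1, hu1]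
    · simp only [hXs 1 (one_mem P), hs1]
      ring
    · have hi1 := mem_of_follower hi
      obtain ⟨-, -, -, hθd⟩ := ((hyθ i).1 hi).2.2 t ht
      have hth : ∀ τ, thErr R (X τ i) = θ i τ := fun τ => by
        rw [hXi i hi1, thErr_ofPathState]
      have hrate : thErrRate R P (X t i) = thField P (safeWidth R) (y i t) (θ i t)
          (u i t * (1 - R.curv (s i t) * y i t) / cos (θ i t)) := by
        rw [thErrRate_eq, hth, hXi i hi1]; rfl
      rw [← hrate] at hθd
      have hu' := hud i hi1 t ht
      rw [← haV i (Finset.mem_Icc.1 hi1).1 (Finset.mem_Icc.1 hi1).2 t ht] at hu'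
      refine ⟨(hpos i hi1 t ht).1, (hpos i hi1 t ht).2, ?_, ?_⟩
      · have h1 := hasDeriv_speed R (hcos i hi1 t ht) (hsd i hi1 t ht) (hyt i hi1 t ht).2.2 hθd hu'
        have hc : cos (thErr R (X t i)) ≠ 0 := by rw [hth]; exact hcos i hi1 t ht
        have hf : 1 - R.curv (X t i).s * (X t i).y ≠ 0 := by
          rw [hXi i hi1]; exact hfac i hi1 t ht
        simp only [← hXi i hi1] at h1
        refine h1.congr_deriv ?_
        beta_reduce
        rw [acc_eq_of_vVirt hc hf]
        unfold curvRate yRate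
        rw [hXv i hi1 t ht, hth, hXs i hi1]
        have : (X t i).y = y i t := by rw [hXi i hi1]; rfl
        rw [this]
      · have h1 := hθd.add ((R.ang_deriv (s i t)).comp_hasDerivWithinAt t (hsd i hi1 t ht))
        have hfun : (fun τ => (X τ i).th) = fun τ => θ i τ + R.ang (s i τ) := by
          funext τ; rw [hXi i hi1]; rfl
        beta_reduce
        rw [hfun]
        refine h1.congr_deriv ?_
        unfold thErrRate
        have : vVirt R (X t i) = (X t i).v * (cos (thErr R (X t i)) /
            (1 - R.curv (X t i).s * (X t i).y)) := by unfold vVirt; ring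
        rw [← hXv i hi1 t ht, this, hXs i hi1]
        ring

end Platoon

end

theorem theorem1 (R : Platoon.Road) (P : Platoon.Params) :
    -- the closed-loop system has a motion for all times `t ≥ 0` from all safe initial conditions
    (∀ X₀ : Platoon.State, Platoon.SafeInitial R P X₀ →
      ∃ X : ℝ → Platoon.State, X 0 = X₀ ∧ Platoon.IsClosedLoop R P X (Set.Ici 0)) ∧
    -- safety and bounded controls, along every motion on `[0, T)`, `0 < T ≤ ∞`
    (∀ (J : Set ℝ) (X : ℝ → Platoon.State), Platoon.IsHorizon J → Platoon.IsClosedLoop R P X J →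
      Platoon.SafeInitial R P (X 0) → ∀ i ∈ Finset.Icc 2 P.n,
        (∀ t ∈ J, |Platoon.thErr R (X t i)| < Real.pi / 2 ∧
          |R.curv (X t i).s| * |(X t i).y| < 1 ∧
          0 < Platoon.dRho P (X t) i ∧
          0 < Platoon.dL R (X t i) ∧ 0 < Platoon.dR R (X t i)) ∧
        (∀ t ∈ J, Platoon.ControlsDefined R P (X t) i) ∧
        (∃ B : ℝ, ∀ t ∈ J, |Platoon.chi R P (X t i)| ≤ B) ∧
        -- the curvature rate `dχ^r/ds` enters `a_i` and has to be bounded on the road travelled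
        ((∃ C : ℝ, ∀ t ∈ J, |deriv R.curv (X t i).s| ≤ C) →
          ∃ B : ℝ, ∀ t ∈ J, |Platoon.acc R P (X t) i| ≤ B)) ∧
    -- asymptotic stability of the lateral and of the longitudinal errors
    (∀ i ∈ Finset.Icc 2 P.n,
      Platoon.OriginAsymptoticallyStable R P
        (fun X => Platoon.latErr R X i) (fun X => Platoon.latErr R X i) ∧
      Platoon.OriginAsymptoticallyStable R P
        (Platoon.chainErr R P i) (fun X => Platoon.lonErr P X i)) := by
  refine ⟨fun X₀ h₀ => Platoon.exists_motion R P h₀, fun J X hJ h h₀ i hi => ?_, fun i hi => ?_⟩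
  · exact ⟨fun t ht => (h.safety_claims hJ h₀ hi ht).1, fun t ht => (h.safety_claims hJ h₀ hi ht).2,
      h.bounded_chi hJ h₀ hi, h.bounded_acc hJ h₀ hi⟩
  · exact ⟨Platoon.asymptoticallyStable_latErr R P hi, Platoon.asymptoticallyStable_lonErr R P hi⟩
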